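/- Let $\mathcal V$ be a (locally small) cartesian closed category with pullbacks which is \emph{extensive}: it has small coproducts, and for each small family $(X_j)_j$ of objects the functor $\coprod\colon \prod_j \mathcal V_{/X_j}\to \mathcal V_{/\coprod_j X_j}$ is an equivalence of categories. Write $\ast$ for the terminal object and $[X,Y]$ for the internal hom of $\mathcal V$. \textbf{Enriched notions.} Let $\mathcal I,\mathcal C$ be small $\mathcal V$-categories such that the $\mathcal V$-category $\mathcal C^{\mathcal I}$ of $\mathcal V$-functors $\mathcal I\to\mathcal C$ exists, i.e. for all $F,G\colon\mathcal I\to\mathcal C$ the hom-object $\mathcal C^{\mathcal I}(F,G)$, the limit of the diagram $\prod_i\mathcal C(Fi,Gi)\rightrightarrows\prod_{i,j}[\mathcal I(i,j),\mathcal C(Fi,Gj)]$, exists in $\mathcal V$ (automatic if $\mathcal V$ has small products). Let $\Delta\colon\mathcal C\to\mathcal C^{\mathcal I}$ be the diagonal $\mathcal V$-functor, let $G\colon\mathcal I\to\mathcal C$ be a $\mathcal V$-functor, let $L\in\mathcal C$, and let $\lambda\colon\Delta L\Rightarrow G$ be a $\mathcal V$-natural transformation. The pair $(L,\lambda)$ is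 a (conical) \emph{$\mathcal V$-limit} of $G$ if the $\mathcal V$-natural transformation $\mathcal C(-,L)\Rightarrow\mathcal C^{\mathcal I}(\Delta(-),G)$ of $\mathcal V$-functors $\mathcal C^{\mathrm{op}}\to\mathcal V$ that corresponds by the enriched Yoneda lemma to the element $\lambda\colon\ast\to\mathcal C^{\mathcal I}(\Delta L,G)$ is an isomorphism. An object $T$ of a $\mathcal V$-category $\mathcal D$ is \emph{$\mathcal V$-terminal} if $\mathcal D(A,T)\to\ast$ is an isomorphism for all $A\in\mathcal D$. \textbf{Internal notions.} $\mathrm{Cat}(\mathcal V)$ is the category of internal categories $\mathbb A=(\mathbb A_0,\mathbb A_1,s,t,i,c)$ to $\mathcal V$ and internal functors, and $\llbracket-,-\rrbracket$ is its internal hom. An \emph{element} of $\mathbb A$ is a map $\ast\to\mathbb A_0$. For $X\in\mathcal V$, $\mathrm{cst}X$ is the internal category with $\mathbb A_0=\mathbb A_1=X$ all of whose structure maps are identities. The underlying $\mathcal V$-category $\mathrm{Und}\,\mathbb A$ has the elements of $\mathbb A$ as objects, and its hom-object from $a$ to $b$ is the pullback of $(s,t)\colon\mathbb A_1\to\mathbb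 A_0\times\mathbb A_0$ along $(a,b)\colon\ast\to\mathbb A_0\times\mathbb A_0$. The internalization $\mathrm{Int}\,\mathcal D$ of a small $\mathcal V$-category $\mathcal D$ has $(\mathrm{Int}\,\mathcal D)_0=\coprod_{A}\ast$ and $(\mathrm{Int}\,\mathcal D)_1=\coprod_{A,B}\mathcal D(A,B)$, with structure maps induced by those of $\mathcal D$; it is functorial in $\mathcal V$-functors. Let $\mathbb 2=\mathrm{Int}$ of the $\mathcal V$-category with objects $0,1$, with hom-objects $\ast$ from $0$ to $0$, from $0$ to $1$ and from $1$ to $1$, and with the initial object as hom-object from $1$ to $0$. For an internal functor $H\colon\mathbb A\to\mathbb B$ and an element $b$ of $\mathbb B$, the comma internal category $H\downarrow b$ is the pullback of $H\times b\colon\mathbb A\to\mathbb B\times\mathbb B$ along $\langle0,1\rangle^*\colon\llbracket\mathbb 2,\mathbb B\rrbracket\to\mathbb B\times\mathbb B$. An element $T$ of $\mathbb A$ is an \emph{internal terminal object} if the projection $\mathbb A_{/T}:=\mathrm{id}_{\mathbb A}\downarrow T\to\mathbb A$ is an isomorphism in $\mathrm{Cat}(\mathcal V)$. Consider the internal category of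 cones $\mathrm{Int}\,\Delta\downarrow G$, the comma internal category of $\mathrm{Int}\,\Delta\colon\mathrm{Int}\,\mathcal C\to\mathrm{Int}(\mathcal C^{\mathcal I})$ and the element $G$ of $\mathrm{Int}(\mathcal C^{\mathcal I})$. The pair $(L,\lambda)$ is an element of it. For $X\in\mathcal V$ it yields an element of $\llbracket\mathrm{cst}X,\mathrm{Int}\,\Delta\downarrow G\rrbracket$, again written $(L,\lambda)$, by precomposition with $\mathrm{cst}X\to\ast$. Finally, let $\mathcal G$ be a \emph{conservative family} of objects of $\mathcal V$: a map $f\colon Y\to Z$ in $\mathcal V$ is an isomorphism if and only if $f\circ-\colon\mathcal V(X,Y)\to\mathcal V(X,Z)$ is a bijection for all $X\in\mathcal G$. \textbf{Statement.} The following are equivalent: \begin{enumerate} \item[(i)] $(L,\lambda)$ is a $\mathcal V$-limit of $G$; \item[(ii)] $(L,\lambda)$ is an internal terminal object in $\mathrm{Int}\,\Delta\downarrow G$; \item[(iii)] for each $X\in\mathcal G$, $(L,\lambda)$ is a $\mathcal V$-terminal object in the $\mathcal V$-category $\mathrm{Und}\llbracket\mathrm{cst}X,\mathrm{Int}\,\Delta\downarrow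 G\rrbracket$. \end{enumerate} -/

import Mathlib

open CategoryTheory Limits MonoidalCategory CartesianMonoidalCategory

universe v u

namespace EnrInt

noncomputable section

/-! ### Extensive categories -/

section Extensivity

variable {V : Type u} [Category.{v} V]

/-- The functor `∐ : ∏ᵢ V/Xᵢ ⥤ V/∐ᵢ Xᵢ`. -/
def overCoproduct [HasCoproducts.{v} V] {J : Type v} (X : J → V) :
    (∀ j, Over (X j)) ⥤ Over (∐ X) where
  obj F := Over.mk (Limits.Sigma.map fun j => (F j).hom)
  map φ := Over.homMk (Limits.Sigma.map fun j => (φ j).left) (by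
    apply Limits.Sigma.hom_ext
    intro j
    simp)
  map_id F := by
    ext
    apply Limits.Sigma.hom_ext
    intro j
    simp
  map_comp φ ψ := by
    ext
    apply Limits.Sigma.hom_ext
    intro j
    simp

/-- A category is extensive if it has small coproducts and each functor
`∐ : ∏ᵢ V/Xᵢ ⥤ V/∐ᵢ Xᵢ` is an equivalence of categories. -/
class Extensive (V : Type u) [Category.{v} V] : Prop where
  hasCoproducts : HasCoproducts.{v} V
  isEquivalence : ∀ {J : Type v} (X : J → V), (overCoproduct X).IsEquivalence

attribute [instance] Extensive.hasCoproducts Extensive.isEquivalence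

variable [Extensive V] {J : Type v} {X W : J → V}

theorem exists_family {W' : J → V} (p : ∀ j, W j ⟶ X j) (p' : ∀ j, W' j ⟶ X j)
    (f : ∐ W ⟶ ∐ W') (h : f ≫ Limits.Sigma.map p' = Limits.Sigma.map p) :
    ∃ φ : ∀ j, W j ⟶ W' j, (∀ j, φ j ≫ p' j = p j) ∧
      ∀ j, φ j ≫ Limits.Sigma.ι W' j = Limits.Sigma.ι W j ≫ f := by
  let F : ∀ j, Over (X j) := fun j => Over.mk (p j)
  let F' : ∀ j, Over (X j) := fun j => Over.mk (p' j)
  let f' : (overCoproduct X).obj F ⟶ (overCoproduct X).obj F' := Over.homMk f h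
  have hg : (overCoproduct X).map ((overCoproduct X).preimage f') = f' :=
    (overCoproduct X).map_preimage f'
  refine ⟨fun j => ((overCoproduct X).preimage f' j).left,
    fun j => Over.w ((overCoproduct X).preimage f' j), fun j => ?_⟩
  have h2 : Limits.Sigma.map (fun j => ((overCoproduct X).preimage f' j).left) = f :=
    congrArg (fun q => q.left) hg
  rw [← h2]
  exact (Limits.Sigma.ι_map (fun j => ((overCoproduct X).preimage f' j).left) j).symm

theorem family_unique {W' : J → V} (p : ∀ j, W j ⟶ X j) (p' : ∀ j, W' j ⟶ X j)
    (φ ψ : ∀ j, W j ⟶ W' j) (hφ : ∀ j, φ j ≫ p' j = p j) (hψ : ∀ j, ψ j ≫ p' j = p j)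
    (h : ∀ j, φ j ≫ Limits.Sigma.ι W' j = ψ j ≫ Limits.Sigma.ι W' j) : φ = ψ := by
  let F : ∀ j, Over (X j) := fun j => Over.mk (p j)
  let F' : ∀ j, Over (X j) := fun j => Over.mk (p' j)
  let f : F ⟶ F' := fun j => Over.homMk (φ j) (hφ j)
  let g : F ⟶ F' := fun j => Over.homMk (ψ j) (hψ j)
  have hfg : f = g := (overCoproduct X).map_injective (by
    ext1
    change Limits.Sigma.map φ = Limits.Sigma.map ψ
    apply Limits.Sigma.hom_ext
    intro j
    simpa using h j)
  funext j
  exact congrArg (fun q : F ⟶ F' => (q j).left) hfg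

/-- The family of objects which is `T` in degree `j` and initial in all other degrees. -/
abbrev singleFamily (T : V) (j k : J) : V :=
  ∐ fun _ : ULift.{v} (PLift (j = k)) => T

theorem exists_factor (p : ∀ j, W j ⟶ X j) {T : V} (w : T ⟶ ∐ W) {j : J} (x : T ⟶ X j)
    (h : w ≫ Limits.Sigma.map p = x ≫ Limits.Sigma.ι X j) :
    ∃ w' : T ⟶ W j, w' ≫ Limits.Sigma.ι W j = w ∧ w' ≫ p j = x := by
  obtain ⟨φ, h1, h2⟩ := exists_family (W := singleFamily T j)
    (fun k => Limits.Sigma.desc (fun h => x ≫ eqToHom (congrArg X h.down.down))) p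
    (Limits.Sigma.desc fun k => Limits.Sigma.desc fun _ => w) (by
      apply Limits.Sigma.hom_ext
      intro k
      apply Limits.Sigma.hom_ext
      rintro ⟨⟨rfl⟩⟩
      rw [Limits.Sigma.ι_desc_assoc, Limits.Sigma.ι_desc_assoc, Limits.Sigma.ι_map,
        Limits.Sigma.ι_desc_assoc, h, eqToHom_refl, Category.comp_id])
  refine ⟨Limits.Sigma.ι (fun _ : ULift.{v} (PLift (j = j)) => T) ⟨⟨rfl⟩⟩ ≫ φ j, ?_, ?_⟩
  · rw [Category.assoc, h2, Limits.Sigma.ι_desc, Limits.Sigma.ι_desc]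
  · rw [Category.assoc, h1, Limits.Sigma.ι_desc, eqToHom_refl, Category.comp_id]

theorem factor_unique (p : ∀ j, W j ⟶ X j) {T : V} {j : J} (a b : T ⟶ W j)
    (h : a ≫ Limits.Sigma.ι W j = b ≫ Limits.Sigma.ι W j) (h' : a ≫ p j = b ≫ p j) : a = b := by
  have key := family_unique (W := singleFamily T j)
    (fun k => Limits.Sigma.desc (fun h => a ≫ p j ≫ eqToHom (congrArg X h.down.down))) p
    (fun k => Limits.Sigma.desc (fun h => a ≫ eqToHom (congrArg W h.down.down)))
    (fun k => Limits.Sigma.desc (fun h => b ≫ eqToHom (congrArg W h.down.down)))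
    (fun k => by
      apply Limits.Sigma.hom_ext
      rintro ⟨⟨rfl⟩⟩
      rw [Limits.Sigma.ι_desc_assoc, Limits.Sigma.ι_desc]
      simp)
    (fun k => by
      apply Limits.Sigma.hom_ext
      rintro ⟨⟨rfl⟩⟩
      rw [Limits.Sigma.ι_desc_assoc, Limits.Sigma.ι_desc]
      simp [h'])
    (fun k => by
      apply Limits.Sigma.hom_ext
      rintro ⟨⟨rfl⟩⟩
      rw [Limits.Sigma.ι_desc_assoc, Limits.Sigma.ι_desc_assoc]
      simp [h])
  have h3 := congrArg (fun q => Limits.Sigma.ι (fun _ : ULift.{v} (PLift (j = j)) => T)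
    ⟨⟨rfl⟩⟩ ≫ q) (congrFun key j)
  simp only [Limits.Sigma.ι_desc, eqToHom_refl, Category.comp_id] at h3
  exact h3

/-- Every map into a coproduct decomposes its domain as a coproduct. -/
theorem exists_decomposition {Y : V} (g : Y ⟶ ∐ X) :
    ∃ (W : J → V) (p : ∀ j, W j ⟶ X j) (e : ∐ W ≅ Y), e.hom ≫ g = Limits.Sigma.map p := by
  refine ⟨fun j => ((overCoproduct X).objPreimage (Over.mk g) j).left,
    fun j => ((overCoproduct X).objPreimage (Over.mk g) j).hom,
    (Over.forget _).mapIso ((overCoproduct X).objObjPreimageIso (Over.mk g)), ?_⟩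
  exact Over.w ((overCoproduct X).objObjPreimageIso (Over.mk g)).hom

theorem hom_ext_of_coproduct {Y Z : V} (g : Y ⟶ ∐ X) {a b : Y ⟶ Z}
    (h : ∀ (j : J) (T : V) (y : T ⟶ Y) (x : T ⟶ X j), y ≫ g = x ≫ Limits.Sigma.ι X j →
      y ≫ a = y ≫ b) : a = b := by
  obtain ⟨W, p, e, he⟩ := exists_decomposition g
  rw [← cancel_epi e.hom]
  apply Limits.Sigma.hom_ext
  intro j
  have := h j _ (Limits.Sigma.ι W j ≫ e.hom) (p j) (by simp [he])
  simpa using this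

end Extensivity

/-! ### Internal categories -/

section Internal

attribute [local simp] pullback.lift_fst pullback.lift_snd pullback.lift_fst_assoc
  pullback.lift_snd_assoc

variable (V : Type u) [Category.{v} V] [HasPullbacks V]

/-- Internal categories to `V`. The composition map is defined on the object
`mor ×_obj mor = pullback t s` of composable pairs, the first arrow being composed first.
Associativity is stated on generalized elements of the object of composable triples. -/
structure InternalCat where
  /-- the object of objects -/
  obj : V
  /-- the object of morphisms -/
  mor : V
  /-- source -/
  s : mor ⟶ obj
  /-- target -/
  t : mor ⟶ obj
  /-- composition -/
  c : pullback t s ⟶ mor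
  /-- identities -/
  i : obj ⟶ mor
  i_s : i ≫ s = 𝟙 obj
  i_t : i ≫ t = 𝟙 obj
  c_s : c ≫ s = pullback.fst t s ≫ s
  c_t : c ≫ t = pullback.snd t s ≫ t
  id_c : pullback.lift (s ≫ i) (𝟙 mor) (by simp [i_t]) ≫ c = 𝟙 mor
  c_id : pullback.lift (𝟙 mor) (t ≫ i) (by simp [i_s]) ≫ c = 𝟙 mor
  assoc : ∀ {X : V} (f g h : X ⟶ mor) (hfg : f ≫ t = g ≫ s) (hgh : g ≫ t = h ≫ s),
    pullback.lift (pullback.lift f g hfg ≫ c) h (by simp [c_t, hgh]) ≫ c =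
      pullback.lift f (pullback.lift g h hgh ≫ c) (by simp [c_s, hfg]) ≫ c

variable {V}

namespace InternalCat

attribute [simp] i_s i_t c_s c_t

@[simp]
theorem i_s_assoc (A : InternalCat V) {Z : V} (k : A.obj ⟶ Z) : A.i ≫ A.s ≫ k = k := by
  rw [← Category.assoc, i_s, Category.id_comp]

@[simp]
theorem i_t_assoc (A : InternalCat V) {Z : V} (k : A.obj ⟶ Z) : A.i ≫ A.t ≫ k = k := by
  rw [← Category.assoc, i_t, Category.id_comp]

@[simp]
theorem c_s_assoc (A : InternalCat V) {Z : V} (k : A.obj ⟶ Z) :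
    A.c ≫ A.s ≫ k = pullback.fst A.t A.s ≫ A.s ≫ k := by
  rw [← Category.assoc, c_s, Category.assoc]

@[simp]
theorem c_t_assoc (A : InternalCat V) {Z : V} (k : A.obj ⟶ Z) :
    A.c ≫ A.t ≫ k = pullback.snd A.t A.s ≫ A.t ≫ k := by
  rw [← Category.assoc, c_t, Category.assoc]

/-- Composition of generalized elements `X ⟶ A.mor`. -/
def comp (A : InternalCat V) {X : V} (f g : X ⟶ A.mor) (h : f ≫ A.t = g ≫ A.s) : X ⟶ A.mor :=
  pullback.lift f g h ≫ A.c

variable (A : InternalCat V) {X Y : V}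

@[simp]
theorem comp_s (f g : X ⟶ A.mor) (h : f ≫ A.t = g ≫ A.s) : A.comp f g h ≫ A.s = f ≫ A.s := by
  simp [comp]

@[simp]
theorem comp_t (f g : X ⟶ A.mor) (h : f ≫ A.t = g ≫ A.s) : A.comp f g h ≫ A.t = g ≫ A.t := by
  simp [comp]

@[simp]
theorem comp_s_assoc (f g : X ⟶ A.mor) (h : f ≫ A.t = g ≫ A.s) {Z : V} (k : A.obj ⟶ Z) :
    A.comp f g h ≫ A.s ≫ k = f ≫ A.s ≫ k := by
  rw [← Category.assoc, comp_s, Category.assoc]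

@[simp]
theorem comp_t_assoc (f g : X ⟶ A.mor) (h : f ≫ A.t = g ≫ A.s) {Z : V} (k : A.obj ⟶ Z) :
    A.comp f g h ≫ A.t ≫ k = g ≫ A.t ≫ k := by
  rw [← Category.assoc, comp_t, Category.assoc]

theorem whisker_comp (k : Y ⟶ X) (f g : X ⟶ A.mor) (h : f ≫ A.t = g ≫ A.s) :
    k ≫ A.comp f g h = A.comp (k ≫ f) (k ≫ g) (by simp [h]) := by
  simp only [comp, ← Category.assoc]
  congr 1
  apply pullback.hom_ext <;> simp

theorem comp_congr {f f' g g' : X ⟶ A.mor} (hf : f = f') (hg : g = g')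
    (h : f ≫ A.t = g ≫ A.s) : A.comp f g h = A.comp f' g' (by rw [← hf, ← hg, h]) := by
  subst hf hg; rfl

theorem id_comp (f : X ⟶ A.mor) (a : X ⟶ A.obj) (h : (a ≫ A.i) ≫ A.t = f ≫ A.s) :
    A.comp (a ≫ A.i) f h = f := by
  have ha : a = f ≫ A.s := by simpa using h
  subst ha
  have := (Category.assoc _ _ _).trans ((f ≫= A.id_c).trans (Category.comp_id f))
  refine Eq.trans ?_ this
  rw [comp]
  congr 1
  apply pullback.hom_ext <;> simp

theorem comp_id (f : X ⟶ A.mor) (a : X ⟶ A.obj) (h : f ≫ A.t = (a ≫ A.i) ≫ A.s) :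
    A.comp f (a ≫ A.i) h = f := by
  have ha : a = f ≫ A.t := by simpa using h.symm
  subst ha
  have := (Category.assoc _ _ _).trans ((f ≫= A.c_id).trans (Category.comp_id f))
  refine Eq.trans ?_ this
  rw [comp]
  congr 1
  apply pullback.hom_ext <;> simp

theorem comp_assoc (f g h : X ⟶ A.mor) (hfg : f ≫ A.t = g ≫ A.s) (hgh : g ≫ A.t = h ≫ A.s) :
    A.comp (A.comp f g hfg) h (by simp [hgh]) = A.comp f (A.comp g h hgh) (by simp [hfg]) :=
  A.assoc f g h hfg hgh

end InternalCat

variable (V) in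
/-- The data of an internal category whose composition is given on generalized elements,
naturally in the domain. By the Yoneda lemma this is the same as an internal category. -/
structure CompData where
  /-- the object of objects -/
  obj : V
  /-- the object of morphisms -/
  mor : V
  /-- source -/
  s : mor ⟶ obj
  /-- target -/
  t : mor ⟶ obj
  /-- identities -/
  i : obj ⟶ mor
  i_s : i ≫ s = 𝟙 obj
  i_t : i ≫ t = 𝟙 obj
  /-- composition of generalized elements -/
  m : ∀ {X : V} (f g : X ⟶ mor), f ≫ t = g ≫ s → (X ⟶ mor)
  m_s : ∀ {X : V} (f g : X ⟶ mor) (h : f ≫ t = g ≫ s), m f g h ≫ s = f ≫ s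
  m_t : ∀ {X : V} (f g : X ⟶ mor) (h : f ≫ t = g ≫ s), m f g h ≫ t = g ≫ t
  m_nat : ∀ {X Y : V} (k : Y ⟶ X) (f g : X ⟶ mor) (h : f ≫ t = g ≫ s),
    k ≫ m f g h = m (k ≫ f) (k ≫ g) (by simp [h])
  id_m : m (s ≫ i) (𝟙 mor) (by simp [i_t]) = 𝟙 mor
  m_id : m (𝟙 mor) (t ≫ i) (by simp [i_s]) = 𝟙 mor
  m_assoc : ∀ {X : V} (f g h : X ⟶ mor) (hfg : f ≫ t = g ≫ s) (hgh : g ≫ t = h ≫ s),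
    m (m f g hfg) h (by rw [m_t, hgh]) = m f (m g h hgh) (by rw [m_s, hfg])

namespace CompData

variable (D : CompData V)

theorem lift_m {X : V} (f g : X ⟶ D.mor) (h : f ≫ D.t = g ≫ D.s) :
    pullback.lift f g h ≫ D.m (pullback.fst D.t D.s) (pullback.snd D.t D.s) pullback.condition =
      D.m f g h := by
  rw [D.m_nat]
  congr 1
  · exact pullback.lift_fst _ _ _
  · exact pullback.lift_snd _ _ _

/-- The internal category that is presented by composition on generalized elements. -/
@[simps obj mor s t i]
def toInternalCat : InternalCat V where
  obj := D.obj
  mor := D.mor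
  s := D.s
  t := D.t
  c := D.m (pullback.fst D.t D.s) (pullback.snd D.t D.s) pullback.condition
  i := D.i
  i_s := D.i_s
  i_t := D.i_t
  c_s := D.m_s _ _ _
  c_t := D.m_t _ _ _
  id_c := by rw [lift_m, D.id_m]
  c_id := by rw [lift_m, D.m_id]
  assoc f g h hfg hgh := by simpa only [lift_m] using D.m_assoc f g h hfg hgh

theorem toInternalCat_comp {X : V} (f g : X ⟶ D.mor) (h : f ≫ D.t = g ≫ D.s) :
    D.toInternalCat.comp f g h = D.m f g h :=
  D.lift_m f g h

end CompData

/-- Internal functors. -/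
@[ext]
structure InternalFunctor (A B : InternalCat V) where
  /-- the map on objects of objects -/
  onObj : A.obj ⟶ B.obj
  /-- the map on objects of morphisms -/
  onMor : A.mor ⟶ B.mor
  map_s : onMor ≫ B.s = A.s ≫ onObj
  map_t : onMor ≫ B.t = A.t ≫ onObj
  map_i : A.i ≫ onMor = onObj ≫ B.i
  map_c : A.c ≫ onMor = pullback.lift (pullback.fst A.t A.s ≫ onMor)
    (pullback.snd A.t A.s ≫ onMor) (by simp [map_s, map_t, pullback.condition_assoc]) ≫ B.c

namespace InternalFunctor

variable {A B C D : InternalCat V}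

attribute [simp] map_s map_t map_i

@[simp]
theorem map_s_assoc (F : InternalFunctor A B) {Z : V} (k : B.obj ⟶ Z) :
    F.onMor ≫ B.s ≫ k = A.s ≫ F.onObj ≫ k := by
  rw [← Category.assoc, map_s, Category.assoc]

@[simp]
theorem map_t_assoc (F : InternalFunctor A B) {Z : V} (k : B.obj ⟶ Z) :
    F.onMor ≫ B.t ≫ k = A.t ≫ F.onObj ≫ k := by
  rw [← Category.assoc, map_t, Category.assoc]

@[simp]
theorem map_i_assoc (F : InternalFunctor A B) {Z : V} (k : B.mor ⟶ Z) :
    A.i ≫ F.onMor ≫ k = F.onObj ≫ B.i ≫ k := by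
  rw [← Category.assoc, map_i, Category.assoc]

theorem map_comp (F : InternalFunctor A B) {X : V} (f g : X ⟶ A.mor) (h : f ≫ A.t = g ≫ A.s) :
    A.comp f g h ≫ F.onMor =
      B.comp (f ≫ F.onMor) (g ≫ F.onMor) (by simp [reassoc_of% h]) := by
  rw [InternalCat.comp, InternalCat.comp, Category.assoc, F.map_c, ← Category.assoc]
  congr 1
  apply pullback.hom_ext <;> simp

/-- An internal functor, with the compatibility with composition checked on generalized
elements. -/
@[simps]
def mk' (onObj : A.obj ⟶ B.obj) (onMor : A.mor ⟶ B.mor) (map_s : onMor ≫ B.s = A.s ≫ onObj)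
    (map_t : onMor ≫ B.t = A.t ≫ onObj) (map_i : A.i ≫ onMor = onObj ≫ B.i)
    (map_comp : ∀ {X : V} (f g : X ⟶ A.mor) (h : f ≫ A.t = g ≫ A.s),
      A.comp f g h ≫ onMor = B.comp (f ≫ onMor) (g ≫ onMor)
        (by rw [Category.assoc, Category.assoc, map_s, map_t, reassoc_of% h])) :
    InternalFunctor A B where
  onObj := onObj
  onMor := onMor
  map_s := map_s
  map_t := map_t
  map_i := map_i
  map_c := by
    have := map_comp (pullback.fst A.t A.s) (pullback.snd A.t A.s) pullback.condition
    rw [InternalCat.comp] at this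
    refine Eq.trans ?_ this
    congr 1
    refine Eq.trans (Category.id_comp _).symm ?_
    congr 1
    apply pullback.hom_ext <;> simp

/-- The identity internal functor. -/
@[simps!]
protected def id (A : InternalCat V) : InternalFunctor A A :=
  mk' (𝟙 _) (𝟙 _) (by simp) (by simp) (by simp) (fun f g h => by simp)

/-- Composition of internal functors. -/
@[simps!]
protected def comp (F : InternalFunctor A B) (G : InternalFunctor B C) : InternalFunctor A C :=
  mk' (F.onObj ≫ G.onObj) (F.onMor ≫ G.onMor) (by simp) (by simp) (by simp)
    (fun f g h => by
      rw [← Category.assoc, map_comp, map_comp]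
      apply InternalCat.comp_congr <;> simp)

end InternalFunctor

/-- The category `Cat(V)` of internal categories and internal functors. -/
instance : Category (InternalCat V) where
  Hom := InternalFunctor
  id := InternalFunctor.id
  comp := InternalFunctor.comp
  id_comp F := by apply InternalFunctor.ext <;> simp
  comp_id F := by apply InternalFunctor.ext <;> simp
  assoc F G H := by apply InternalFunctor.ext <;> simp

/-- The data of the constant internal category at `X`. -/
def cst.data (X : V) : CompData V where
  obj := X
  mor := X
  s := 𝟙 X
  t := 𝟙 X
  i := 𝟙 X
  i_s := Category.comp_id _
  i_t := Category.comp_id _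
  m := fun f _ _ => f
  m_s := fun _ _ _ => rfl
  m_t := fun _ _ h => h
  m_nat := fun _ _ _ _ => rfl
  id_m := Category.comp_id _
  m_id := rfl
  m_assoc := fun _ _ _ _ _ => rfl

/-- The internal category that is constant at `X`: all structure maps are `𝟙 X`. -/
def cst (X : V) : InternalCat V :=
  (cst.data X).toInternalCat

section FiberProduct

variable {A B C : InternalCat V} (F : InternalFunctor A C) (G : InternalFunctor B C)

/-- The source map of the pullback of internal categories. -/
def fiberProduct.s : pullback F.onMor G.onMor ⟶ pullback F.onObj G.onObj :=
  pullback.lift (pullback.fst _ _ ≫ A.s) (pullback.snd _ _ ≫ B.s) (by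
    rw [Category.assoc, Category.assoc, ← F.map_s, ← G.map_s, pullback.condition_assoc])

/-- The target map of the pullback of internal categories. -/
def fiberProduct.t : pullback F.onMor G.onMor ⟶ pullback F.onObj G.onObj :=
  pullback.lift (pullback.fst _ _ ≫ A.t) (pullback.snd _ _ ≫ B.t) (by
    rw [Category.assoc, Category.assoc, ← F.map_t, ← G.map_t, pullback.condition_assoc])

/-- The identity map of the pullback of internal categories. -/
def fiberProduct.i : pullback F.onObj G.onObj ⟶ pullback F.onMor G.onMor :=
  pullback.lift (pullback.fst _ _ ≫ A.i) (pullback.snd _ _ ≫ B.i) (by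
    rw [Category.assoc, Category.assoc, F.map_i, G.map_i, pullback.condition_assoc])

theorem fiberProduct.composable_fst {X : V} {f g : X ⟶ pullback F.onMor G.onMor}
    (h : f ≫ fiberProduct.t F G = g ≫ fiberProduct.s F G) :
    (f ≫ pullback.fst _ _) ≫ A.t = (g ≫ pullback.fst _ _) ≫ A.s := by
  simpa [fiberProduct.s, fiberProduct.t] using h =≫ pullback.fst _ _

theorem fiberProduct.composable_snd {X : V} {f g : X ⟶ pullback F.onMor G.onMor}
    (h : f ≫ fiberProduct.t F G = g ≫ fiberProduct.s F G) :
    (f ≫ pullback.snd _ _) ≫ B.t = (g ≫ pullback.snd _ _) ≫ B.s := by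
  simpa [fiberProduct.s, fiberProduct.t] using h =≫ pullback.snd _ _

/-- The composition of the pullback of internal categories. -/
def fiberProduct.comp {X : V} (f g : X ⟶ pullback F.onMor G.onMor)
    (h : f ≫ fiberProduct.t F G = g ≫ fiberProduct.s F G) : X ⟶ pullback F.onMor G.onMor :=
  pullback.lift
    (A.comp (f ≫ pullback.fst _ _) (g ≫ pullback.fst _ _) (fiberProduct.composable_fst F G h))
    (B.comp (f ≫ pullback.snd _ _) (g ≫ pullback.snd _ _) (fiberProduct.composable_snd F G h))
    (by
      rw [F.map_comp, G.map_comp]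
      apply C.comp_congr <;> simp [pullback.condition])

theorem fiberProduct.comp_fst {X : V} (f g : X ⟶ pullback F.onMor G.onMor)
    (h : f ≫ fiberProduct.t F G = g ≫ fiberProduct.s F G) :
    fiberProduct.comp F G f g h ≫ pullback.fst _ _ =
      A.comp (f ≫ pullback.fst _ _) (g ≫ pullback.fst _ _) (fiberProduct.composable_fst F G h) :=
  pullback.lift_fst _ _ _

theorem fiberProduct.comp_snd {X : V} (f g : X ⟶ pullback F.onMor G.onMor)
    (h : f ≫ fiberProduct.t F G = g ≫ fiberProduct.s F G) :
    fiberProduct.comp F G f g h ≫ pullback.snd _ _ =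
      B.comp (f ≫ pullback.snd _ _) (g ≫ pullback.snd _ _) (fiberProduct.composable_snd F G h) :=
  pullback.lift_snd _ _ _

/-- The data of the pullback of internal categories. -/
def fiberProduct.data : CompData V where
  obj := pullback F.onObj G.onObj
  mor := pullback F.onMor G.onMor
  s := fiberProduct.s F G
  t := fiberProduct.t F G
  i := fiberProduct.i F G
  i_s := by apply pullback.hom_ext <;> simp [fiberProduct.s, fiberProduct.i]
  i_t := by apply pullback.hom_ext <;> simp [fiberProduct.t, fiberProduct.i]
  m := fiberProduct.comp F G
  m_s f g h := by apply pullback.hom_ext <;> simp [fiberProduct.s, fiberProduct.comp]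
  m_t f g h := by apply pullback.hom_ext <;> simp [fiberProduct.t, fiberProduct.comp]
  m_nat k f g h := by
    apply pullback.hom_ext <;>
      simp [fiberProduct.comp_fst, fiberProduct.comp_snd, InternalCat.whisker_comp]
  id_m := by
    apply pullback.hom_ext
    · rw [fiberProduct.comp_fst, A.comp_congr (f' := (pullback.fst _ _ ≫ A.s) ≫ A.i)
        (by simp [fiberProduct.s, fiberProduct.i]) rfl, A.id_comp, Category.id_comp]
    · rw [fiberProduct.comp_snd, B.comp_congr (f' := (pullback.snd _ _ ≫ B.s) ≫ B.i)
        (by simp [fiberProduct.s, fiberProduct.i]) rfl, B.id_comp, Category.id_comp]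
  m_id := by
    apply pullback.hom_ext
    · rw [fiberProduct.comp_fst, A.comp_congr (g' := (pullback.fst _ _ ≫ A.t) ≫ A.i) rfl
        (by simp [fiberProduct.t, fiberProduct.i]), A.comp_id, Category.id_comp]
    · rw [fiberProduct.comp_snd, B.comp_congr (g' := (pullback.snd _ _ ≫ B.t) ≫ B.i) rfl
        (by simp [fiberProduct.t, fiberProduct.i]), B.comp_id, Category.id_comp]
  m_assoc f g h hfg hgh := by
    apply pullback.hom_ext
    · simp only [fiberProduct.comp_fst]
      exact A.comp_assoc ..
    · simp only [fiberProduct.comp_snd]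
      exact B.comp_assoc ..

/-- The pullback of internal categories, which is computed levelwise. -/
def fiberProduct : InternalCat V :=
  (fiberProduct.data F G).toInternalCat

theorem fiberProduct_comp {X : V} (f g : X ⟶ pullback F.onMor G.onMor)
    (h : f ≫ fiberProduct.t F G = g ≫ fiberProduct.s F G) :
    (fiberProduct F G).comp f g h = fiberProduct.comp F G f g h :=
  CompData.toInternalCat_comp (fiberProduct.data F G) f g h

/-- The projection of `fiberProduct F G` to the domain of `F`. -/
def fiberProduct.fst : InternalFunctor (fiberProduct F G) A :=
  InternalFunctor.mk' (pullback.fst F.onObj G.onObj) (pullback.fst F.onMor G.onMor)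
    (pullback.lift_fst _ _ _).symm (pullback.lift_fst _ _ _).symm (pullback.lift_fst _ _ _)
    (fun f g h => (fiberProduct_comp F G f g h =≫ pullback.fst _ _).trans
      (fiberProduct.comp_fst F G f g h))

end FiberProduct

end Internal

/-! ### Products and internal homs of internal categories -/

section Products

variable {V : Type u} [Category.{v} V] [CartesianMonoidalCategory V] [HasPullbacks V]

/-- The data of the product of two internal categories. -/
def prodCat.data (A B : InternalCat V) : CompData V where
  obj := A.obj ⊗ B.obj
  mor := A.mor ⊗ B.mor
  s := A.s ⊗ₘ B.s
  t := A.t ⊗ₘ B.t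
  i := A.i ⊗ₘ B.i
  i_s := by simp
  i_t := by simp
  m f g h := lift
    (A.comp (f ≫ fst _ _) (g ≫ fst _ _) (by simpa using h =≫ fst _ _))
    (B.comp (f ≫ snd _ _) (g ≫ snd _ _) (by simpa using h =≫ snd _ _))
  m_s f g h := by ext <;> simp
  m_t f g h := by ext <;> simp
  m_nat k f g h := by ext <;> simp [InternalCat.whisker_comp]
  id_m := by
    ext
    · rw [lift_fst, A.comp_congr (f' := (fst _ _ ≫ A.s) ≫ A.i) (by simp) rfl, A.id_comp]
    · rw [lift_snd, B.comp_congr (f' := (snd _ _ ≫ B.s) ≫ B.i) (by simp) rfl, B.id_comp]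
  m_id := by
    ext
    · rw [lift_fst, A.comp_congr (g' := (fst _ _ ≫ A.t) ≫ A.i) rfl (by simp), A.comp_id]
    · rw [lift_snd, B.comp_congr (g' := (snd _ _ ≫ B.t) ≫ B.i) rfl (by simp), B.comp_id]
  m_assoc f g h hfg hgh := by
    ext
    · simp only [lift_fst]
      exact A.comp_assoc ..
    · simp only [lift_snd]
      exact B.comp_assoc ..

/-- The product of two internal categories. -/
def prodCat (A B : InternalCat V) : InternalCat V :=
  (prodCat.data A B).toInternalCat

theorem prodCat_comp (A B : InternalCat V) {X : V} (f g : X ⟶ A.mor ⊗ B.mor)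
    (h : f ≫ (A.t ⊗ₘ B.t) = g ≫ (A.s ⊗ₘ B.s)) :
    (prodCat A B).comp f g h = lift
      (A.comp (f ≫ fst _ _) (g ≫ fst _ _) (by simpa using h =≫ fst _ _))
      (B.comp (f ≫ snd _ _) (g ≫ snd _ _) (by simpa using h =≫ snd _ _)) :=
  CompData.toInternalCat_comp (prodCat.data A B) f g h

theorem prodLift.aux {A B C : InternalCat V} (F : InternalFunctor C A) (G : InternalFunctor C B)
    {X : V} (f g : X ⟶ C.mor) (h : f ≫ C.t = g ≫ C.s) :
    C.comp f g h ≫ lift F.onMor G.onMor = lift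
      (A.comp ((f ≫ lift F.onMor G.onMor) ≫ fst _ _) ((g ≫ lift F.onMor G.onMor) ≫ fst _ _)
        (by simp [reassoc_of% h]))
      (B.comp ((f ≫ lift F.onMor G.onMor) ≫ snd _ _) ((g ≫ lift F.onMor G.onMor) ≫ snd _ _)
        (by simp [reassoc_of% h])) := by
  apply CartesianMonoidalCategory.hom_ext
  · rw [comp_lift, lift_fst, lift_fst, F.map_comp]
    exact A.comp_congr (by simp) (by simp) _
  · rw [comp_lift, lift_snd, lift_snd, G.map_comp]
    exact B.comp_congr (by simp) (by simp) _

/-- The internal functor to a product that is induced by its two components. -/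
def prodLift {A B C : InternalCat V} (F : InternalFunctor C A) (G : InternalFunctor C B) :
    InternalFunctor C (prodCat A B) :=
  InternalFunctor.mk' (lift F.onObj G.onObj) (lift F.onMor G.onMor)
    (show lift F.onMor G.onMor ≫ (A.s ⊗ₘ B.s) = C.s ≫ lift F.onObj G.onObj by ext <;> simp)
    (show lift F.onMor G.onMor ≫ (A.t ⊗ₘ B.t) = C.t ≫ lift F.onObj G.onObj by ext <;> simp)
    (show C.i ≫ lift F.onMor G.onMor = lift F.onObj G.onObj ≫ (A.i ⊗ₘ B.i) by ext <;> simp)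
    (fun f g h => (prodLift.aux F G f g h).trans (prodCat_comp A B (f ≫ lift F.onMor G.onMor)
      (g ≫ lift F.onMor G.onMor) (by ext <;> simp [reassoc_of% h])).symm)

end Products

section InternalHom

open MonoidalClosed

variable {V : Type u} [Category.{v} V] [CartesianMonoidalCategory V] [MonoidalClosed V]
  [HasPullbacks V]

/-- The subobject of `E` on which the two given maps `P ⊗ E ⟶ Z` agree, i.e. the equalizer of
the corresponding maps from `E` to the exponential of `Z` by `P`, as a pullback. -/
def agree {P E Z : V} (p q : P ⊗ E ⟶ Z) : V :=
  pullback (lift (𝟙 E) (curry p)) (lift (𝟙 E) (curry q))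

/-- The inclusion of `agree p q`. -/
def agree.ι {P E Z : V} (p q : P ⊗ E ⟶ Z) : agree p q ⟶ E :=
  pullback.fst _ _

theorem agree.snd_eq {P E Z : V} (p q : P ⊗ E ⟶ Z) :
    pullback.snd (lift (𝟙 E) (curry p)) (lift (𝟙 E) (curry q)) = agree.ι p q := by
  have := pullback.condition (f := lift (𝟙 E) (curry p)) (g := lift (𝟙 E) (curry q)) =≫ fst _ _
  simpa [agree.ι] using this.symm

theorem agree.condition {P E Z : V} (p q : P ⊗ E ⟶ Z) :
    P ◁ agree.ι p q ≫ p = P ◁ agree.ι p q ≫ q := by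
  apply curry_injective
  rw [curry_natural_left, curry_natural_left]
  have := pullback.condition (f := lift (𝟙 E) (curry p)) (g := lift (𝟙 E) (curry q)) =≫ snd _ _
  rw [Category.assoc, Category.assoc, lift_snd, lift_snd, agree.snd_eq] at this
  exact this

theorem agree.exists_lift {P E Z : V} (p q : P ⊗ E ⟶ Z) {X : V} (f : X ⟶ E)
    (h : P ◁ f ≫ p = P ◁ f ≫ q) : ∃ g : X ⟶ agree p q, g ≫ agree.ι p q = f :=
  ⟨pullback.lift f f (by
    ext
    · simp
    · simp [← curry_natural_left, h]), pullback.lift_fst _ _ _⟩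

theorem agree.hom_ext {P E Z : V} {p q : P ⊗ E ⟶ Z} {X : V} {f g : X ⟶ agree p q}
    (h : f ≫ agree.ι p q = g ≫ agree.ι p q) : f = g := by
  apply pullback.hom_ext
  · exact h
  · rw [agree.snd_eq]
    exact h

variable (A B : InternalCat V)

/-- An `X`-indexed family of internal functors `A ⟶ B`. -/
@[ext]
structure FunctorFamily (X : V) where
  /-- the map on objects -/
  onObj : A.obj ⊗ X ⟶ B.obj
  /-- the map on morphisms -/
  onMor : A.mor ⊗ X ⟶ B.mor
  map_s : onMor ≫ B.s = A.s ▷ X ≫ onObj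
  map_t : onMor ≫ B.t = A.t ▷ X ≫ onObj
  map_i : A.i ▷ X ≫ onMor = onObj ≫ B.i
  map_c : A.c ▷ X ≫ onMor = B.comp (pullback.fst A.t A.s ▷ X ≫ onMor)
    (pullback.snd A.t A.s ▷ X ≫ onMor) (by
      rw [Category.assoc, Category.assoc, map_s, map_t, ← comp_whiskerRight_assoc,
        ← comp_whiskerRight_assoc, pullback.condition])

namespace internalHom

/-- The object of pairs of a map on objects and a map on morphisms. -/
abbrev E₀ : V := (ihom A.obj).obj B.obj ⊗ (ihom A.mor).obj B.mor

/-- The universal map on objects. -/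
def o₀ : A.obj ⊗ E₀ A B ⟶ B.obj := uncurry (fst _ _)

/-- The universal map on morphisms. -/
def m₀ : A.mor ⊗ E₀ A B ⟶ B.mor := uncurry (snd _ _)

/-- The subobject of pairs compatible with sources. -/
abbrev E₁ : V := agree (m₀ A B ≫ B.s) (A.s ▷ E₀ A B ≫ o₀ A B)

/-- The inclusion of `E₁`. -/
abbrev ι₁ : E₁ A B ⟶ E₀ A B := agree.ι _ _

/-- The subobject of pairs that are moreover compatible with targets. -/
abbrev E₂ : V :=
  agree (A.mor ◁ ι₁ A B ≫ m₀ A B ≫ B.t) (A.t ▷ E₁ A B ≫ A.obj ◁ ι₁ A B ≫ o₀ A B)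

/-- The inclusion of `E₂`. -/
abbrev ι₂ : E₂ A B ⟶ E₀ A B := agree.ι _ _ ≫ ι₁ A B

/-- The subobject of pairs that are moreover compatible with identities. -/
abbrev E₃ : V :=
  agree (A.i ▷ E₂ A B ≫ A.mor ◁ ι₂ A B ≫ m₀ A B) (A.obj ◁ ι₂ A B ≫ o₀ A B ≫ B.i)

/-- The inclusion of `E₃`. -/
abbrev ι₃ : E₃ A B ⟶ E₀ A B := agree.ι _ _ ≫ ι₂ A B

/-- The universal map on objects over `E₃`. -/
def o₃ : A.obj ⊗ E₃ A B ⟶ B.obj := A.obj ◁ ι₃ A B ≫ o₀ A B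

/-- The universal map on morphisms over `E₃`. -/
def m₃ : A.mor ⊗ E₃ A B ⟶ B.mor := A.mor ◁ ι₃ A B ≫ m₀ A B

theorem m₃_s : m₃ A B ≫ B.s = A.s ▷ _ ≫ o₃ A B := by
  have := agree.condition (m₀ A B ≫ B.s) (A.s ▷ E₀ A B ≫ o₀ A B)
  simp only [m₃, o₃, ι₃, ι₂, MonoidalCategory.whiskerLeft_comp, Category.assoc, this]
  simp only [whisker_exchange_assoc]

theorem m₃_t : m₃ A B ≫ B.t = A.t ▷ _ ≫ o₃ A B := by
  have := agree.condition (A.mor ◁ ι₁ A B ≫ m₀ A B ≫ B.t)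
    (A.t ▷ E₁ A B ≫ A.obj ◁ ι₁ A B ≫ o₀ A B)
  simp only [m₃, o₃, ι₃, ι₂, MonoidalCategory.whiskerLeft_comp, Category.assoc, this]
  simp only [whisker_exchange_assoc]

theorem m₃_i : A.i ▷ _ ≫ m₃ A B = o₃ A B ≫ B.i := by
  have := agree.condition (A.i ▷ E₂ A B ≫ A.mor ◁ ι₂ A B ≫ m₀ A B)
    (A.obj ◁ ι₂ A B ≫ o₀ A B ≫ B.i)
  simp only [ι₂, MonoidalCategory.whiskerLeft_comp, Category.assoc] at this
  simp only [m₃, o₃, ι₃, ι₂, MonoidalCategory.whiskerLeft_comp, Category.assoc, ← this]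
  simp only [whisker_exchange_assoc]

theorem m₃_composable : (pullback.fst A.t A.s ▷ E₃ A B ≫ m₃ A B) ≫ B.t =
    (pullback.snd A.t A.s ▷ E₃ A B ≫ m₃ A B) ≫ B.s := by
  rw [Category.assoc, Category.assoc, m₃_s, m₃_t, ← comp_whiskerRight_assoc,
    ← comp_whiskerRight_assoc, pullback.condition]

/-- The object of internal functors `A ⟶ B`. -/
def obj : V :=
  agree (A.c ▷ E₃ A B ≫ m₃ A B) (B.comp (pullback.fst A.t A.s ▷ E₃ A B ≫ m₃ A B)
    (pullback.snd A.t A.s ▷ E₃ A B ≫ m₃ A B) (m₃_composable A B))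

/-- The inclusion of the object of internal functors. -/
def ι : obj A B ⟶ E₃ A B := agree.ι _ _

theorem ι_c : pullback A.t A.s ◁ ι A B ≫ A.c ▷ E₃ A B ≫ m₃ A B =
    pullback A.t A.s ◁ ι A B ≫ B.comp (pullback.fst A.t A.s ▷ E₃ A B ≫ m₃ A B)
      (pullback.snd A.t A.s ▷ E₃ A B ≫ m₃ A B) (m₃_composable A B) :=
  agree.condition _ _

variable {A B} in
/-- The family of internal functors that is classified by a map to `obj A B`. -/
@[simps]
def family {X : V} (f : X ⟶ obj A B) : FunctorFamily A B X where
  onObj := A.obj ◁ (f ≫ ι A B) ≫ o₃ A B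
  onMor := A.mor ◁ (f ≫ ι A B) ≫ m₃ A B
  map_s := by rw [Category.assoc, m₃_s, whisker_exchange_assoc]
  map_t := by rw [Category.assoc, m₃_t, whisker_exchange_assoc]
  map_i := by rw [← whisker_exchange_assoc, m₃_i, Category.assoc]
  map_c := by
    have h2 := (_ ◁ f) ≫= ι_c A B
    rw [← MonoidalCategory.whiskerLeft_comp_assoc, ← MonoidalCategory.whiskerLeft_comp_assoc,
      InternalCat.whisker_comp, whisker_exchange_assoc] at h2
    refine h2.trans (B.comp_congr ?_ ?_ _) <;> rw [whisker_exchange_assoc]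

variable {A B}

theorem family_onObj_eq {X : V} (f : X ⟶ obj A B) :
    (family f).onObj = uncurry (((f ≫ ι A B) ≫ ι₃ A B) ≫ fst _ _) := by
  rw [uncurry_natural_left, family_onObj, o₃, o₀, ← MonoidalCategory.whiskerLeft_comp_assoc]

theorem family_onMor_eq {X : V} (f : X ⟶ obj A B) :
    (family f).onMor = uncurry (((f ≫ ι A B) ≫ ι₃ A B) ≫ snd _ _) := by
  rw [uncurry_natural_left, family_onMor, m₃, m₀, ← MonoidalCategory.whiskerLeft_comp_assoc]

theorem family_ext {X : V} {f g : X ⟶ obj A B} (ho : (family f).onObj = (family g).onObj)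
    (hm : (family f).onMor = (family g).onMor) : f = g := by
  have h : (f ≫ ι A B) ≫ ι₃ A B = (g ≫ ι A B) ≫ ι₃ A B := by
    apply CartesianMonoidalCategory.hom_ext
    · rw [family_onObj_eq, family_onObj_eq] at ho
      exact uncurry_injective ho
    · rw [family_onMor_eq, family_onMor_eq] at hm
      exact uncurry_injective hm
  apply agree.hom_ext
  apply agree.hom_ext
  apply agree.hom_ext
  apply agree.hom_ext
  simp only [ι₃, ι₂, ι₁, ι, Category.assoc] at h ⊢
  exact h

theorem exists_family {X : V} (φ : FunctorFamily A B X) : ∃ f : X ⟶ obj A B, family f = φ := by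
  let f₀ : X ⟶ E₀ A B := lift (curry φ.onObj) (curry φ.onMor)
  have ho : A.obj ◁ f₀ ≫ o₀ A B = φ.onObj := by
    rw [o₀, ← uncurry_natural_left, lift_fst, uncurry_curry]
  have hm : A.mor ◁ f₀ ≫ m₀ A B = φ.onMor := by
    rw [m₀, ← uncurry_natural_left, lift_snd, uncurry_curry]
  obtain ⟨f₁, h₁⟩ := agree.exists_lift (m₀ A B ≫ B.s) (A.s ▷ E₀ A B ≫ o₀ A B) f₀ (by
    rw [reassoc_of% hm, whisker_exchange_assoc, ho, φ.map_s])
  have ho₁ : A.obj ◁ f₁ ≫ A.obj ◁ ι₁ A B ≫ o₀ A B = φ.onObj := by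
    rw [← MonoidalCategory.whiskerLeft_comp_assoc, h₁, ho]
  have hm₁ : A.mor ◁ f₁ ≫ A.mor ◁ ι₁ A B ≫ m₀ A B = φ.onMor := by
    rw [← MonoidalCategory.whiskerLeft_comp_assoc, h₁, hm]
  obtain ⟨f₂, h₂⟩ := agree.exists_lift (A.mor ◁ ι₁ A B ≫ m₀ A B ≫ B.t)
    (A.t ▷ E₁ A B ≫ A.obj ◁ ι₁ A B ≫ o₀ A B) f₁ (by
      rw [reassoc_of% hm₁, whisker_exchange_assoc, ho₁, φ.map_t])
  have h₂' : f₂ ≫ ι₂ A B = f₀ := by rw [← Category.assoc, h₂, h₁]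
  have ho₂ : A.obj ◁ f₂ ≫ A.obj ◁ ι₂ A B ≫ o₀ A B = φ.onObj := by
    rw [← MonoidalCategory.whiskerLeft_comp_assoc, h₂', ho]
  have hm₂ : A.mor ◁ f₂ ≫ A.mor ◁ ι₂ A B ≫ m₀ A B = φ.onMor := by
    rw [← MonoidalCategory.whiskerLeft_comp_assoc, h₂', hm]
  obtain ⟨f₃, h₃⟩ := agree.exists_lift (A.i ▷ E₂ A B ≫ A.mor ◁ ι₂ A B ≫ m₀ A B)
    (A.obj ◁ ι₂ A B ≫ o₀ A B ≫ B.i) f₂ (by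
      rw [reassoc_of% ho₂, whisker_exchange_assoc, hm₂, φ.map_i])
  have h₃' : f₃ ≫ ι₃ A B = f₀ := by rw [← Category.assoc, h₃, h₂']
  have hm₃ : A.mor ◁ f₃ ≫ m₃ A B = φ.onMor := by
    rw [m₃, ← MonoidalCategory.whiskerLeft_comp_assoc, h₃', hm]
  have ho₃ : A.obj ◁ f₃ ≫ o₃ A B = φ.onObj := by
    rw [o₃, ← MonoidalCategory.whiskerLeft_comp_assoc, h₃', ho]
  obtain ⟨f, h⟩ := agree.exists_lift (A.c ▷ E₃ A B ≫ m₃ A B)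
    (B.comp (pullback.fst A.t A.s ▷ E₃ A B ≫ m₃ A B)
      (pullback.snd A.t A.s ▷ E₃ A B ≫ m₃ A B) (m₃_composable A B)) f₃ (by
      rw [whisker_exchange_assoc, hm₃, φ.map_c, InternalCat.whisker_comp]
      apply B.comp_congr <;> rw [whisker_exchange_assoc, hm₃])
  refine ⟨f, FunctorFamily.ext ?_ ?_⟩
  · exact (congrArg (fun q => A.obj ◁ q ≫ o₃ A B) h).trans ho₃
  · exact (congrArg (fun q => A.mor ◁ q ≫ m₃ A B) h).trans hm₃

/-- The map to `obj A B` that classifies a family of internal functors. -/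
def classify {X : V} (φ : FunctorFamily A B X) : X ⟶ obj A B :=
  (exists_family φ).choose

@[simp]
theorem family_classify {X : V} (φ : FunctorFamily A B X) : family (classify φ) = φ :=
  (exists_family φ).choose_spec

theorem family_comp_onObj {X Y : V} (k : Y ⟶ X) (f : X ⟶ obj A B) :
    (family (k ≫ f)).onObj = A.obj ◁ k ≫ (family f).onObj := by
  simp

theorem family_comp_onMor {X Y : V} (k : Y ⟶ X) (f : X ⟶ obj A B) :
    (family (k ≫ f)).onMor = A.mor ◁ k ≫ (family f).onMor := by
  simp

end internalHom
end InternalHom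

section InternalHomMor

open MonoidalClosed

variable {V : Type u} [Category.{v} V] [CartesianMonoidalCategory V] [MonoidalClosed V]
  [HasPullbacks V]

namespace internalHom

variable (A B : InternalCat V)

/-- An `X`-indexed family of internal natural transformations between internal functors
`A ⟶ B`, where the `X`-indexed families of functors are given by maps to `obj A B`. -/
@[ext]
structure NatFamily (X : V) where
  /-- the domain functors -/
  dom : X ⟶ obj A B
  /-- the codomain functors -/
  cod : X ⟶ obj A B
  /-- the components -/
  app : A.obj ⊗ X ⟶ B.mor
  app_s : app ≫ B.s = (family dom).onObj
  app_t : app ≫ B.t = (family cod).onObj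
  natural : B.comp (family dom).onMor (A.t ▷ X ≫ app)
      (by rw [Category.assoc, app_s, (family dom).map_t]) =
    B.comp (A.s ▷ X ≫ app) (family cod).onMor
      (by rw [Category.assoc, app_t, (family cod).map_s])

variable {A B}

/-- Restriction of a family along a map of the indexing objects. -/
@[simps]
def NatFamily.pre {X Y : V} (k : Y ⟶ X) (N : NatFamily A B X) : NatFamily A B Y where
  dom := k ≫ N.dom
  cod := k ≫ N.cod
  app := A.obj ◁ k ≫ N.app
  app_s := by rw [Category.assoc, N.app_s, family_comp_onObj]
  app_t := by rw [Category.assoc, N.app_t, family_comp_onObj]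
  natural := by
    have h := (A.mor ◁ k) ≫= N.natural
    rw [B.whisker_comp, B.whisker_comp] at h
    refine (B.comp_congr ?_ ?_ _).trans (h.trans (B.comp_congr ?_ ?_ _))
    · rw [family_comp_onMor]
    · rw [whisker_exchange_assoc]
    · rw [whisker_exchange_assoc]
    · rw [family_comp_onMor]

variable (A B)

/-- The object of pairs of functors together with a map `A.obj ⟶ B.mor`. -/
abbrev N₀ : V := (obj A B ⊗ obj A B) ⊗ (ihom A.obj).obj B.mor

/-- The universal domain. -/
def d₀ : N₀ A B ⟶ obj A B := fst _ _ ≫ fst _ _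

/-- The universal codomain. -/
def e₀ : N₀ A B ⟶ obj A B := fst _ _ ≫ snd _ _

/-- The universal map on objects. -/
def a₀ : A.obj ⊗ N₀ A B ⟶ B.mor := uncurry (snd _ _)

/-- The subobject where the source of the components is correct. -/
abbrev N₁ : V := agree (a₀ A B ≫ B.s) (family (d₀ A B)).onObj

/-- The inclusion of `N₁`. -/
abbrev j₁ : N₁ A B ⟶ N₀ A B := agree.ι _ _

/-- The subobject where moreover the target of the components is correct. -/
abbrev N₂ : V := agree (A.obj ◁ j₁ A B ≫ a₀ A B ≫ B.t) (A.obj ◁ j₁ A B ≫ (family (e₀ A B)).onObj)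

/-- The inclusion of `N₂`. -/
def j₂ : N₂ A B ⟶ N₀ A B := agree.ι _ _ ≫ j₁ A B

/-- The universal components over `N₂`. -/
def a₂ : A.obj ⊗ N₂ A B ⟶ B.mor := A.obj ◁ j₂ A B ≫ a₀ A B

theorem a₂_s : a₂ A B ≫ B.s = (family (j₂ A B ≫ d₀ A B)).onObj := by
  have h := agree.condition (a₀ A B ≫ B.s) (family (d₀ A B)).onObj
  rw [family_comp_onObj, a₂, j₂, MonoidalCategory.whiskerLeft_comp, Category.assoc,
    Category.assoc, Category.assoc]
  exact _ ≫= h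

theorem a₂_t : a₂ A B ≫ B.t = (family (j₂ A B ≫ e₀ A B)).onObj := by
  have h := agree.condition (A.obj ◁ j₁ A B ≫ a₀ A B ≫ B.t)
    (A.obj ◁ j₁ A B ≫ (family (e₀ A B)).onObj)
  rw [family_comp_onObj, a₂, j₂, MonoidalCategory.whiskerLeft_comp, Category.assoc,
    Category.assoc, Category.assoc]
  exact h

theorem composable₁ : (family (j₂ A B ≫ d₀ A B)).onMor ≫ B.t = (A.t ▷ _ ≫ a₂ A B) ≫ B.s := by
  rw [Category.assoc, a₂_s, (family (j₂ A B ≫ d₀ A B)).map_t]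

theorem composable₂ : (A.s ▷ _ ≫ a₂ A B) ≫ B.t = (family (j₂ A B ≫ e₀ A B)).onMor ≫ B.s := by
  rw [Category.assoc, a₂_t, (family (j₂ A B ≫ e₀ A B)).map_s]

/-- The object of internal natural transformations. -/
def mor : V :=
  agree (B.comp (family (j₂ A B ≫ d₀ A B)).onMor (A.t ▷ _ ≫ a₂ A B) (composable₁ A B))
    (B.comp (A.s ▷ _ ≫ a₂ A B) (family (j₂ A B ≫ e₀ A B)).onMor (composable₂ A B))

/-- The inclusion of the object of internal natural transformations. -/
def j : mor A B ⟶ N₂ A B := agree.ι _ _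

theorem j_natural :
    A.mor ◁ j A B ≫ B.comp (family (j₂ A B ≫ d₀ A B)).onMor (A.t ▷ _ ≫ a₂ A B)
        (composable₁ A B) =
      A.mor ◁ j A B ≫ B.comp (A.s ▷ _ ≫ a₂ A B) (family (j₂ A B ≫ e₀ A B)).onMor
        (composable₂ A B) :=
  agree.condition _ _

/-- The universal family of internal natural transformations. -/
@[simps]
def univ : NatFamily A B (mor A B) where
  dom := j A B ≫ j₂ A B ≫ d₀ A B
  cod := j A B ≫ j₂ A B ≫ e₀ A B
  app := A.obj ◁ j A B ≫ a₂ A B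
  app_s := by rw [Category.assoc, a₂_s, family_comp_onObj _ (j₂ A B ≫ d₀ A B)]
  app_t := by rw [Category.assoc, a₂_t, family_comp_onObj _ (j₂ A B ≫ e₀ A B)]
  natural := by
    have h := j_natural A B
    rw [B.whisker_comp, B.whisker_comp] at h
    refine (B.comp_congr ?_ ?_ _).trans (h.trans (B.comp_congr ?_ ?_ _))
    · rw [← family_comp_onMor]
    · rw [whisker_exchange_assoc]
    · rw [whisker_exchange_assoc]
    · rw [← family_comp_onMor]

variable {A B}

theorem pre_univ_ext {X : V} {f g : X ⟶ mor A B} (h : (univ A B).pre f = (univ A B).pre g) :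
    f = g := by
  have h0 : (f ≫ j A B) ≫ j₂ A B = (g ≫ j A B) ≫ j₂ A B := by
    have h1 := congrArg NatFamily.dom h
    have h2 := congrArg NatFamily.cod h
    have h3 := congrArg NatFamily.app h
    apply CartesianMonoidalCategory.hom_ext
    · apply CartesianMonoidalCategory.hom_ext
      · simpa only [d₀, NatFamily.pre_dom, univ_dom, Category.assoc] using h1
      · simpa only [e₀, NatFamily.pre_cod, univ_cod, Category.assoc] using h2
    · apply uncurry_injective
      rw [uncurry_natural_left, uncurry_natural_left]
      simpa [a₂, a₀] using h3
  apply agree.hom_ext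
  apply agree.hom_ext
  apply agree.hom_ext
  exact (Category.assoc _ _ _).trans (h0.trans (Category.assoc _ _ _).symm)

theorem exists_pre_univ {X : V} (N : NatFamily A B X) :
    ∃ f : X ⟶ mor A B, (univ A B).pre f = N := by
  let f₀ : X ⟶ N₀ A B := lift (lift N.dom N.cod) (curry N.app)
  have hd : f₀ ≫ d₀ A B = N.dom := by rw [d₀, lift_fst_assoc, lift_fst]
  have he : f₀ ≫ e₀ A B = N.cod := by rw [e₀, lift_fst_assoc, lift_snd]
  have ha : A.obj ◁ f₀ ≫ a₀ A B = N.app := by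
    rw [a₀, ← uncurry_natural_left, lift_snd, uncurry_curry]
  obtain ⟨f₁, h₁⟩ := agree.exists_lift (a₀ A B ≫ B.s) (family (d₀ A B)).onObj f₀ (by
    rw [reassoc_of% ha, ← family_comp_onObj, hd, N.app_s])
  obtain ⟨f₂, h₂⟩ := agree.exists_lift (A.obj ◁ j₁ A B ≫ a₀ A B ≫ B.t)
    (A.obj ◁ j₁ A B ≫ (family (e₀ A B)).onObj) f₁ (by
      rw [← MonoidalCategory.whiskerLeft_comp_assoc, ← MonoidalCategory.whiskerLeft_comp_assoc,
        h₁, reassoc_of% ha, ← family_comp_onObj, he, N.app_t])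
  have h₂' : f₂ ≫ j₂ A B = f₀ := (Category.assoc _ _ _).symm.trans ((h₂ =≫ j₁ A B).trans h₁)
  have ha₂ : A.obj ◁ f₂ ≫ a₂ A B = N.app := by
    rw [a₂, ← MonoidalCategory.whiskerLeft_comp_assoc, h₂', ha]
  have hd₂ : f₂ ≫ j₂ A B ≫ d₀ A B = N.dom := by rw [reassoc_of% h₂', hd]
  have he₂ : f₂ ≫ j₂ A B ≫ e₀ A B = N.cod := by rw [reassoc_of% h₂', he]
  obtain ⟨f, h⟩ := agree.exists_lift
    (B.comp (family (j₂ A B ≫ d₀ A B)).onMor (A.t ▷ _ ≫ a₂ A B) (composable₁ A B))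
    (B.comp (A.s ▷ _ ≫ a₂ A B) (family (j₂ A B ≫ e₀ A B)).onMor (composable₂ A B)) f₂ (by
      rw [B.whisker_comp, B.whisker_comp]
      refine (B.comp_congr ?_ ?_ _).trans (N.natural.trans (B.comp_congr ?_ ?_ _))
      · rw [← family_comp_onMor, hd₂]
      · rw [whisker_exchange_assoc, ha₂]
      · rw [whisker_exchange_assoc, ha₂]
      · rw [← family_comp_onMor, he₂])
  refine ⟨f, NatFamily.ext ?_ ?_ ?_⟩
  · refine Eq.trans ?_ hd₂
    exact (Category.assoc _ _ _).symm.trans (h =≫ (j₂ A B ≫ d₀ A B))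
  · refine Eq.trans ?_ he₂
    exact (Category.assoc _ _ _).symm.trans (h =≫ (j₂ A B ≫ e₀ A B))
  · refine Eq.trans ?_ ha₂
    exact (MonoidalCategory.whiskerLeft_comp_assoc _ _ _ _).symm.trans
      (congrArg (fun q => A.obj ◁ q ≫ a₂ A B) h)

/-- The map to `mor A B` that classifies a family of internal natural transformations. -/
def classifyNat {X : V} (N : NatFamily A B X) : X ⟶ mor A B :=
  (exists_pre_univ N).choose

@[simp]
theorem pre_classifyNat {X : V} (N : NatFamily A B X) : (univ A B).pre (classifyNat N) = N :=
  (exists_pre_univ N).choose_spec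

theorem classifyNat_dom {X : V} (N : NatFamily A B X) :
    classifyNat N ≫ (univ A B).dom = N.dom :=
  congrArg NatFamily.dom (pre_classifyNat N)

theorem classifyNat_cod {X : V} (N : NatFamily A B X) :
    classifyNat N ≫ (univ A B).cod = N.cod :=
  congrArg NatFamily.cod (pre_classifyNat N)

theorem classifyNat_app {X : V} (N : NatFamily A B X) :
    A.obj ◁ classifyNat N ≫ (univ A B).app = N.app :=
  congrArg NatFamily.app (pre_classifyNat N)

/-- Identity natural transformations. -/
@[simps]
def NatFamily.id {X : V} (f : X ⟶ obj A B) : NatFamily A B X where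
  dom := f
  cod := f
  app := (family f).onObj ≫ B.i
  app_s := by rw [Category.assoc, B.i_s, Category.comp_id]
  app_t := by rw [Category.assoc, B.i_t, Category.comp_id]
  natural := by
    rw [B.comp_congr rfl (Category.assoc _ _ _).symm, B.comp_id,
      B.comp_congr (Category.assoc _ _ _).symm rfl, B.id_comp]

theorem NatFamily.composable {X : V} {M N : NatFamily A B X} (h : M.cod = N.dom) :
    M.app ≫ B.t = N.app ≫ B.s := by
  rw [M.app_t, N.app_s, h]

/-- Vertical composition of natural transformations. -/
@[simps]
def NatFamily.comp {X : V} (M N : NatFamily A B X) (h : M.cod = N.dom) : NatFamily A B X where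
  dom := M.dom
  cod := N.cod
  app := B.comp M.app N.app (NatFamily.composable h)
  app_s := by rw [B.comp_s, M.app_s]
  app_t := by rw [B.comp_t, N.app_t]
  natural := by
    obtain ⟨md, mc, ma, mas, mat, mn⟩ := M
    obtain ⟨nd, nc, na, nas, nat, nn⟩ := N
    dsimp only at h
    subst h
    dsimp only at mn nn ⊢
    have e1 := B.whisker_comp (A.t ▷ X) ma na (by rw [mat, nas])
    have e2 := B.whisker_comp (A.s ▷ X) ma na (by rw [mat, nas])
    rw [B.comp_congr rfl e1, B.comp_congr e2 rfl]
    rw [← B.comp_assoc _ _ _ (by rw [Category.assoc, mas, (family md).map_t])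
      (by rw [Category.assoc, Category.assoc, mat, nas])]
    rw [B.comp_congr mn rfl]
    rw [B.comp_assoc _ _ _ (by rw [Category.assoc, mat, (family mc).map_s])
      (by rw [Category.assoc, nas, (family mc).map_t])]
    rw [B.comp_congr rfl nn]
    rw [B.comp_assoc _ _ _ (by rw [Category.assoc, Category.assoc, mat, nas])
      (by rw [Category.assoc, nat, (family nc).map_s])]

theorem hom_ext {X : V} {f g : X ⟶ mor A B} (h₁ : f ≫ (univ A B).dom = g ≫ (univ A B).dom)
    (h₂ : f ≫ (univ A B).cod = g ≫ (univ A B).cod)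
    (h₃ : A.obj ◁ f ≫ (univ A B).app = A.obj ◁ g ≫ (univ A B).app) : f = g :=
  pre_univ_ext (NatFamily.ext h₁ h₂ h₃)

/-- The identity transformations, as a map. -/
def idt : obj A B ⟶ mor A B :=
  classifyNat (NatFamily.id (𝟙 _))

/-- Vertical composition of transformations, on generalized elements. -/
def vcomp {X : V} (f g : X ⟶ mor A B) (h : f ≫ (univ A B).cod = g ≫ (univ A B).dom) :
    X ⟶ mor A B :=
  classifyNat (((univ A B).pre f).comp ((univ A B).pre g) h)

theorem idt_dom : idt ≫ (univ A B).dom = 𝟙 _ := classifyNat_dom _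

theorem idt_cod : idt ≫ (univ A B).cod = 𝟙 _ := classifyNat_cod _

theorem whisker_idt_app {X : V} (f : X ⟶ obj A B) :
    A.obj ◁ (f ≫ idt) ≫ (univ A B).app = (family f).onObj ≫ B.i := by
  rw [MonoidalCategory.whiskerLeft_comp_assoc, idt, classifyNat_app, NatFamily.id_app,
    ← Category.assoc, ← family_comp_onObj, Category.comp_id]

section

variable {X : V} (f g : X ⟶ mor A B)

theorem vcomp_dom (h) : vcomp f g h ≫ (univ A B).dom = f ≫ (univ A B).dom := classifyNat_dom _

theorem vcomp_cod (h) : vcomp f g h ≫ (univ A B).cod = g ≫ (univ A B).cod := classifyNat_cod _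

theorem composable_app (h : f ≫ (univ A B).cod = g ≫ (univ A B).dom) : (A.obj ◁ f ≫ (univ A B).app) ≫ B.t =
    (A.obj ◁ g ≫ (univ A B).app) ≫ B.s :=
  NatFamily.composable (M := (univ A B).pre f) (N := (univ A B).pre g) h

theorem vcomp_app (h) : A.obj ◁ vcomp f g h ≫ (univ A B).app =
    B.comp (A.obj ◁ f ≫ (univ A B).app) (A.obj ◁ g ≫ (univ A B).app)
      (composable_app f g h) :=
  classifyNat_app _

end

/-- The data of the internal hom of two internal categories. -/
def data (A B : InternalCat V) : CompData V where
  obj := obj A B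
  mor := mor A B
  s := (univ A B).dom
  t := (univ A B).cod
  i := idt
  i_s := idt_dom
  i_t := idt_cod
  m f g h := vcomp f g h
  m_s f g h := vcomp_dom f g h
  m_t f g h := vcomp_cod f g h
  m_nat k f g h := by
    apply hom_ext
    · rw [Category.assoc, vcomp_dom, vcomp_dom, Category.assoc]
    · rw [Category.assoc, vcomp_cod, vcomp_cod, Category.assoc]
    · rw [MonoidalCategory.whiskerLeft_comp_assoc, vcomp_app, vcomp_app, B.whisker_comp]
      apply B.comp_congr <;> rw [MonoidalCategory.whiskerLeft_comp_assoc]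
  id_m := by
    apply hom_ext
    · rw [vcomp_dom, Category.assoc, idt_dom, Category.comp_id, Category.id_comp]
    · rw [vcomp_cod]
    · rw [vcomp_app, B.comp_congr (whisker_idt_app _) rfl, B.id_comp]
  m_id := by
    apply hom_ext
    · rw [vcomp_dom]
    · rw [vcomp_cod, Category.assoc, idt_cod, Category.comp_id, Category.id_comp]
    · rw [vcomp_app, B.comp_congr rfl (whisker_idt_app _), B.comp_id]
  m_assoc f g h hfg hgh := by
    apply hom_ext
    · simp only [vcomp_dom]
    · simp only [vcomp_cod]
    · exact (vcomp_app _ _ _).trans ((B.comp_congr (vcomp_app f g hfg) rfl _).trans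
        ((B.comp_assoc _ _ _ (composable_app f g hfg) (composable_app g h hgh)).trans
        ((B.comp_congr rfl (vcomp_app g h hgh).symm _).trans (vcomp_app _ _ _).symm)))

end internalHom

/-- The internal hom `⟦A, B⟧` of `Cat(V)`: its object of objects classifies families of internal
functors and its object of morphisms classifies families of internal natural transformations. -/
def internalHom (A B : InternalCat V) : InternalCat V :=
  (internalHom.data A B).toInternalCat

end InternalHomMor

section Insert

variable {V : Type u} [Category.{v} V] [CartesianMonoidalCategory V]

/-- The map `X ⟶ A ⊗ X` that inserts an element `a` of `A`. -/
def insertElem {A : V} (a : 𝟙_ V ⟶ A) (X : V) : X ⟶ A ⊗ X :=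
  lift (toUnit X ≫ a) (𝟙 X)

theorem insertElem_nat {A : V} (a : 𝟙_ V ⟶ A) {X Y : V} (k : Y ⟶ X) :
    k ≫ insertElem a X = insertElem a Y ≫ A ◁ k := by
  ext <;> simp [insertElem]

end Insert

section Comma

attribute [local simp] pullback.lift_fst pullback.lift_snd pullback.lift_fst_assoc
  pullback.lift_snd_assoc

variable {V : Type u} [Category.{v} V] [CartesianMonoidalCategory V] [HasPullbacks V]

/-- The internal functor `A ⟶ B` that is constant at an object `b` of `B`, i.e. the composite
of `A ⟶ ∗` with `b : ∗ ⟶ B`. -/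
def constAt (A : InternalCat V) {B : InternalCat V} (b : 𝟙_ V ⟶ B.obj) : InternalFunctor A B :=
  InternalFunctor.mk' (toUnit _ ≫ b) (toUnit _ ≫ b ≫ B.i)
    (by simp) (by simp) (by simp)
    (fun f g h => by
      rw [B.comp_congr (f' := (toUnit _ ≫ b) ≫ B.i) (by simp) rfl, B.id_comp]
      simp)

variable [MonoidalClosed V]

open MonoidalClosed internalHom

/-- The family of internal functors that is constant at `F`. -/
@[simps]
def constFamily {A B : InternalCat V} (F : InternalFunctor A B) (X : V) :
    FunctorFamily A B X where
  onObj := fst _ _ ≫ F.onObj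
  onMor := fst _ _ ≫ F.onMor
  map_s := by simp
  map_t := by simp
  map_i := by simp
  map_c := by
    rw [B.comp_congr (f' := fst _ _ ≫ pullback.fst A.t A.s ≫ F.onMor)
      (g' := fst _ _ ≫ pullback.snd A.t A.s ≫ F.onMor) (by simp) (by simp),
      ← B.whisker_comp _ _ _ (by simp [pullback.condition_assoc])]
    rw [whiskerRight_fst_assoc, F.map_c]
    rfl

/-- The element of `⟦A, B⟧` that corresponds to an internal functor `A ⟶ B`. -/
def nameOf {A B : InternalCat V} (F : InternalFunctor A B) : 𝟙_ V ⟶ (internalHom A B).obj :=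
  classify (constFamily F (𝟙_ V))

/-- The internal functor `⟦A, B⟧ ⟶ B` given by evaluation at an object `a` of `A`, i.e. by
precomposition with `a : ∗ ⟶ A`. -/
def evalAt {A : InternalCat V} (a : 𝟙_ V ⟶ A.obj) (B : InternalCat V) :
    InternalFunctor (internalHom A B) B :=
  InternalFunctor.mk' (A := internalHom A B) (insertElem a (obj A B) ≫ (family (𝟙 (obj A B))).onObj)
    (insertElem a (mor A B) ≫ (univ A B).app)
    (show (insertElem a (mor A B) ≫ (univ A B).app) ≫ B.s = (univ A B).dom ≫
        insertElem a (obj A B) ≫ (family (𝟙 (obj A B))).onObj by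
      rw [reassoc_of% (insertElem_nat a (univ A B).dom), ← family_comp_onObj, Category.comp_id,
        Category.assoc, (univ A B).app_s])
    (show (insertElem a (mor A B) ≫ (univ A B).app) ≫ B.t = (univ A B).cod ≫
        insertElem a (obj A B) ≫ (family (𝟙 (obj A B))).onObj by
      rw [reassoc_of% (insertElem_nat a (univ A B).cod), ← family_comp_onObj, Category.comp_id,
        Category.assoc, (univ A B).app_t])
    (show idt ≫ insertElem a (mor A B) ≫ (univ A B).app = (insertElem a (obj A B) ≫
        (family (𝟙 (obj A B))).onObj) ≫ B.i by
      rw [reassoc_of% (insertElem_nat a (idt (A := A) (B := B))), Category.assoc, ← whisker_idt_app,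
        Category.id_comp])
    (fun {X} f g h => by
      have key : ∀ (f g : X ⟶ mor A B) (h : f ≫ (univ A B).cod = g ≫ (univ A B).dom) (h'),
          vcomp f g h ≫ insertElem a (mor A B) ≫ (univ A B).app =
            B.comp (f ≫ insertElem a (mor A B) ≫ (univ A B).app)
              (g ≫ insertElem a (mor A B) ≫ (univ A B).app) h' := by
        intro f g h h'
        rw [reassoc_of% (insertElem_nat a (vcomp f g h)), vcomp_app, B.whisker_comp]
        apply B.comp_congr
        · rw [reassoc_of% (insertElem_nat a f)]
        · rw [reassoc_of% (insertElem_nat a g)]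
      exact (CompData.toInternalCat_comp (internalHom.data A B) f g h =≫
        (insertElem a (mor A B) ≫ (univ A B).app)).trans (key f g h _))

theorem nameOf_evalAt {A B : InternalCat V} (F : InternalFunctor A B) (a : 𝟙_ V ⟶ A.obj) :
    nameOf F ≫ (evalAt a B).onObj = a ≫ F.onObj := by
  have h : classify (constFamily F (𝟙_ V)) ≫ insertElem a (obj A B) ≫ (family (𝟙 (obj A B))).onObj = a ≫ F.onObj := by
    rw [reassoc_of% (insertElem_nat a (classify (constFamily F (𝟙_ V)))), ← family_comp_onObj,
      Category.comp_id, family_classify, constFamily_onObj, insertElem, lift_fst_assoc,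
      toUnit_unique (toUnit (𝟙_ V)) (𝟙 _), Category.id_comp]
  exact h

end Comma

section Underlying

attribute [local simp] pullback.lift_fst pullback.lift_snd pullback.lift_fst_assoc
  pullback.lift_snd_assoc

variable {V : Type u} [Category.{v} V] [CartesianMonoidalCategory V] [HasPullbacks V]

/-- The objects of the underlying `V`-category of an internal category `A` are the elements of
the object of objects of `A`. -/
structure Und (A : InternalCat V) where
  /-- the element -/
  elt : 𝟙_ V ⟶ A.obj

namespace Und

variable {A : InternalCat V}

/-- The hom-objects of the underlying `V`-category: the pullback of
`(s, t) : A.mor ⟶ A.obj ⊗ A.obj` along `(a, b) : 𝟙_ V ⟶ A.obj ⊗ A.obj`. -/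
def hom (a b : Und A) : V :=
  pullback (lift A.s A.t) (lift a.elt b.elt)

/-- The projection of the hom-object to the object of morphisms. -/
def toMor (a b : Und A) : hom a b ⟶ A.mor :=
  pullback.fst _ _

theorem toMor_s (a b : Und A) : toMor a b ≫ A.s = toUnit _ ≫ a.elt := by
  have h := pullback.condition (f := lift A.s A.t) (g := lift a.elt b.elt) =≫ fst _ _
  rw [Category.assoc, Category.assoc, lift_fst, lift_fst] at h
  exact h.trans (congrArg (fun q => q ≫ a.elt) (toUnit_unique _ _))

theorem toMor_t (a b : Und A) : toMor a b ≫ A.t = toUnit _ ≫ b.elt := by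
  have h := pullback.condition (f := lift A.s A.t) (g := lift a.elt b.elt) =≫ snd _ _
  rw [Category.assoc, Category.assoc, lift_snd, lift_snd] at h
  exact h.trans (congrArg (fun q => q ≫ b.elt) (toUnit_unique _ _))

theorem hom_ext {a b : Und A} {X : V} {f g : X ⟶ hom a b} (h : f ≫ toMor a b = g ≫ toMor a b) :
    f = g := by
  apply pullback.hom_ext
  · exact h
  · exact toUnit_unique _ _

/-- Maps to hom-objects of the underlying `V`-category. -/
def homLift {a b : Und A} {X : V} (f : X ⟶ A.mor) (hs : f ≫ A.s = toUnit _ ≫ a.elt)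
    (ht : f ≫ A.t = toUnit _ ≫ b.elt) : X ⟶ hom a b :=
  pullback.lift f (toUnit X) (by ext <;> simp [hs, ht])

@[simp]
theorem homLift_toMor {a b : Und A} {X : V} (f : X ⟶ A.mor) (hs : f ≫ A.s = toUnit _ ≫ a.elt)
    (ht : f ≫ A.t = toUnit _ ≫ b.elt) : homLift f hs ht ≫ toMor a b = f :=
  pullback.lift_fst _ _ _

/-- The identities of the underlying `V`-category. -/
def ident (a : Und A) : 𝟙_ V ⟶ hom a a :=
  homLift (a.elt ≫ A.i) (by simp) (by simp)

/-- The composition maps of the underlying `V`-category. -/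
def compos (a b c : Und A) : hom a b ⊗ hom b c ⟶ hom a c :=
  homLift (A.comp (fst _ _ ≫ toMor a b) (snd _ _ ≫ toMor b c) (by simp [toMor_s, toMor_t]))
    (by simp [toMor_s]) (by simp [toMor_t])

theorem lift_compos {a b c : Und A} {X : V} (f : X ⟶ hom a b) (g : X ⟶ hom b c) :
    (lift f g ≫ compos a b c) ≫ toMor a c = A.comp (f ≫ toMor a b) (g ≫ toMor b c)
      (by simp [toMor_s, toMor_t]) := by
  rw [Category.assoc, compos, homLift_toMor, A.whisker_comp]
  apply A.comp_congr <;> simp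

instance : EnrichedCategory V (Und A) where
  Hom := hom
  id := ident
  comp := compos
  id_comp a b := by
    apply hom_ext
    have h : (λ_ (hom a b)).inv ≫ ident a ▷ hom a b =
        lift (toUnit _ ≫ ident a) (𝟙 _) := by ext <;> simp
    rw [reassoc_of% h, lift_compos,
      A.comp_congr (f' := (toUnit _ ≫ a.elt) ≫ A.i) (by simp [ident]) rfl, A.id_comp]
  comp_id a b := by
    apply hom_ext
    have h : (ρ_ (hom a b)).inv ≫ hom a b ◁ ident b =
        lift (𝟙 _) (toUnit _ ≫ ident b) := by ext <;> simp
    rw [reassoc_of% h, lift_compos,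
      A.comp_congr (g' := (toUnit _ ≫ b.elt) ≫ A.i) rfl (by simp [ident]), A.comp_id]
  assoc a b c d := by
    apply hom_ext
    have h1 : (α_ (hom a b) (hom b c) (hom c d)).inv ≫ compos a b c ▷ hom c d =
        lift (lift (fst _ _) (snd _ _ ≫ fst _ _) ≫ compos a b c) (snd _ _ ≫ snd _ _) := by
      ext
      · simp only [Category.assoc, whiskerRight_fst, lift_fst]
        rw [← Category.assoc]
        congr 1
        ext <;> simp
      · simp
    have h2 : hom a b ◁ compos b c d =
        lift (fst _ _) (lift (snd _ _ ≫ fst _ _) (snd _ _ ≫ snd _ _) ≫ compos b c d) := by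
      ext
      · simp
      · rw [whiskerLeft_snd, lift_snd]
        congr 1
        ext <;> simp
    rw [reassoc_of% h1, h2]
    refine (lift_compos _ _).trans ((A.comp_congr (lift_compos _ _) rfl _).trans
      ((A.comp_assoc _ _ _ ?_ ?_).trans
      ((A.comp_congr rfl (lift_compos _ _).symm _).trans (lift_compos _ _).symm))) <;>
    simp [toMor_s, toMor_t]

end Und

variable (V) in
/-- An object `T` of a `V`-category is `V`-terminal if `C(A, T) ⟶ 𝟙_ V` is invertible for each
object `A`. -/
def IsVTerminal {C : Type*} [EnrichedCategory V C] (T : C) : Prop :=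
  ∀ A : C, IsIso (toUnit (A ⟶[V] T))

/-- A family of objects of `V` is conservative if it detects isomorphisms: a map `f : Y ⟶ Z` is
invertible if and only if `V(X, Y) ⟶ V(X, Z)` is bijective for each `X` in the family. -/
def IsConservative (𝒢 : Set V) : Prop :=
  ∀ ⦃Y Z : V⦄ (f : Y ⟶ Z), IsIso f ↔ ∀ X ∈ 𝒢, Function.Bijective fun g : X ⟶ Y => g ≫ f

end Underlying

/-! ### Internalization -/

section EnrichedElements

variable {V : Type u} [Category.{v} V] [CartesianMonoidalCategory V]
variable {C : Type*} [EnrichedCategory V C]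

theorem lift_eId_eComp {X : V} {A B : C} (f : X ⟶ (A ⟶[V] B)) :
    lift (toUnit X ≫ eId V A) f ≫ eComp V A A B = f := by
  have h : lift (toUnit X ≫ eId V A) f = f ≫ (λ_ _).inv ≫ eId V A ▷ _ := by ext <;> simp
  rw [h, Category.assoc, Category.assoc, e_id_comp, Category.comp_id]

theorem lift_eComp_eId {X : V} {A B : C} (f : X ⟶ (A ⟶[V] B)) :
    lift f (toUnit X ≫ eId V B) ≫ eComp V A B B = f := by
  have h : lift f (toUnit X ≫ eId V B) = f ≫ (ρ_ _).inv ≫ _ ◁ eId V B := by ext <;> simp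
  rw [h, Category.assoc, Category.assoc, e_comp_id, Category.comp_id]

theorem lift_eComp_assoc {X : V} {A B D E : C} (f : X ⟶ (A ⟶[V] B)) (g : X ⟶ (B ⟶[V] D))
    (h : X ⟶ (D ⟶[V] E)) :
    lift (lift f g ≫ eComp V A B D) h ≫ eComp V A D E =
      lift f (lift g h ≫ eComp V B D E) ≫ eComp V A B E := by
  have h1 : lift (lift f g ≫ eComp V A B D) h =
      lift f (lift g h) ≫ (α_ _ _ _).inv ≫ eComp V A B D ▷ _ := by
    ext
    · simp
    · simp
  have h2 : lift f (lift g h ≫ eComp V B D E) = lift f (lift g h) ≫ _ ◁ eComp V B D E := by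
    ext <;> simp
  rw [h1, h2, Category.assoc, Category.assoc, Category.assoc, e_assoc]

end EnrichedElements

section Internalization

set_option linter.unusedSectionVars false

attribute [local simp] pullback.lift_fst pullback.lift_snd pullback.lift_fst_assoc
  pullback.lift_snd_assoc

variable {V : Type u} [Category.{v} V] [CartesianMonoidalCategory V] [HasPullbacks V] [Extensive V]

namespace internalize

variable (V) in
/-- The coproduct `∐_A 1`, the object of objects of the internalization. -/
abbrev Ob (C : Type v) : V :=
  ∐ fun _ : C => 𝟙_ V

/-- The element of `Ob V C` given by an object of `C`. -/
abbrev el {C : Type v} (A : C) : 𝟙_ V ⟶ Ob V C :=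
  Limits.Sigma.ι (fun _ : C => 𝟙_ V) A

/-- The generalized element of `Ob V C` that is constant at an object of `C`. -/
abbrev gel {C : Type v} (A : C) (X : V) : X ⟶ Ob V C :=
  toUnit X ≫ el A

variable {C : Type v} [EnrichedCategory V C]

variable (V C) in
/-- The coproduct `∐_{A, B} C(A, B)`, the object of morphisms of the internalization. -/
abbrev Mor : V :=
  ∐ fun p : C × C => (p.1 ⟶[V] p.2)

/-- The inclusion of a hom-object in the object of morphisms. -/
abbrev incl (A B : C) : (A ⟶[V] B) ⟶ Mor V C :=
  Limits.Sigma.ι (fun p : C × C => (p.1 ⟶[V] p.2)) (A, B)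

variable (V C) in
/-- The source map. -/
def src : Mor V C ⟶ Ob V C :=
  Limits.Sigma.desc fun p : C × C => gel p.1 _

variable (V C) in
/-- The target map. -/
def tgt : Mor V C ⟶ Ob V C :=
  Limits.Sigma.desc fun p : C × C => gel p.2 _

variable (V C) in
/-- The identities. -/
def ident : Ob V C ⟶ Mor V C :=
  Limits.Sigma.desc fun A : C => eId V A ≫ incl A A

@[simp]
theorem incl_src (A B : C) : incl A B ≫ src V C = gel A _ :=
  Limits.Sigma.ι_desc _ _

@[simp]
theorem incl_tgt (A B : C) : incl A B ≫ tgt V C = gel B _ :=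
  Limits.Sigma.ι_desc _ _

@[simp]
theorem el_ident (A : C) : el A ≫ ident V C = eId V A ≫ incl A A :=
  Limits.Sigma.ι_desc _ _

variable (V C) in
/-- The object of morphisms, with the coproduct taken over the source object first. -/
abbrev Mor' : V :=
  ∐ fun A : C => ∐ fun B : C => (A ⟶[V] B)

variable (V C) in
/-- The comparison of the two descriptions of the object of morphisms. -/
def reindex : Mor V C ⟶ Mor' V C :=
  Limits.Sigma.desc fun p : C × C => Limits.Sigma.ι (fun B : C => (p.1 ⟶[V] B)) p.2 ≫
    Limits.Sigma.ι (fun A : C => ∐ fun B : C => (A ⟶[V] B)) p.1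

/-- The inclusion of the object of all morphisms with source `A`. -/
def fromSrc (A : C) : (∐ fun B : C => (A ⟶[V] B)) ⟶ Mor V C :=
  Limits.Sigma.desc fun B => incl A B

theorem ι_fromSrc (A B : C) : Limits.Sigma.ι (fun B : C => (A ⟶[V] B)) B ≫ fromSrc A = incl A B :=
  Limits.Sigma.ι_desc _ _

theorem reindex_desc : reindex V C ≫ Limits.Sigma.desc (fun A : C => fromSrc A) = 𝟙 _ := by
  apply Limits.Sigma.hom_ext
  intro p
  simp [reindex, fromSrc]

theorem fromSrc_reindex (A : C) : fromSrc A ≫ reindex V C =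
    Limits.Sigma.ι (fun A : C => ∐ fun B : C => (A ⟶[V] B)) A := by
  apply Limits.Sigma.hom_ext
  intro p
  simp [reindex, fromSrc]

theorem reindex_src : reindex V C ≫ Limits.Sigma.map (fun _ : C => toUnit _) = src V C := by
  apply Limits.Sigma.hom_ext
  intro p
  simp [reindex, src]

theorem exists_fromSrc {X : V} (g : X ⟶ Mor V C) (A : C) (h : g ≫ src V C = gel A X) :
    ∃ g' : X ⟶ ∐ fun B : C => (A ⟶[V] B), g' ≫ fromSrc A = g := by
  obtain ⟨g', h1, -⟩ := exists_factor (fun A : C => toUnit (∐ fun B : C => (A ⟶[V] B)))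
    (g ≫ reindex V C) (toUnit X) (by rw [Category.assoc, reindex_src, h])
  refine ⟨g', ?_⟩
  have h2 := h1 =≫ Limits.Sigma.desc (fun A : C => fromSrc A)
  rw [Category.assoc, Category.assoc, reindex_desc, Category.comp_id, Limits.Sigma.ι_desc] at h2
  exact h2

theorem fromSrc_cancel {X : V} {A : C} (f g : X ⟶ ∐ fun B : C => (A ⟶[V] B))
    (h : f ≫ fromSrc A = g ≫ fromSrc A) : f = g := by
  apply factor_unique (fun A : C => toUnit (∐ fun B : C => (A ⟶[V] B)))
  · rw [← fromSrc_reindex, reassoc_of% h]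
  · exact toUnit_unique _ _

/-- Maps out of an object with a map `g` to the object of morphisms may be compared where `g`
factors through a hom-object. -/
theorem ext_incl {X Z : V} (g : X ⟶ Mor V C) {a b : X ⟶ Z}
    (h : ∀ (A B : C) (T : V) (y : T ⟶ X) (x : T ⟶ (A ⟶[V] B)), y ≫ g = x ≫ incl A B →
      y ≫ a = y ≫ b) : a = b :=
  hom_ext_of_coproduct g fun p T y x hx => h p.1 p.2 T y x hx

theorem ext_incl_of_src {X Z : V} (g : X ⟶ Mor V C) {a b : X ⟶ Z} (A : C)
    (hg : g ≫ src V C = gel A X)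
    (h : ∀ (B : C) (T : V) (y : T ⟶ X) (x : T ⟶ (A ⟶[V] B)), y ≫ g = x ≫ incl A B →
      y ≫ a = y ≫ b) : a = b := by
  obtain ⟨g', hg'⟩ := exists_fromSrc g A hg
  refine hom_ext_of_coproduct g' fun B T y x hx => h B T y x ?_
  rw [← hg', reassoc_of% hx, ι_fromSrc]

/-- A generalized element of the object of composable pairs that is given by elements `f` of
`C(A, B)` and `g` of `C(B, D)`. -/
def IsPair {T : V} (y : T ⟶ pullback (tgt V C) (src V C)) {A B D : C} (f : T ⟶ (A ⟶[V] B))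
    (g : T ⟶ (B ⟶[V] D)) : Prop :=
  y ≫ pullback.fst _ _ = f ≫ incl A B ∧ y ≫ pullback.snd _ _ = g ≫ incl B D

/-- The object of composable pairs is the coproduct of the objects `C(A, B) ⊗ C(B, D)`. -/
theorem exists_glue {Z : V} (k : ∀ A B D : C, (A ⟶[V] B) ⊗ (B ⟶[V] D) ⟶ Z) :
    ∃ c : pullback (tgt V C) (src V C) ⟶ Z, ∀ (T : V) (y : T ⟶ _) (A B D : C)
      (f : T ⟶ (A ⟶[V] B)) (g : T ⟶ (B ⟶[V] D)), IsPair y f g → y ≫ c = lift f g ≫ k A B D := by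
  obtain ⟨W, p, e, he⟩ := exists_decomposition (pullback.fst (tgt V C) (src V C))
  have h1 : ∀ q : C × C, ∃ u : W q ⟶ ∐ fun D : C => (q.2 ⟶[V] D),
      u ≫ fromSrc q.2 = Limits.Sigma.ι W q ≫ e.hom ≫ pullback.snd _ _ := by
    intro q
    apply exists_fromSrc
    rw [Category.assoc, Category.assoc, ← pullback.condition, reassoc_of% he,
      Limits.Sigma.ι_map_assoc]
    refine (p q ≫= incl_tgt q.1 q.2).trans ?_
    rw [comp_toUnit_assoc]
  choose u hu using h1
  have h2 : ∀ q : C × C, ∃ c : W q ⟶ Z, ∀ (D : C) (T : V) (y : T ⟶ W q) (x : T ⟶ (q.2 ⟶[V] D)),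
      y ≫ u q = x ≫ Limits.Sigma.ι (fun D : C => (q.2 ⟶[V] D)) D →
        y ≫ c = lift (y ≫ p q) x ≫ k _ _ _ := by
    intro q
    obtain ⟨W', p', e', he'⟩ := exists_decomposition (u q)
    refine ⟨e'.inv ≫ Limits.Sigma.desc
      (fun D => lift (Limits.Sigma.ι W' D ≫ e'.hom ≫ p q) (p' D) ≫ k _ _ _), ?_⟩
    intro D T y x h
    obtain ⟨w, hw, hw'⟩ := exists_factor p' (y ≫ e'.inv) x (by
      rw [Category.assoc, ← he', Iso.inv_hom_id_assoc, h])
    rw [← Category.assoc, ← hw, Category.assoc, Limits.Sigma.ι_desc, comp_lift_assoc, hw',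
      reassoc_of% hw, Iso.inv_hom_id_assoc]
  choose c hc using h2
  refine ⟨e.inv ≫ Limits.Sigma.desc c, ?_⟩
  intro T y A B D f g hy
  obtain ⟨w, hw, hw'⟩ := exists_factor p (j := (A, B)) (y ≫ e.inv) f (by
    rw [Category.assoc, ← he, Iso.inv_hom_id_assoc, hy.1])
  rw [← Category.assoc, ← hw, Category.assoc, Limits.Sigma.ι_desc, hc (A, B) D T w g, hw']
  apply fromSrc_cancel
  rw [Category.assoc, Category.assoc, hu, ι_fromSrc, reassoc_of% hw, Iso.inv_hom_id_assoc, hy.2]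

variable (V C) in
/-- The composition map: the map from the object of composable pairs, that is from
`∐_{A, B, D} C(A, B) ⊗ C(B, D)`, which is induced by the composition maps of `C`. -/
def compMap : pullback (tgt V C) (src V C) ⟶ Mor V C :=
  (exists_glue fun A B D : C => eComp V A B D ≫ incl A D).choose

theorem compMap_spec {T : V} (y : T ⟶ pullback (tgt V C) (src V C)) {A B D : C}
    {f : T ⟶ (A ⟶[V] B)} {g : T ⟶ (B ⟶[V] D)} (h : IsPair y f g) :
    y ≫ compMap V C = lift f g ≫ eComp V A B D ≫ incl A D :=
  (exists_glue fun A B D : C => eComp V A B D ≫ incl A D).choose_spec T y A B D f g h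

/-- Composition of generalized elements. -/
def m {X : V} (f g : X ⟶ Mor V C) (h : f ≫ tgt V C = g ≫ src V C) : X ⟶ Mor V C :=
  pullback.lift f g h ≫ compMap V C

theorem m_spec {X : V} {f g : X ⟶ Mor V C} (h : f ≫ tgt V C = g ≫ src V C) {A B D : C}
    {f' : X ⟶ (A ⟶[V] B)} {g' : X ⟶ (B ⟶[V] D)} (hf : f = f' ≫ incl A B) (hg : g = g' ≫ incl B D) :
    m f g h = lift f' g' ≫ eComp V A B D ≫ incl A D :=
  compMap_spec _ ⟨(pullback.lift_fst _ _ _).trans hf, (pullback.lift_snd _ _ _).trans hg⟩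

theorem m_nat {X Y : V} (k : Y ⟶ X) (f g : X ⟶ Mor V C) (h : f ≫ tgt V C = g ≫ src V C) :
    k ≫ m f g h = m (k ≫ f) (k ≫ g) (by simp [h]) := by
  rw [m, m, ← Category.assoc]
  congr 1
  apply pullback.hom_ext <;> simp

/-- Maps out of an object with a composable pair of maps to the object of morphisms may be
compared where the pair factors through hom-objects. -/
theorem ext_pair {X Z : V} (f g : X ⟶ Mor V C) (h : f ≫ tgt V C = g ≫ src V C) {a b : X ⟶ Z}
    (hab : ∀ (A B D : C) (T : V) (y : T ⟶ X) (x : T ⟶ (A ⟶[V] B)) (x' : T ⟶ (B ⟶[V] D)),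
      y ≫ f = x ≫ incl A B → y ≫ g = x' ≫ incl B D → y ≫ a = y ≫ b) : a = b := by
  apply ext_incl f
  intro A B T y x hx
  apply ext_incl_of_src (y ≫ g) B
  · rw [Category.assoc, ← h, reassoc_of% hx, incl_tgt, comp_toUnit_assoc]
  · intro D T' y' x' hx'
    rw [← Category.assoc, ← Category.assoc]
    apply hab A B D T' (y' ≫ y) (y' ≫ x) x'
    · rw [Category.assoc, hx, Category.assoc]
    · rw [Category.assoc, hx']

theorem m_src {X : V} (f g : X ⟶ Mor V C) (h : f ≫ tgt V C = g ≫ src V C) :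
    m f g h ≫ src V C = f ≫ src V C := by
  apply ext_pair f g h
  intro A B D T y x x' hx hx'
  rw [← Category.assoc, m_nat, m_spec _ hx hx', reassoc_of% hx]
  simp

theorem m_tgt {X : V} (f g : X ⟶ Mor V C) (h : f ≫ tgt V C = g ≫ src V C) :
    m f g h ≫ tgt V C = g ≫ tgt V C := by
  apply ext_pair f g h
  intro A B D T y x x' hx hx'
  rw [← Category.assoc, m_nat, m_spec _ hx hx', reassoc_of% hx']
  simp

variable (V C) in
/-- The data of the internalization. -/
def data : CompData V where
  obj := Ob V C
  mor := Mor V C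
  s := src V C
  t := tgt V C
  i := ident V C
  i_s := by
    apply Limits.Sigma.hom_ext
    intro A
    rw [← Category.assoc, el_ident, Category.assoc, incl_src]
    simp
  i_t := by
    apply Limits.Sigma.hom_ext
    intro A
    rw [← Category.assoc, el_ident, Category.assoc, incl_tgt]
    simp
  m := m
  m_s := m_src
  m_t := m_tgt
  m_nat := m_nat
  id_m := by
    apply ext_incl (𝟙 _)
    intro A B T y x h
    rw [m_nat, m_spec (f' := toUnit T ≫ eId V A) _ _ h, ← Category.assoc, lift_eId_eComp, h]
    rw [Category.comp_id] at h
    rw [h, Category.assoc, ← Category.assoc (incl A B), incl_src, Category.assoc, el_ident]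
    simp
  m_id := by
    apply ext_incl (𝟙 _)
    intro A B T y x h
    rw [m_nat, m_spec (g' := toUnit T ≫ eId V B) _ h, ← Category.assoc, lift_eComp_eId, h]
    rw [Category.comp_id] at h
    rw [h, Category.assoc, ← Category.assoc (incl A B), incl_tgt, Category.assoc, el_ident]
    simp
  m_assoc f g h hfg hgh := by
    apply ext_pair f g hfg
    intro A B D T y x x' hx hx'
    apply ext_incl_of_src (y ≫ h) D
    · rw [Category.assoc, ← hgh, reassoc_of% hx', incl_tgt, comp_toUnit_assoc]
    · intro E T' y' x'' hx''
      have e1 : (y' ≫ y) ≫ f = (y' ≫ x) ≫ incl A B := by rw [Category.assoc, hx, Category.assoc]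
      have e2 : (y' ≫ y) ≫ g = (y' ≫ x') ≫ incl B D := by rw [Category.assoc, hx', Category.assoc]
      have e3 : (y' ≫ y) ≫ h = x'' ≫ incl D E := by rw [Category.assoc, hx'']
      have h1 : (y' ≫ y) ≫ m (m f g hfg) h (by rw [m_tgt, hgh]) =
          lift (lift (y' ≫ x) (y' ≫ x') ≫ eComp V A B D) x'' ≫ eComp V A D E ≫ incl A E :=
        (m_nat _ _ _ _).trans (m_spec _
          ((m_nat _ _ _ _).trans ((m_spec _ e1 e2).trans (Category.assoc _ _ _).symm)) e3)
      have h2 : (y' ≫ y) ≫ m f (m g h hgh) (by rw [m_src, hfg]) =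
          lift (y' ≫ x) (lift (y' ≫ x') x'' ≫ eComp V B D E) ≫ eComp V A B E ≫ incl A E :=
        (m_nat _ _ _ _).trans (m_spec _ e1
          ((m_nat _ _ _ _).trans ((m_spec _ e2 e3).trans (Category.assoc _ _ _).symm)))
      rw [← Category.assoc, ← Category.assoc, h1, h2, ← Category.assoc, ← Category.assoc,
        lift_eComp_assoc]

end internalize

variable (V) in
/-- The internalization of a `V`-category. -/
def internalize (C : Type v) [EnrichedCategory V C] : InternalCat V :=
  (internalize.data V C).toInternalCat

theorem internalize.comp_eq {C : Type v} [EnrichedCategory V C] {X : V} (f g : X ⟶ internalize.Mor V C)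
    (h : f ≫ internalize.tgt V C = g ≫ internalize.src V C) : (internalize V C).comp f g h = internalize.m f g h :=
  CompData.toInternalCat_comp (internalize.data V C) f g h

end Internalization

section InternalizationMap

set_option linter.unusedSectionVars false

variable {V : Type u} [Category.{v} V] [CartesianMonoidalCategory V] [HasPullbacks V] [Extensive V]

namespace internalize

variable {C D : Type v} [EnrichedCategory V C] [EnrichedCategory V D] (F : EnrichedFunctor V C D)

/-- The map on objects of objects of the internalization of a `V`-functor. -/
def mapOb : Ob V C ⟶ Ob V D :=
  Limits.Sigma.desc fun A => el (F.obj A)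

/-- The map on objects of morphisms of the internalization of a `V`-functor. -/
def mapMor : Mor V C ⟶ Mor V D :=
  Limits.Sigma.desc fun p => F.map p.1 p.2 ≫ incl (F.obj p.1) (F.obj p.2)

theorem el_mapOb (A : C) : el A ≫ mapOb F = el (F.obj A) :=
  Limits.Sigma.ι_desc _ _

theorem incl_mapMor (A B : C) :
    incl A B ≫ mapMor F = F.map A B ≫ incl (F.obj A) (F.obj B) :=
  Limits.Sigma.ι_desc _ _

theorem mapMor_src : mapMor F ≫ src V D = src V C ≫ mapOb F := by
  apply Limits.Sigma.hom_ext
  intro p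
  rw [← Category.assoc, ← Category.assoc]
  refine (incl_mapMor F p.1 p.2 =≫ _).trans (Eq.trans ?_ (incl_src p.1 p.2 =≫ _).symm)
  rw [Category.assoc, incl_src, Category.assoc, el_mapOb, comp_toUnit_assoc]

theorem mapMor_tgt : mapMor F ≫ tgt V D = tgt V C ≫ mapOb F := by
  apply Limits.Sigma.hom_ext
  intro p
  rw [← Category.assoc, ← Category.assoc]
  refine (incl_mapMor F p.1 p.2 =≫ _).trans (Eq.trans ?_ (incl_tgt p.1 p.2 =≫ _).symm)
  rw [Category.assoc, incl_tgt, Category.assoc, el_mapOb, comp_toUnit_assoc]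

theorem ident_mapMor : ident V C ≫ mapMor F = mapOb F ≫ ident V D := by
  apply Limits.Sigma.hom_ext
  intro A
  rw [← Category.assoc, ← Category.assoc, el_ident, el_mapOb, el_ident, Category.assoc,
    incl_mapMor, ← Category.assoc, F.map_id]

theorem m_mapMor {X : V} (f g : X ⟶ Mor V C) (h : f ≫ tgt V C = g ≫ src V C)
    (h' : (f ≫ mapMor F) ≫ tgt V D = (g ≫ mapMor F) ≫ src V D) :
    m f g h ≫ mapMor F = m (f ≫ mapMor F) (g ≫ mapMor F) h' := by
  apply ext_pair f g h
  intro A B E T y x x' hx hx'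
  rw [← Category.assoc, m_nat, m_spec _ hx hx', m_nat,
    m_spec (f' := x ≫ F.map A B) (g' := x' ≫ F.map B E), Category.assoc, Category.assoc,
    incl_mapMor, ← Category.assoc (eComp V A B E), F.map_comp, Category.assoc, lift_map_assoc]
  · rw [← Category.assoc, hx, Category.assoc, incl_mapMor, Category.assoc]
  · rw [← Category.assoc, hx', Category.assoc, incl_mapMor, Category.assoc]

end internalize

/-- The internalization of a `V`-functor. -/
def internalizeMap {C D : Type v} [EnrichedCategory V C] [EnrichedCategory V D]
    (F : EnrichedFunctor V C D) : InternalFunctor (internalize V C) (internalize V D) :=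
  InternalFunctor.mk' (A := internalize V C) (B := internalize V D)
    (internalize.mapOb F) (internalize.mapMor F) (internalize.mapMor_src F)
    (internalize.mapMor_tgt F) (internalize.ident_mapMor F)
    (fun f g h => (internalize.comp_eq f g h =≫ internalize.mapMor F).trans
      ((internalize.m_mapMor F f g h _).trans (internalize.comp_eq _ _ _).symm))

end InternalizationMap

/-! ### The free-living morphism -/

/-- The objects of the free-living morphism. -/
inductive Two : Type v
  | zero
  | one

section FreeLivingMorphism

set_option linter.unusedSectionVars false

variable {V : Type u} [Category.{v} V] [CartesianMonoidalCategory V] [MonoidalClosed V]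
  [Extensive V]

instance : HasInitial V :=
  (hasCoproducts_shrink.{0, v} : HasCoproducts.{0} V) PEmpty

namespace Two

variable (V) in
/-- The hom-objects of the free-living morphism. -/
def hom : Two.{v} → Two.{v} → V
  | one, zero => ⊥_ V
  | _, _ => 𝟙_ V

theorem ext_of_initial {X Z : V} (g : X ⟶ ⊥_ V) (a b : X ⟶ Z) : a = b := by
  have := strict_initial (initialIsInitial (C := V)) g
  exact (IsInitial.ofIso (initialIsInitial (C := V)) (asIso g).symm).hom_ext _ _

theorem hom_ext : ∀ (a b : Two.{v}) {X : V} (f g : X ⟶ hom V a b), f = g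
  | zero, zero, _, _, _ => toUnit_unique _ _
  | zero, one, _, _, _ => toUnit_unique _ _
  | one, one, _, _, _ => toUnit_unique _ _
  | one, zero, _, f, _ => ext_of_initial f _ _

/-- The free-living morphism: the `V`-category with two objects `zero` and `one` such that
the hom-object from `one` to `zero` is initial and the other hom-objects are terminal. -/
instance : EnrichedCategory V Two.{v} where
  Hom := hom V
  id
    | zero => 𝟙 _
    | one => 𝟙 _
  comp
    | zero, _, zero => toUnit _
    | zero, _, one => toUnit _
    | one, _, one => toUnit _
    | one, zero, zero => fst _ _
    | one, one, zero => snd _ _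
  id_comp _ _ := hom_ext _ _ _ _
  comp_id _ _ := hom_ext _ _ _ _
  assoc _ _ _ _ := hom_ext _ _ _ _

variable {C : Type*} [EnrichedCategory V C] {c d : C} (f : 𝟙_ V ⟶ (c ⟶[V] d))

variable (c d) in
/-- The objects of `C` classified by a `V`-functor out of the free-living morphism. -/
def functorObj : Two.{v} → C
  | zero => c
  | one => d

/-- The map on hom-objects of the `V`-functor that classifies an element of a hom-object. -/
def functorMap : ∀ a b : Two.{v}, (a ⟶[V] b) ⟶ (functorObj c d a ⟶[V] functorObj c d b)
  | zero, zero => eId V c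
  | zero, one => f
  | one, one => eId V d
  | one, zero => initial.to _

theorem id_left {a b : C} (g : 𝟙_ V ⟶ (a ⟶[V] b)) (k : 𝟙_ V ⊗ 𝟙_ V ⟶ 𝟙_ V) :
    k ≫ g = (eId V a ⊗ₘ g) ≫ eComp V a a b := by
  have h : (eId V a ⊗ₘ g) = (k ≫ g) ≫ (λ_ _).inv ≫ eId V a ▷ _ := by
    ext
    · simp only [tensorHom_fst, Category.assoc, whiskerRight_fst,
        leftUnitor_inv_fst_assoc, comp_toUnit_assoc]
      congr 1
      exact toUnit_unique _ _
    · rw [toUnit_unique k (snd _ _)]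
      simp
  rw [h, Category.assoc, Category.assoc, Category.assoc, e_id_comp, Category.comp_id]

theorem id_right {a b : C} (g : 𝟙_ V ⟶ (a ⟶[V] b)) (k : 𝟙_ V ⊗ 𝟙_ V ⟶ 𝟙_ V) :
    k ≫ g = (g ⊗ₘ eId V b) ≫ eComp V a b b := by
  have h : (g ⊗ₘ eId V b) = (k ≫ g) ≫ (ρ_ _).inv ≫ _ ◁ eId V b := by
    ext
    · rw [toUnit_unique k (fst _ _)]
      simp
    · simp only [tensorHom_snd, Category.assoc, whiskerLeft_snd,
        rightUnitor_inv_snd_assoc, comp_toUnit_assoc]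
      congr 1
      exact toUnit_unique _ _
  rw [h, Category.assoc, Category.assoc, Category.assoc, e_comp_id, Category.comp_id]

/-- The `V`-functor out of the free-living morphism that classifies an element of a
hom-object. -/
def functor : EnrichedFunctor V Two.{v} C where
  obj := functorObj c d
  map := functorMap f
  map_id
    | zero => Category.id_comp _
    | one => Category.id_comp _
  map_comp
    | zero, zero, zero => id_left (eId V c) _
    | zero, zero, one => id_left f _
    | zero, one, one => id_right f _
    | one, one, one => id_left (eId V d) _
    | zero, one, zero => ext_of_initial (snd (𝟙_ V) (⊥_ V)) _ _
    | one, zero, zero => ext_of_initial (fst (⊥_ V) (𝟙_ V)) _ _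
    | one, zero, one => ext_of_initial (fst (⊥_ V) (𝟙_ V)) _ _
    | one, one, zero => ext_of_initial (snd (𝟙_ V) (⊥_ V)) _ _

end Two

end FreeLivingMorphism

section CommaCategory

open internalize

variable {V : Type u} [Category.{v} V] [CartesianMonoidalCategory V] [MonoidalClosed V]
  [HasPullbacks V] [Extensive V]

variable (V) in
/-- The free-living morphism as an internal category. -/
def walkingArrow : InternalCat V :=
  internalize V Two.{v}

variable (V) in
/-- The domain of the free-living morphism. -/
def walkingArrow.zero : 𝟙_ V ⟶ (walkingArrow V).obj :=
  el Two.zero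

variable (V) in
/-- The codomain of the free-living morphism. -/
def walkingArrow.one : 𝟙_ V ⟶ (walkingArrow V).obj :=
  el Two.one

/-- The internal functor `⟨0, 1⟩^* : ⟦𝟚, B⟧ ⟶ B × B`. -/
def evalEnds (B : InternalCat V) : InternalFunctor (internalHom (walkingArrow V) B) (prodCat B B) :=
  prodLift (evalAt (walkingArrow.zero V) B) (evalAt (walkingArrow.one V) B)

/-- The comma internal category `H ↓ b` of an internal functor `H : A ⟶ B` and an object `b` of
`B`: the pullback of `H × b : A ⟶ B × B` along `⟨0, 1⟩^* : ⟦𝟚, B⟧ ⟶ B × B`. -/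
def comma {A B : InternalCat V} (H : InternalFunctor A B) (b : 𝟙_ V ⟶ B.obj) : InternalCat V :=
  fiberProduct (prodLift H (constAt A b)) (evalEnds B)

/-- The projection `H ↓ b ⟶ A`. -/
def comma.proj {A B : InternalCat V} (H : InternalFunctor A B) (b : 𝟙_ V ⟶ B.obj) :
    comma H b ⟶ A :=
  fiberProduct.fst (prodLift H (constAt A b)) (evalEnds B)

/-- An object of the comma internal category, given by an object `a` of `A` and an internal
functor `𝟚 ⟶ B`, that is a morphism of `B`, from `H a` to `b`. -/
def comma.mk {A B : InternalCat V} (H : InternalFunctor A B) (b : 𝟙_ V ⟶ B.obj)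
    (a : 𝟙_ V ⟶ A.obj) (k : InternalFunctor (walkingArrow V) B)
    (h₀ : walkingArrow.zero V ≫ k.onObj = a ≫ H.onObj) (h₁ : walkingArrow.one V ≫ k.onObj = b) :
    𝟙_ V ⟶ (comma H b).obj :=
  pullback.lift (f := (prodLift H (constAt A b)).onObj) (g := (evalEnds B).onObj) a (nameOf k) (by
    have e : a ≫ lift H.onObj (toUnit _ ≫ b) = nameOf k ≫
        lift (evalAt (walkingArrow.zero V) B).onObj (evalAt (walkingArrow.one V) B).onObj := by
      rw [comp_lift, comp_lift, nameOf_evalAt, nameOf_evalAt, h₀, h₁, ← Category.assoc,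
        toUnit_unique (a ≫ toUnit _) (𝟙 _), Category.id_comp]
    exact e)

/-- The slice internal category `A / T`. -/
def slice (A : InternalCat V) (T : 𝟙_ V ⟶ A.obj) : InternalCat V :=
  comma (InternalFunctor.id A) T

/-- The projection `A / T ⟶ A`. -/
def slice.proj (A : InternalCat V) (T : 𝟙_ V ⟶ A.obj) : slice A T ⟶ A :=
  comma.proj (InternalFunctor.id A) T

/-- An object `T` of an internal category `A` is an internal terminal object if the projection
`A / T ⟶ A` is an isomorphism in `Cat(V)`. -/
def IsInternalTerminal (A : InternalCat V) (T : 𝟙_ V ⟶ A.obj) : Prop :=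
  IsIso (slice.proj A T)

/-- The object of `⟦cst X, A⟧` that is constant at an object `T` of `A`: the element that
corresponds to the internal functor `cst X ⟶ ∗ ⟶ A`. -/
def constElem (A : InternalCat V) (T : 𝟙_ V ⟶ A.obj) (X : V) :
    𝟙_ V ⟶ (internalHom (cst X) A).obj :=
  nameOf (constAt (cst X) T)

end CommaCategory

/-! ### Enriched functor categories -/

section FunctorCategories

open MonoidalClosed internalize

set_option linter.unusedSectionVars false

variable {V : Type u} [Category.{v} V] [CartesianMonoidalCategory V] [MonoidalClosed V]
variable {I C : Type v} [EnrichedCategory V I] [EnrichedCategory V C]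

theorem curry_left {X P Y Y' W : V} (f : X ⟶ Y) (g : P ⟶ Y') (c : Y ⊗ Y' ⟶ W) :
    f ≫ curry (lift (snd _ _) (fst _ _ ≫ g) ≫ c) = curry (lift (snd _ _ ≫ f) (fst _ _ ≫ g) ≫ c) := by
  rw [← curry_natural_left, comp_lift_assoc, whiskerLeft_snd, whiskerLeft_fst_assoc]

theorem curry_right {X P Y Y' W : V} (f : X ⟶ Y) (g : P ⟶ Y') (c : Y' ⊗ Y ⟶ W) :
    f ≫ curry (lift (fst _ _ ≫ g) (snd _ _) ≫ c) = curry (lift (fst _ _ ≫ g) (snd _ _ ≫ f) ≫ c) := by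
  rw [← curry_natural_left, comp_lift_assoc, whiskerLeft_snd, whiskerLeft_fst_assoc]

/-- A `V`-natural transformation. -/
@[ext]
structure VNatTrans (F G : EnrichedFunctor V I C) where
  /-- the components -/
  app : ∀ A : I, 𝟙_ V ⟶ (F.obj A ⟶[V] G.obj A)
  natural : ∀ A B : I,
    lift (toUnit _ ≫ app A) (G.map A B) ≫ eComp V (F.obj A) (G.obj A) (G.obj B) =
      lift (F.map A B) (toUnit _ ≫ app B) ≫ eComp V (F.obj A) (F.obj B) (G.obj B)

/-- The diagram whose limit is the object of `V`-natural transformations: the parallel pair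
`∏_A C(F A, G A) ⇉ ∏_{A, B} [I(A, B), C(F A, G B)]`. -/
def natIndex (F G : EnrichedFunctor V I C) : MulticospanIndex (MulticospanShape.prod I) V where
  left A := (F.obj A ⟶[V] G.obj A)
  right p := (ihom (p.1 ⟶[V] p.2)).obj (F.obj p.1 ⟶[V] G.obj p.2)
  fst p := curry (lift (snd _ _) (fst _ _ ≫ G.map p.1 p.2) ≫
    eComp V (F.obj p.1) (G.obj p.1) (G.obj p.2))
  snd p := curry (lift (fst _ _ ≫ F.map p.1 p.2) (snd _ _) ≫
    eComp V (F.obj p.1) (F.obj p.2) (G.obj p.2))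

variable (V I C) in
/-- The objects of `V`-natural transformations between `V`-functors `I ⟶ C` exist in `V`, so that
the `V`-category `C^I` of `V`-functors is defined. -/
class HasFunctorHoms : Prop where
  hasMultiequalizer : ∀ F G : EnrichedFunctor V I C, HasMultiequalizer (natIndex F G)

attribute [instance] HasFunctorHoms.hasMultiequalizer

variable [HasFunctorHoms V I C]

/-- The object `C^I(F, G)` of `V`-natural transformations. -/
def natObj (F G : EnrichedFunctor V I C) : V :=
  multiequalizer (natIndex F G)

namespace natObj

/-- The component of the object of `V`-natural transformations at an object. -/
def π (F G : EnrichedFunctor V I C) (A : I) : natObj F G ⟶ (F.obj A ⟶[V] G.obj A) :=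
  Multiequalizer.ι (natIndex F G) A

theorem hom_ext {F G : EnrichedFunctor V I C} {X : V} {f g : X ⟶ natObj F G}
    (h : ∀ A, f ≫ π F G A = g ≫ π F G A) : f = g :=
  Multiequalizer.hom_ext _ _ _ h

theorem curry_eq {F G : EnrichedFunctor V I C} (p : I × I) {X : V}
    (f : X ⟶ (F.obj p.1 ⟶[V] G.obj p.1)) (g : X ⟶ (F.obj p.2 ⟶[V] G.obj p.2)) :
    f ≫ (natIndex F G).fst p = g ≫ (natIndex F G).snd p ↔
      lift (snd _ _ ≫ f) (fst _ _ ≫ G.map p.1 p.2) ≫ eComp V _ _ _ =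
        lift (fst (p.1 ⟶[V] p.2) X ≫ F.map p.1 p.2) (snd _ _ ≫ g) ≫ eComp V _ _ _ := by
  have h1 := curry_left f (G.map p.1 p.2) (eComp V (F.obj p.1) (G.obj p.1) (G.obj p.2))
  have h2 := curry_right g (F.map p.1 p.2) (eComp V (F.obj p.1) (F.obj p.2) (G.obj p.2))
  constructor
  · intro h
    exact curry_injective (h1.symm.trans (h.trans h2))
  · intro h
    exact h1.trans ((congrArg curry h).trans h2.symm)

/-- Naturality, on generalized elements. -/
theorem condition {F G : EnrichedFunctor V I C} {X : V} (f : X ⟶ natObj F G) (A B : I)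
    (k : X ⟶ (A ⟶[V] B)) :
    lift (f ≫ π F G A) (k ≫ G.map A B) ≫ eComp V _ _ _ =
      lift (k ≫ F.map A B) (f ≫ π F G B) ≫ eComp V _ _ _ := by
  have h := lift k f ≫= (curry_eq (F := F) (G := G) (A, B) (π F G A) (π F G B)).1
    (Multiequalizer.condition (natIndex F G) (A, B))
  rw [comp_lift_assoc, comp_lift_assoc, lift_snd_assoc, lift_snd_assoc, lift_fst_assoc,
    lift_fst_assoc] at h
  exact h

/-- Maps to the object of `V`-natural transformations. -/
def mk {F G : EnrichedFunctor V I C} {X : V} (f : ∀ A : I, X ⟶ (F.obj A ⟶[V] G.obj A))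
    (h : ∀ A B : I, lift (snd (A ⟶[V] B) X ≫ f A) (fst _ _ ≫ G.map A B) ≫ eComp V _ _ _ =
      lift (fst _ _ ≫ F.map A B) (snd _ _ ≫ f B) ≫ eComp V _ _ _) : X ⟶ natObj F G :=
  Multiequalizer.lift (natIndex F G) X f fun p => (curry_eq p (f p.1) (f p.2)).2 (h p.1 p.2)

@[simp]
theorem mk_π {F G : EnrichedFunctor V I C} {X : V} (f : ∀ A : I, X ⟶ (F.obj A ⟶[V] G.obj A))
    (h : ∀ A B : I, lift (snd (A ⟶[V] B) X ≫ f A) (fst _ _ ≫ G.map A B) ≫ eComp V _ _ _ =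
      lift (fst _ _ ≫ F.map A B) (snd _ _ ≫ f B) ≫ eComp V _ _ _) (A : I) :
    mk f h ≫ π F G A = f A :=
  Multiequalizer.lift_ι _ _ _ _ _

/-- The identity `V`-natural transformation, as an element. -/
def ident (F : EnrichedFunctor V I C) : 𝟙_ V ⟶ natObj F F :=
  mk (fun A => eId V (F.obj A)) fun A B => by
    rw [toUnit_unique (snd (A ⟶[V] B) (𝟙_ V)) (toUnit _), lift_eId_eComp, lift_eComp_eId]

theorem ident_π (F : EnrichedFunctor V I C) (A : I) : ident F ≫ π F F A = eId V (F.obj A) :=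
  mk_π _ _ _

/-- Composition of `V`-natural transformations. -/
def compos (F G H : EnrichedFunctor V I C) : natObj F G ⊗ natObj G H ⟶ natObj F H :=
  mk (fun A => lift (fst _ _ ≫ π F G A) (snd _ _ ≫ π G H A) ≫ eComp V _ _ _) fun A B => by
    have e1 := condition (snd (A ⟶[V] B) (natObj F G ⊗ natObj G H) ≫ fst _ _) A B (fst _ _)
    have e2 := condition (snd (A ⟶[V] B) (natObj F G ⊗ natObj G H) ≫ snd _ _) A B (fst _ _)
    rw [comp_lift_assoc, comp_lift_assoc, lift_eComp_assoc]
    simp only [Category.assoc] at e1 e2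
    rw [e2, ← lift_eComp_assoc, e1, lift_eComp_assoc]

theorem lift_compos {F G H : EnrichedFunctor V I C} {X : V} (f : X ⟶ natObj F G)
    (g : X ⟶ natObj G H) (A : I) : (lift f g ≫ compos F G H) ≫ π F H A =
      lift (f ≫ π F G A) (g ≫ π G H A) ≫ eComp V _ _ _ := by
  rw [Category.assoc, compos, mk_π, comp_lift_assoc, lift_fst_assoc, lift_snd_assoc]

end natObj

/-- The `V`-category `C^I` of `V`-functors `I ⟶ C`. -/
instance functorVCategory : EnrichedCategory V (EnrichedFunctor V I C) where
  Hom := natObj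
  id := natObj.ident
  comp := natObj.compos
  id_comp F G := by
    apply natObj.hom_ext
    intro A
    have h : (λ_ (natObj F G)).inv ≫ natObj.ident F ▷ natObj F G =
        lift (toUnit _ ≫ natObj.ident F) (𝟙 _) := by ext <;> simp
    rw [reassoc_of% h, natObj.lift_compos, Category.assoc, natObj.ident, natObj.mk_π,
      lift_eId_eComp]
  comp_id F G := by
    apply natObj.hom_ext
    intro A
    have h : (ρ_ (natObj F G)).inv ≫ natObj F G ◁ natObj.ident G =
        lift (𝟙 _) (toUnit _ ≫ natObj.ident G) := by ext <;> simp
    rw [reassoc_of% h, natObj.lift_compos, Category.assoc, natObj.ident, natObj.mk_π,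
      lift_eComp_eId]
  assoc F G H K := by
    apply natObj.hom_ext
    intro A
    have h1 : (α_ (natObj F G) (natObj G H) (natObj H K)).inv ≫
        natObj.compos F G H ▷ natObj H K =
        lift (lift (fst _ _) (snd _ _ ≫ fst _ _) ≫ natObj.compos F G H) (snd _ _ ≫ snd _ _) := by
      ext
      · simp only [Category.assoc, whiskerRight_fst, lift_fst]
        rw [← Category.assoc]
        congr 1
        ext <;> simp
      · simp
    have h2 : natObj F G ◁ natObj.compos G H K =
        lift (fst _ _)
          (lift (snd _ _ ≫ fst _ _) (snd _ _ ≫ snd _ _) ≫ natObj.compos G H K) := by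
      ext
      · simp
      · rw [whiskerLeft_snd, lift_snd]
        congr 1
        ext <;> simp
    rw [reassoc_of% h1, h2, natObj.lift_compos, natObj.lift_compos, natObj.lift_compos,
      natObj.lift_compos, lift_eComp_assoc]

variable (V I) in
/-- The constant `V`-functor at an object. -/
@[simps]
def constFunctor (L : C) : EnrichedFunctor V I C where
  obj _ := L
  map _ _ := toUnit _ ≫ eId V L
  map_id A := by
    rw [← Category.assoc, toUnit_unique (eId V A ≫ toUnit _) (𝟙 _), Category.id_comp]
  map_comp A B D := by
    have h : (toUnit (A ⟶[V] B) ≫ eId V L) ⊗ₘ (toUnit (B ⟶[V] D) ≫ eId V L) =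
        lift (toUnit _ ≫ eId V L) (toUnit _ ≫ eId V L) := by ext <;> simp
    rw [h, lift_eId_eComp, comp_toUnit_assoc]

variable (V I) in
/-- The map on hom-objects of the diagonal `V`-functor, all of whose components are `𝟙`. -/
def diagonalMap (A B : C) : (A ⟶[V] B) ⟶ natObj (constFunctor V I A) (constFunctor V I B) :=
  natObj.mk (F := constFunctor V I A) (G := constFunctor V I B) (fun _ => 𝟙 (A ⟶[V] B))
    fun i j => by
      have h : lift (snd (i ⟶[V] j) (A ⟶[V] B) ≫ 𝟙 _) (fst _ _ ≫ toUnit _ ≫ eId V B) ≫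
          eComp V A B B = lift (fst (i ⟶[V] j) (A ⟶[V] B) ≫ toUnit _ ≫ eId V A)
            (snd _ _ ≫ 𝟙 _) ≫ eComp V A A B := by
        rw [comp_toUnit_assoc, comp_toUnit_assoc, lift_eId_eComp, lift_eComp_eId]
      exact h

theorem diagonalMap_π (A B : C) (i : I) : diagonalMap V I A B ≫
    natObj.π (constFunctor V I A) (constFunctor V I B) i = 𝟙 (A ⟶[V] B) :=
  natObj.mk_π _ _ _

variable (V I C) in
/-- The diagonal `V`-functor `Δ : C ⟶ C^I`. -/
def diagonal : EnrichedFunctor V C (EnrichedFunctor V I C) where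
  obj := constFunctor V I
  map := diagonalMap V I
  map_id A := by
    have h : eId V A ≫ diagonalMap V I A A = natObj.ident (constFunctor V I A) := by
      apply natObj.hom_ext
      intro i
      exact (Category.assoc _ _ _).trans (((eId V A ≫= diagonalMap_π A A i).trans
        (Category.comp_id _)).trans (natObj.ident_π (constFunctor V I A) i).symm)
    exact h
  map_comp A B D := by
    have h : eComp V A B D ≫ diagonalMap V I A D =
        (diagonalMap V I A B ⊗ₘ diagonalMap V I B D) ≫ natObj.compos _ _ _ := by
      apply natObj.hom_ext
      intro i
      have e : (diagonalMap V I A B ⊗ₘ diagonalMap V I B D) =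
          lift (fst _ _ ≫ diagonalMap V I A B) (snd _ _ ≫ diagonalMap V I B D) := by ext <;> simp
      have e1 : lift (fst _ _ ≫ 𝟙 _) (snd _ _ ≫ 𝟙 _) ≫ eComp V A B D = eComp V A B D := by
        rw [Category.comp_id, Category.comp_id, lift_fst_snd, Category.id_comp]
      rw [e, natObj.lift_compos, Category.assoc, Category.assoc, Category.assoc]
      refine ((_ ≫= diagonalMap_π A D i).trans (Category.comp_id _)).trans (e1.symm.trans ?_)
      refine congrArg (fun q => q ≫ eComp V A B D) ?_
      exact congrArg₂ (fun p q => lift (fst (A ⟶[V] B) (B ⟶[V] D) ≫ p)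
        (snd (A ⟶[V] B) (B ⟶[V] D) ≫ q)) (diagonalMap_π A B i).symm (diagonalMap_π B D i).symm
    exact h

/-- A `V`-natural transformation as an element of the object of `V`-natural transformations. -/
def VNatTrans.elt {F G : EnrichedFunctor V I C} (α : VNatTrans F G) : 𝟙_ V ⟶ (F ⟶[V] G) :=
  natObj.mk α.app fun A B => by
    have h := fst (A ⟶[V] B) (𝟙_ V) ≫= α.natural A B
    rw [comp_lift_assoc, comp_lift_assoc, comp_toUnit_assoc, comp_toUnit_assoc] at h
    rw [toUnit_unique (snd (A ⟶[V] B) (𝟙_ V)) (toUnit _)]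
    exact h

end FunctorCategories

/-! ### Representability and conical limits -/

section Representability

variable {V : Type u} [Category.{v} V] [CartesianMonoidalCategory V]

variable (V) in
/-- A `V`-functor `Cᵒᵖ ⟶ V`. Its action on hom-objects `C(A, B) ⟶ [F B, F A]` is given by the
transposed map `C(A, B) ⊗ F B ⟶ F A`. -/
structure VPresheaf (C : Type v) [EnrichedCategory V C] where
  /-- the map on objects -/
  obj : C → V
  /-- the transposed map on hom-objects -/
  ev : ∀ A B : C, (A ⟶[V] B) ⊗ obj B ⟶ obj A
  ev_id : ∀ A : C, lift (toUnit _ ≫ eId V A) (𝟙 (obj A)) ≫ ev A A = 𝟙 _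
  ev_comp : ∀ A B D : C,
    eComp V A B D ▷ obj D ≫ ev A D = (α_ _ _ _).hom ≫ (A ⟶[V] B) ◁ ev B D ≫ ev A B

namespace VPresheaf

variable {C : Type v} [EnrichedCategory V C]

/-- A `V`-natural transformation of `V`-functors `Cᵒᵖ ⟶ V`. Its components `𝟙_ V ⟶ [F A, G A]`
are given by the transposed maps `F A ⟶ G A`. -/
@[ext]
structure Hom (F G : VPresheaf V C) where
  /-- the transposed components -/
  app : ∀ A : C, F.obj A ⟶ G.obj A
  natural : ∀ A B : C, F.ev A B ≫ app A = (A ⟶[V] B) ◁ app B ≫ G.ev A B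

/-- The category of `V`-functors `Cᵒᵖ ⟶ V` and `V`-natural transformations. -/
instance : Category (VPresheaf V C) where
  Hom := Hom
  id F := ⟨fun _ => 𝟙 _, fun A B => by simp⟩
  comp α β := ⟨fun A => α.app A ≫ β.app A, fun A B => by
    rw [← Category.assoc, α.natural, Category.assoc, β.natural,
      MonoidalCategory.whiskerLeft_comp, Category.assoc]⟩
  id_comp α := Hom.ext (funext fun _ => Category.id_comp _)
  comp_id α := Hom.ext (funext fun _ => Category.comp_id _)
  assoc α β γ := Hom.ext (funext fun _ => Category.assoc _ _ _)

/-- The `V`-functor `D(H(-), d) : Cᵒᵖ ⟶ V`, for a `V`-functor `H : C ⟶ D` and an object `d`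
of `D`. -/
def homInto {D : Type v} [EnrichedCategory V D] (H : EnrichedFunctor V C D) (d : D) :
    VPresheaf V C where
  obj A := (H.obj A ⟶[V] d)
  ev A B := H.map A B ▷ _ ≫ eComp V _ _ _
  ev_id A := by
    have h : lift (toUnit _ ≫ eId V A) (𝟙 (H.obj A ⟶[V] d)) ≫ H.map A A ▷ _ =
        lift (toUnit _ ≫ eId V (H.obj A)) (𝟙 _) := by
      rw [← H.map_id]
      ext <;> simp
    rw [reassoc_of% h, lift_eId_eComp]
  ev_comp A B E := by
    have h1 : (H.map A B ⊗ₘ H.map B E) ▷ (H.obj E ⟶[V] d) ≫ (α_ _ _ _).hom =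
        (α_ _ _ _).hom ≫ (H.map A B ⊗ₘ (H.map B E ▷ (H.obj E ⟶[V] d))) := by
      ext <;> simp
    have h2 : (H.map A B ⊗ₘ (H.map B E ▷ (H.obj E ⟶[V] d))) ≫ _ ◁ eComp V _ _ _ =
        _ ◁ (H.map B E ▷ (H.obj E ⟶[V] d) ≫ eComp V _ _ _) ≫ H.map A B ▷ _ := by
      rw [tensorHom_def', MonoidalCategory.whiskerLeft_comp, Category.assoc, Category.assoc,
        whisker_exchange]
    rw [← comp_whiskerRight_assoc, H.map_comp, comp_whiskerRight_assoc, ← e_assoc',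
      reassoc_of% h1, reassoc_of% h2]

/-- The representable `V`-functor `C(-, L) : Cᵒᵖ ⟶ V`. -/
def yoneda (L : C) : VPresheaf V C where
  obj A := (A ⟶[V] L)
  ev A B := eComp V A B L
  ev_id _ := lift_eId_eComp _
  ev_comp A B D := (e_assoc' V A B D L).symm

/-- The `V`-natural transformation `C(-, L) ⟶ F` that corresponds to an element `x` of `F L`
under the Yoneda lemma. -/
def yonedaMap (F : VPresheaf V C) {L : C} (x : 𝟙_ V ⟶ F.obj L) : yoneda (V := V) L ⟶ F where
  app A := lift (𝟙 (A ⟶[V] L)) (toUnit _ ≫ x) ≫ F.ev A L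
  natural A B := by
    have h1 : lift (𝟙 _) (toUnit _ ≫ x) ≫ eComp V A B L ▷ F.obj L =
        eComp V A B L ≫ lift (𝟙 _) (toUnit _ ≫ x) := by ext <;> simp
    have h2 : lift (𝟙 _) (toUnit _ ≫ x) ≫ (α_ (A ⟶[V] B) (B ⟶[V] L) (F.obj L)).hom =
        _ ◁ lift (𝟙 _) (toUnit _ ≫ x) := by ext <;> simp
    have h := lift (𝟙 ((A ⟶[V] B) ⊗ (B ⟶[V] L))) (toUnit _ ≫ x) ≫= F.ev_comp A B L
    rw [reassoc_of% h1, reassoc_of% h2] at h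
    refine h.trans ?_
    rw [MonoidalCategory.whiskerLeft_comp, Category.assoc]
    rfl

/-- A `V`-functor `F : Cᵒᵖ ⟶ V` is `V`-representable by a pair of an object `L` of `C` and an
element `x` of `F L` if the corresponding `V`-natural transformation `C(-, L) ⟶ F` is an
isomorphism. -/
def IsRepresentableBy (F : VPresheaf V C) (L : C) (x : 𝟙_ V ⟶ F.obj L) : Prop :=
  IsIso (F.yonedaMap x)

end VPresheaf

end Representability

section Cones

open internalize

variable {V : Type u} [Category.{v} V] [CartesianMonoidalCategory V] [MonoidalClosed V]
variable {I C : Type v} [EnrichedCategory V I] [EnrichedCategory V C] [HasFunctorHoms V I C]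
variable (G : EnrichedFunctor V I C)

/-- The pair `(L, lam)` is a conical `V`-limit of `G` if the `V`-functor
`C^I(Δ(-), G) : Cᵒᵖ ⟶ V` is `V`-representable by `(L, lam)`. -/
def IsConicalLimit (L : C) (lam : VNatTrans (constFunctor V I L) G) : Prop :=
  (VPresheaf.homInto (diagonal V I C) G).IsRepresentableBy L lam.elt

variable [HasPullbacks V] [Extensive V]

/-- The internal category of cones `Int Δ ↓ G`. -/
def coneCat : InternalCat V :=
  comma (internalizeMap (diagonal V I C)) (el G)

/-- A cone `(L, lam)` as an object of the internal category of cones. -/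
def coneElem (L : C) (lam : VNatTrans (constFunctor V I L) G) : 𝟙_ V ⟶ (coneCat G).obj :=
  comma.mk (internalizeMap (diagonal V I C)) (el G) (el L)
    (internalizeMap (Two.functor lam.elt))
    ((el_mapOb (Two.functor lam.elt) Two.zero).trans (el_mapOb (diagonal V I C) L).symm)
    (el_mapOb (Two.functor lam.elt) Two.one)

end Cones

end

end EnrInt

open EnrInt

/-!
Everything is tested on generalized elements. An object `T` of an internal category `A` is terminal
in the generalized sense (`IsGenTerminal`) if each `a : X ⟶ A.obj` has exactly one
`f : X ⟶ A.mor` with source `a` and target constant at `T`. Each of the three conditions of the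
theorem is shown to be equivalent to this property of the object `(L, lam)` of `Int Δ ↓ G`.

* The objects of the comma category `H ↓ b` are, on generalized elements, the pairs `(a, f)` of an
  object `a` and a morphism `f` from `H a` to `b`, and its morphisms are the evident commutative
  triangles. This requires that `⟦𝟚, B⟧` classifies morphisms and commutative squares of `B`, see
  `walkingArrow.exists_toMor` and `walkingArrow.exists_square`. Hence the projection `A / T ⟶ A` is
  invertible on objects exactly if `T` is terminal in the generalized sense, and then it is
  invertible on morphisms because all triangles over `T` commute by uniqueness
  (`isInternalTerminal_iff_isGenTerminal`).
* The object of morphisms from `a` to the constant family `T` in `Und ⟦cst X, A⟧` classifies the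
  families of morphisms over `X` from `a` to `T` (`existsUnique_hom_iff`). So its terminality for
  `X` says that generalized objects with domain `X` have unique morphisms to `T`, that is, that
  `(A / T).obj ⟶ A.obj` is bijective on maps out of `X`. A conservative family detects
  whether this map is invertible (`isGenTerminal_iff_isVTerminal`).
* For a `V`-functor `H : C ⟶ D`, by extensivity a generalized object of `Int C` is locally
  constant at an object of `C`, and a morphism of `Int C` between constant objects `A` and `L` is a
  generalized element of `C(A, L)`. Unique local solutions glue
  (`existsUnique_isMediator_iff`), so that terminality of `(L, x)` in `Int H ↓ d` amounts to the
  bijectivity of all maps `V(X, C(A, L)) ⟶ V(X, D(H A, d))`, that is to representability of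
  `D(H(-), d)` by `(L, x)` (`isGenTerminal_internalize_iff`). For `H = Δ` this is the definition of
  a conical limit.
-/

namespace EnrInt

open MonoidalClosed internalHom internalize

/-! ### Isomorphisms and terminal objects on generalized elements -/

section Isomorphisms

variable {V : Type u} [Category.{v} V] [HasPullbacks V] {A B : InternalCat V}

theorem InternalFunctor.isIso_onObj (F : A ⟶ B) [IsIso F] :
    IsIso (InternalFunctor.onObj F) :=
  ⟨InternalFunctor.onObj (inv F), congrArg InternalFunctor.onObj (IsIso.hom_inv_id F),
    congrArg InternalFunctor.onObj (IsIso.inv_hom_id F)⟩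

theorem InternalFunctor.isIso_of_isIso (F : InternalFunctor A B) [IsIso F.onObj]
    [IsIso F.onMor] : IsIso (C := InternalCat V) (X := A) (Y := B) F := by
  let F' : InternalFunctor B A := InternalFunctor.mk' (inv F.onObj) (inv F.onMor)
    (by rw [IsIso.inv_comp_eq, F.map_s_assoc, IsIso.hom_inv_id, Category.comp_id])
    (by rw [IsIso.inv_comp_eq, F.map_t_assoc, IsIso.hom_inv_id, Category.comp_id])
    (by rw [IsIso.comp_inv_eq, Category.assoc, F.map_i, IsIso.inv_hom_id_assoc])
    (fun f g h => by
      rw [IsIso.comp_inv_eq, F.map_comp]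
      apply B.comp_congr <;> simp)
  exact ⟨F', InternalFunctor.ext (IsIso.hom_inv_id F.onObj) (IsIso.hom_inv_id F.onMor),
    InternalFunctor.ext (IsIso.inv_hom_id F.onObj) (IsIso.inv_hom_id F.onMor)⟩

/-- Terminality of the object `T` of `A` on generalized elements: for each generalized object
`a` of `A` there is exactly one generalized morphism from `a` to `T`. -/
def IsGenTerminal {V : Type u} [Category.{v} V] [CartesianMonoidalCategory V] [HasPullbacks V]
    (A : InternalCat V) (T : 𝟙_ V ⟶ A.obj) : Prop :=
  ∀ (X : V) (a : X ⟶ A.obj), ∃! f : X ⟶ A.mor, f ≫ A.s = a ∧ f ≫ A.t = toUnit X ≫ T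

end Isomorphisms

/-! ### Maps out of products with coproducts -/

section Elements

variable {V : Type u} [Category.{v} V] [CartesianMonoidalCategory V] {X : V}

theorem elem_whiskerRight {Y : V} (a : 𝟙_ V ⟶ Y) (X : V) :
    a ▷ X = snd _ _ ≫ insertElem a X := by
  ext
  · rw [insertElem, Category.assoc, lift_fst, comp_toUnit_assoc, whiskerRight_fst,
      toUnit_unique (fst _ _) (toUnit _)]
  · simp [insertElem]

theorem insertElem_whisker {Y Z : V} (a : 𝟙_ V ⟶ Y) (k : Y ⟶ Z) (X : V) :
    insertElem a X ≫ k ▷ X = insertElem (a ≫ k) X := by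
  ext <;> simp [insertElem]

theorem elem_whiskerRight_cancel {Y Z : V} {a : 𝟙_ V ⟶ Y} {p q : Y ⊗ X ⟶ Z} :
    a ▷ X ≫ p = a ▷ X ≫ q ↔ insertElem a X ≫ p = insertElem a X ≫ q := by
  have e : lift (toUnit X) (𝟙 X) ≫ a ▷ X = insertElem a X := by
    ext <;> simp [insertElem]
  constructor
  · intro h
    rw [← e, Category.assoc, h, Category.assoc]
  · intro h
    rw [elem_whiskerRight, Category.assoc, h, Category.assoc]

theorem isIso_toUnit_iff {Y : V} : IsIso (toUnit Y) ↔ ∀ Z : V, ∃! _h : Z ⟶ Y, True := by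
  rw [isIso_iff_yoneda_map_bijective]
  refine forall_congr' fun Z => ?_
  constructor
  · rintro ⟨hinj, hsurj⟩
    obtain ⟨h, -⟩ := hsurj (toUnit Z)
    exact ⟨h, trivial, fun h' _ => hinj (toUnit_unique _ _)⟩
  · rintro ⟨h, -, hh⟩
    exact ⟨fun h₁ h₂ _ => (hh h₁ trivial).trans (hh h₂ trivial).symm,
      fun k => ⟨h, toUnit_unique _ _⟩⟩

end Elements

section Whiskering

variable {V : Type u} [Category.{v} V] [CartesianMonoidalCategory V] [MonoidalClosed V]
variable {J : Type v} {W : J → V} [HasCoproduct W] {X Z : V}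

theorem sigma_whiskerRight_hom_ext {a b : (∐ W) ⊗ X ⟶ Z}
    (h : ∀ j, Limits.Sigma.ι W j ▷ X ≫ a = Limits.Sigma.ι W j ▷ X ≫ b) : a = b := by
  have key : lift (snd X (∐ W)) (fst _ _) ≫ a = lift (snd _ _) (fst _ _) ≫ b := by
    apply curry_injective
    apply Limits.Sigma.hom_ext
    intro j
    have e : X ◁ Limits.Sigma.ι W j ≫ lift (snd X (∐ W)) (fst _ _) =
        lift (snd _ _) (fst _ _) ≫ Limits.Sigma.ι W j ▷ X := by ext <;> simp
    rw [← curry_natural_left, ← curry_natural_left, reassoc_of% e, reassoc_of% e, h j]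
  have e : lift (snd (∐ W) X) (fst _ _) ≫ lift (snd X (∐ W)) (fst _ _) = 𝟙 _ := by
    ext <;> simp
  rw [← Category.id_comp a, ← e, Category.assoc, key, reassoc_of% e]

/-- The map out of `(∐ W) ⊗ X` that is given by maps out of the objects `W j ⊗ X`. -/
noncomputable def sigmaWhiskerDesc (k : ∀ j, W j ⊗ X ⟶ Z) : (∐ W) ⊗ X ⟶ Z :=
  lift (snd _ _) (fst _ _) ≫
    uncurry (Limits.Sigma.desc fun j => curry (lift (snd _ _) (fst _ _) ≫ k j))

theorem ι_sigmaWhiskerDesc (k : ∀ j, W j ⊗ X ⟶ Z) (j : J) :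
    Limits.Sigma.ι W j ▷ X ≫ sigmaWhiskerDesc k = k j := by
  have e : Limits.Sigma.ι W j ▷ X ≫ lift (snd (∐ W) X) (fst _ _) =
      lift (snd _ _) (fst _ _) ≫ X ◁ Limits.Sigma.ι W j := by ext <;> simp
  have e' : lift (snd (W j) X) (fst _ _) ≫ lift (snd X (W j)) (fst _ _) = 𝟙 _ := by
    ext <;> simp
  rw [sigmaWhiskerDesc, reassoc_of% e, ← uncurry_natural_left, Limits.Sigma.ι_desc,
    uncurry_curry, reassoc_of% e']

theorem lift_sigmaWhiskerDesc (k : ∀ j, W j ⊗ X ⟶ Z) {T : V} {w : T ⟶ ∐ W} {j : J}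
    {x : T ⟶ W j} (h : w = x ≫ Limits.Sigma.ι W j) (z : T ⟶ X) :
    lift w z ≫ sigmaWhiskerDesc k = lift x z ≫ k j := by
  have e : lift (x ≫ Limits.Sigma.ι W j) z = lift x z ≫ Limits.Sigma.ι W j ▷ X := by
    ext <;> simp
  rw [h, e, Category.assoc, ι_sigmaWhiskerDesc]

end Whiskering

/-! ### Families of internal functors -/

section Families

variable {V : Type u} [Category.{v} V] [CartesianMonoidalCategory V] [MonoidalClosed V]
  [HasPullbacks V] {A B : InternalCat V} {X : V}

/-- A family of internal functors, with the compatibility with composition checked on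
generalized elements. -/
def FunctorFamily.mk' (onObj : A.obj ⊗ X ⟶ B.obj) (onMor : A.mor ⊗ X ⟶ B.mor)
    (map_s : onMor ≫ B.s = A.s ▷ X ≫ onObj) (map_t : onMor ≫ B.t = A.t ▷ X ≫ onObj)
    (map_i : A.i ▷ X ≫ onMor = onObj ≫ B.i)
    (map_comp : ∀ {T : V} (f g : T ⟶ A.mor) (h : f ≫ A.t = g ≫ A.s) (z : T ⟶ X)
      (h' : (lift f z ≫ onMor) ≫ B.t = (lift g z ≫ onMor) ≫ B.s),
      lift (A.comp f g h) z ≫ onMor = B.comp (lift f z ≫ onMor) (lift g z ≫ onMor) h') :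
    FunctorFamily A B X where
  onObj := onObj
  onMor := onMor
  map_s := map_s
  map_t := map_t
  map_i := map_i
  map_c := by
    have e (k : pullback A.t A.s ⟶ A.mor) : k ▷ X = lift (fst _ _ ≫ k) (snd _ _) := by
      ext <;> simp
    have e' : fst _ X ≫ A.c = A.comp (fst _ X ≫ pullback.fst A.t A.s)
        (fst _ X ≫ pullback.snd A.t A.s) (by simp [pullback.condition]) := by
      rw [← A.whisker_comp _ _ _ pullback.condition, InternalCat.comp]
      have e₁ : pullback.lift (pullback.fst A.t A.s) (pullback.snd A.t A.s)
          pullback.condition = 𝟙 _ := by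
        apply pullback.hom_ext
        · rw [pullback.lift_fst, Category.id_comp]
        · rw [pullback.lift_snd, Category.id_comp]
      rw [e₁, Category.id_comp]
    rw [e A.c, e', map_comp]
    · apply B.comp_congr <;> rw [e]
    · rw [Category.assoc, Category.assoc, map_s, map_t, lift_whiskerRight_assoc,
        lift_whiskerRight_assoc, Category.assoc, Category.assoc, pullback.condition]

/-- Evaluation at an object `a` of `A`, on objects of `⟦A, B⟧`. -/
noncomputable def evalObj {A : InternalCat V} (a : 𝟙_ V ⟶ A.obj) (B : InternalCat V) :
    obj A B ⟶ B.obj :=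
  (evalAt a B).onObj

/-- Evaluation at an object `a` of `A`, on morphisms of `⟦A, B⟧`. -/
noncomputable def evalMor {A : InternalCat V} (a : 𝟙_ V ⟶ A.obj) (B : InternalCat V) :
    mor A B ⟶ B.mor :=
  (evalAt a B).onMor

theorem comp_evalObj {A : InternalCat V} (k : X ⟶ obj A B) (a : 𝟙_ V ⟶ A.obj) :
    k ≫ evalObj a B = insertElem a X ≫ (internalHom.family k).onObj := by
  have h : k ≫ insertElem a (obj A B) ≫ (internalHom.family (𝟙 (obj A B))).onObj =
      insertElem a X ≫ (internalHom.family k).onObj := by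
    rw [reassoc_of% (insertElem_nat a k), ← family_comp_onObj, Category.comp_id]
  exact h

theorem comp_evalMor {A : InternalCat V} (n : X ⟶ mor A B) (a : 𝟙_ V ⟶ A.obj) :
    n ≫ evalMor a B = insertElem a X ≫ A.obj ◁ n ≫ (univ A B).app :=
  (Category.assoc _ _ _).symm.trans ((insertElem_nat a n =≫ (univ A B).app).trans
    (Category.assoc _ _ _))

end Families

/-! ### Families of morphisms as families of functors out of the free-living morphism -/

section Arrows

variable {V : Type u} [Category.{v} V] [CartesianMonoidalCategory V] [MonoidalClosed V]
  [HasPullbacks V] [Extensive V] {B : InternalCat V} {X : V}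

namespace walkingArrow

/-- The values on objects of the family of functors that classifies the generalized
morphism `f`. -/
def objAt (f : X ⟶ B.mor) : Two.{v} → (X ⟶ B.obj)
  | Two.zero => f ≫ B.s
  | Two.one => f ≫ B.t

/-- The values on morphisms of the family of functors that classifies the generalized
morphism `f`. -/
noncomputable def morAt (f : X ⟶ B.mor) : ∀ a b : Two.{v}, Two.hom V a b ⊗ X ⟶ B.mor
  | Two.zero, Two.zero => snd _ _ ≫ (f ≫ B.s) ≫ B.i
  | Two.zero, Two.one => snd _ _ ≫ f
  | Two.one, Two.one => snd _ _ ≫ (f ≫ B.t) ≫ B.i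
  | Two.one, Two.zero => fst _ _ ≫ initial.to _

variable (f : X ⟶ B.mor)

theorem morAt_s : ∀ a b : Two.{v}, morAt f a b ≫ B.s = snd _ _ ≫ objAt f a
  | Two.zero, Two.zero => by simp [morAt, objAt]
  | Two.zero, Two.one => by simp [morAt, objAt]
  | Two.one, Two.one => by simp [morAt, objAt]
  | Two.one, Two.zero => Two.ext_of_initial (fst (⊥_ V) X) _ _

theorem morAt_t : ∀ a b : Two.{v}, morAt f a b ≫ B.t = snd _ _ ≫ objAt f b
  | Two.zero, Two.zero => by simp [morAt, objAt]
  | Two.zero, Two.one => by simp [morAt, objAt]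
  | Two.one, Two.one => by simp [morAt, objAt]
  | Two.one, Two.zero => Two.ext_of_initial (fst (⊥_ V) X) _ _

theorem eId_morAt : ∀ a : Two.{v}, eId V a ▷ X ≫ morAt f a a = snd _ _ ≫ objAt f a ≫ B.i
  | Two.zero => whiskerRight_snd_assoc _ _ _
  | Two.one => whiskerRight_snd_assoc _ _ _

theorem lift_eComp_morAt {T : V} (z : T ⟶ X) : ∀ (a b c : Two.{v}) (x : T ⟶ Two.hom V a b)
    (x' : T ⟶ Two.hom V b c)
    (h : (lift x z ≫ morAt f a b) ≫ B.t = (lift x' z ≫ morAt f b c) ≫ B.s),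
    lift (lift x x' ≫ eComp V a b c) z ≫ morAt f a c =
      B.comp (lift x z ≫ morAt f a b) (lift x' z ≫ morAt f b c) h
  | Two.zero, Two.zero, Two.zero, x, x', h => by
    have e : lift x z ≫ morAt f Two.zero Two.zero = (z ≫ f ≫ B.s) ≫ B.i := by simp [morAt]
    rw [B.comp_congr e rfl, B.id_comp]
    exact (lift_snd_assoc _ _ _).trans (lift_snd_assoc _ _ _).symm
  | Two.zero, Two.zero, Two.one, x, x', h => by
    have e : lift x z ≫ morAt f Two.zero Two.zero = (z ≫ f ≫ B.s) ≫ B.i := by simp [morAt]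
    rw [B.comp_congr e rfl, B.id_comp]
    exact (lift_snd_assoc _ _ _).trans (lift_snd_assoc _ _ _).symm
  | Two.zero, Two.one, Two.one, x, x', h => by
    have e : lift x' z ≫ morAt f Two.one Two.one = (z ≫ f ≫ B.t) ≫ B.i := by simp [morAt]
    rw [B.comp_congr rfl e, B.comp_id]
    exact (lift_snd_assoc _ _ _).trans (lift_snd_assoc _ _ _).symm
  | Two.one, Two.one, Two.one, x, x', h => by
    have e : lift x' z ≫ morAt f Two.one Two.one = (z ≫ f ≫ B.t) ≫ B.i := by simp [morAt]
    rw [B.comp_congr rfl e, B.comp_id]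
    exact (lift_snd_assoc _ _ _).trans (lift_snd_assoc _ _ _).symm
  | Two.zero, Two.one, Two.zero, x, x', h => Two.ext_of_initial x' _ _
  | Two.one, Two.zero, _, x, x', h => Two.ext_of_initial x _ _
  | Two.one, Two.one, Two.zero, x, x', h => Two.ext_of_initial x' _ _

/-- The values on objects, as a single map. -/
noncomputable def onObj : Ob V Two.{v} ⊗ X ⟶ B.obj :=
  sigmaWhiskerDesc fun a => snd _ _ ≫ objAt f a

/-- The values on morphisms, as a single map. -/
noncomputable def onMor : Mor V Two.{v} ⊗ X ⟶ B.mor :=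
  sigmaWhiskerDesc fun p => morAt f p.1 p.2

theorem incl_onMor (a b : Two.{v}) : incl a b ▷ X ≫ onMor f = morAt f a b :=
  ι_sigmaWhiskerDesc _ (a, b)

theorem el_onObj (a : Two.{v}) : el a ▷ X ≫ onObj f = snd _ _ ≫ objAt f a :=
  ι_sigmaWhiskerDesc _ a

theorem gel_onObj (a : Two.{v}) (Y : V) : gel a Y ▷ X ≫ onObj f = snd _ _ ≫ objAt f a := by
  rw [comp_whiskerRight, Category.assoc, el_onObj, whiskerRight_snd_assoc]

theorem onMor_s : onMor f ≫ B.s = src V Two.{v} ▷ X ≫ onObj f := by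
  apply sigma_whiskerRight_hom_ext
  rintro ⟨a, b⟩
  refine (Category.assoc _ _ _).symm.trans ((incl_onMor f a b =≫ B.s).trans ?_)
  rw [← comp_whiskerRight_assoc, morAt_s]
  refine ((congrArg (fun q => q ▷ X ≫ onObj f) (incl_src a b)).trans (gel_onObj f a _)).symm

theorem onMor_t : onMor f ≫ B.t = tgt V Two.{v} ▷ X ≫ onObj f := by
  apply sigma_whiskerRight_hom_ext
  rintro ⟨a, b⟩
  refine (Category.assoc _ _ _).symm.trans ((incl_onMor f a b =≫ B.t).trans ?_)
  rw [← comp_whiskerRight_assoc, morAt_t]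
  refine ((congrArg (fun q => q ▷ X ≫ onObj f) (incl_tgt a b)).trans (gel_onObj f b _)).symm

theorem ident_onMor : ident V Two.{v} ▷ X ≫ onMor f = onObj f ≫ B.i := by
  apply sigma_whiskerRight_hom_ext
  intro a
  rw [← comp_whiskerRight_assoc, el_ident, comp_whiskerRight_assoc, incl_onMor, eId_morAt,
    ← Category.assoc (el a ▷ X), el_onObj, Category.assoc]

theorem lift_m_onMor {T : V} (g g' : T ⟶ Mor V Two.{v}) (h : g ≫ tgt V Two = g' ≫ src V Two)
    (z : T ⟶ X) (h' : (lift g z ≫ onMor f) ≫ B.t = (lift g' z ≫ onMor f) ≫ B.s) :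
    lift (m g g' h) z ≫ onMor f = B.comp (lift g z ≫ onMor f) (lift g' z ≫ onMor f) h' := by
  apply ext_pair g g' h
  intro a b c T' y x x' hx hx'
  have e1 : y ≫ lift g z ≫ onMor f = lift x (y ≫ z) ≫ morAt f a b := by
    rw [comp_lift_assoc]
    exact lift_sigmaWhiskerDesc _ (j := (a, b)) hx (y ≫ z)
  have e2 : y ≫ lift g' z ≫ onMor f = lift x' (y ≫ z) ≫ morAt f b c := by
    rw [comp_lift_assoc]
    exact lift_sigmaWhiskerDesc _ (j := (b, c)) hx' (y ≫ z)
  have e3 : y ≫ lift (m g g' h) z ≫ onMor f =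
      lift (lift x x' ≫ eComp V a b c) (y ≫ z) ≫ morAt f a c := by
    rw [comp_lift_assoc]
    refine lift_sigmaWhiskerDesc _ (j := (a, c)) ?_ (y ≫ z)
    rw [m_nat, m_spec _ hx hx', Category.assoc]
  rw [e3, B.whisker_comp, B.comp_congr e1 e2]
  exact lift_eComp_morAt f (y ≫ z) a b c x x' _

/-- The family of functors out of the free-living morphism that classifies the generalized
morphism `f`. -/
noncomputable def family : FunctorFamily (walkingArrow V) B X :=
  FunctorFamily.mk' (A := walkingArrow V) (onObj f) (onMor f) (onMor_s f) (onMor_t f)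
    (ident_onMor f) (fun g g' h z h' =>
      (congrArg (fun q => lift q z ≫ onMor f) (internalize.comp_eq g g' h)).trans
        (lift_m_onMor f g g' h z h'))

variable (V) in
/-- The nonidentity morphism of the free-living morphism. -/
noncomputable def arrow : 𝟙_ V ⟶ (walkingArrow V).mor :=
  incl Two.zero Two.one

theorem arrow_s : arrow V ≫ (walkingArrow V).s = zero V :=
  (incl_src Two.zero Two.one).trans
    ((toUnit_unique (toUnit (𝟙_ V)) (𝟙 _) =≫ _).trans (Category.id_comp _))

theorem arrow_t : arrow V ≫ (walkingArrow V).t = one V :=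
  (incl_tgt Two.zero Two.one).trans
    ((toUnit_unique (toUnit (𝟙_ V)) (𝟙 _) =≫ _).trans (Category.id_comp _))

theorem insertElem_arrow_s (φ : FunctorFamily (walkingArrow V) B X) :
    (insertElem (arrow V) X ≫ φ.onMor) ≫ B.s = insertElem (zero V) X ≫ φ.onObj := by
  rw [Category.assoc, φ.map_s, ← Category.assoc, insertElem_whisker, arrow_s]

theorem insertElem_arrow_t (φ : FunctorFamily (walkingArrow V) B X) :
    (insertElem (arrow V) X ≫ φ.onMor) ≫ B.t = insertElem (one V) X ≫ φ.onObj := by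
  rw [Category.assoc, φ.map_t, ← Category.assoc, insertElem_whisker, arrow_t]

/-- A family of functors sends the identities of the free-living morphism to identities. -/
theorem incl_self_onMor (φ : FunctorFamily (walkingArrow V) B X) (a : Two.{v}) :
    (incl a a : _ ⟶ (walkingArrow V).mor) ▷ X ≫ φ.onMor =
      (snd _ _ ≫ insertElem (el a : _ ⟶ (walkingArrow V).obj) X ≫ φ.onObj) ≫ B.i := by
  have h (a : Two.{v}) : (eId V a ≫ incl a a : _ ⟶ (walkingArrow V).mor) ▷ X ≫ φ.onMor =
      (snd _ _ ≫ insertElem (el a : _ ⟶ (walkingArrow V).obj) X ≫ φ.onObj) ≫ B.i := by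
    refine (congrArg (fun q : _ ⟶ (walkingArrow V).mor => q ▷ X ≫ φ.onMor)
      (el_ident a).symm).trans ?_
    refine (comp_whiskerRight_assoc (el a : _ ⟶ (walkingArrow V).obj) (walkingArrow V).i X
      _).trans ((_ ≫= φ.map_i).trans ((Category.assoc _ _ _).symm.trans ?_))
    exact (congrArg (fun q => q ≫ φ.onObj) (elem_whiskerRight _ X)).trans
      (Category.assoc _ _ _) =≫ B.i
  cases a
  · exact (congrArg (fun q : _ ⟶ (walkingArrow V).mor => q ▷ X ≫ φ.onMor)
      (Category.id_comp (incl Two.zero Two.zero))).symm.trans (h Two.zero)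
  · exact (congrArg (fun q : _ ⟶ (walkingArrow V).mor => q ▷ X ≫ φ.onMor)
      (Category.id_comp (incl Two.one Two.one))).symm.trans (h Two.one)

/-- A family of functors out of the free-living morphism is determined by its value on the
nonidentity morphism. -/
theorem family_ext {φ ψ : FunctorFamily (walkingArrow V) B X}
    (h : insertElem (arrow V) X ≫ φ.onMor = insertElem (arrow V) X ≫ ψ.onMor) : φ = ψ := by
  have hz : ∀ a : Two.{v}, insertElem (el a : _ ⟶ (walkingArrow V).obj) X ≫ φ.onObj =
      insertElem (el a : _ ⟶ (walkingArrow V).obj) X ≫ ψ.onObj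
    | Two.zero => (insertElem_arrow_s φ).symm.trans ((h =≫ B.s).trans (insertElem_arrow_s ψ))
    | Two.one => (insertElem_arrow_t φ).symm.trans ((h =≫ B.t).trans (insertElem_arrow_t ψ))
  have hi (a : Two.{v}) := (incl_self_onMor φ a).trans
    (((_ ≫= hz a) =≫ B.i).trans (incl_self_onMor ψ a).symm)
  -- The hom-object from `one` to `zero` is strictly initial, so there is nothing to compare there.
  apply FunctorFamily.ext
  · exact sigma_whiskerRight_hom_ext fun a => elem_whiskerRight_cancel.2 (hz a)
  · apply sigma_whiskerRight_hom_ext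
    rintro ⟨_ | _, _ | _⟩
    · exact hi Two.zero
    · exact elem_whiskerRight_cancel.2 h
    · exact Two.ext_of_initial (fst (⊥_ V) X) _ _
    · exact hi Two.one

/-- The generalized morphism that corresponds to a generalized functor out of the free-living
morphism. -/
noncomputable def toMor (k : X ⟶ obj (walkingArrow V) B) : X ⟶ B.mor :=
  insertElem (arrow V) X ≫ (internalHom.family k).onMor

theorem comp_toMor {Y : V} (y : Y ⟶ X) (k : X ⟶ obj (walkingArrow V) B) :
    y ≫ toMor k = toMor (y ≫ k) := by
  rw [toMor, toMor, family_comp_onMor, reassoc_of% (insertElem_nat (arrow V) y)]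

theorem toMor_injective {k l : X ⟶ obj (walkingArrow V) B} (h : toMor k = toMor l) : k = l := by
  have e : internalHom.family k = internalHom.family l := family_ext h
  exact internalHom.family_ext (by rw [e]) (by rw [e])

theorem exists_toMor (f : X ⟶ B.mor) : ∃ k : X ⟶ obj (walkingArrow V) B, toMor k = f := by
  refine ⟨classify (family f), ?_⟩
  rw [toMor, family_classify]
  exact (lift_sigmaWhiskerDesc _ (j := (Two.zero, Two.one)) rfl (𝟙 X)).trans
    ((lift_snd_assoc _ _ _).trans (Category.id_comp _))

theorem toMor_s (k : X ⟶ obj (walkingArrow V) B) :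
    toMor k ≫ B.s = k ≫ evalObj (zero V) B := by
  rw [comp_evalObj]
  exact insertElem_arrow_s _

theorem toMor_t (k : X ⟶ obj (walkingArrow V) B) :
    toMor k ≫ B.t = k ≫ evalObj (one V) B := by
  rw [comp_evalObj]
  exact insertElem_arrow_t _

/-- A generalized morphism of `⟦𝟚, B⟧` is a commutative square. -/
theorem comp_eval_eq (n : X ⟶ mor (walkingArrow V) B)
    (h : toMor (n ≫ (univ _ B).dom) ≫ B.t = (n ≫ evalMor (one V) B) ≫ B.s)
    (h' : (n ≫ evalMor (zero V) B) ≫ B.t = toMor (n ≫ (univ _ B).cod) ≫ B.s) :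
    B.comp (toMor (n ≫ (univ _ B).dom)) (n ≫ evalMor (one V) B) h =
      B.comp (n ≫ evalMor (zero V) B) (toMor (n ≫ (univ _ B).cod)) h' := by
  have e := insertElem (arrow V) X ≫= ((univ (walkingArrow V) B).pre n).natural
  rw [B.whisker_comp, B.whisker_comp] at e
  refine (B.comp_congr rfl ?_ _).trans (e.trans (B.comp_congr ?_ rfl _))
  · rw [comp_evalMor, ← Category.assoc (insertElem (arrow V) X), insertElem_whisker, arrow_t]
    rfl
  · rw [comp_evalMor, ← Category.assoc (insertElem (arrow V) X), insertElem_whisker, arrow_s]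
    rfl

theorem mor_ext {n n' : X ⟶ mor (walkingArrow V) B}
    (hd : n ≫ (univ _ B).dom = n' ≫ (univ _ B).dom)
    (hc : n ≫ (univ _ B).cod = n' ≫ (univ _ B).cod)
    (h₀ : n ≫ evalMor (zero V) B = n' ≫ evalMor (zero V) B)
    (h₁ : n ≫ evalMor (one V) B = n' ≫ evalMor (one V) B) : n = n' := by
  rw [comp_evalMor, comp_evalMor] at h₀ h₁
  apply internalHom.hom_ext hd hc
  apply sigma_whiskerRight_hom_ext
  rintro (_ | _)
  · exact elem_whiskerRight_cancel.2 h₀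
  · exact elem_whiskerRight_cancel.2 h₁

/-- The components at `zero` and at `one` of the transformation that corresponds to a square with
sides `p` and `q`. -/
def sideAt (p q : X ⟶ B.mor) : Two.{v} → (X ⟶ B.mor)
  | Two.zero => p
  | Two.one => q

/-- Each commutative square with sides `p` and `q` between the morphisms `k` and `l` is a
generalized morphism of `⟦𝟚, B⟧`. -/
theorem exists_square (k l : X ⟶ obj (walkingArrow V) B) (p q : X ⟶ B.mor)
    (hp : p ≫ B.s = toMor k ≫ B.s) (hp' : p ≫ B.t = toMor l ≫ B.s)
    (hq : q ≫ B.s = toMor k ≫ B.t) (hq' : q ≫ B.t = toMor l ≫ B.t)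
    (h : B.comp (toMor k) q hq.symm = B.comp p (toMor l) hp') :
    ∃ n : X ⟶ mor (walkingArrow V) B, n ≫ (univ _ B).dom = k ∧ n ≫ (univ _ B).cod = l ∧
      n ≫ evalMor (zero V) B = p ∧ n ≫ evalMor (one V) B = q := by
  let app : (walkingArrow V).obj ⊗ X ⟶ B.mor :=
    sigmaWhiskerDesc fun a : Two.{v} => snd _ _ ≫ sideAt p q a
  have happ (a : Two.{v}) : insertElem (el a : _ ⟶ (walkingArrow V).obj) X ≫ app =
      sideAt p q a :=
    (lift_sigmaWhiskerDesc _ (j := a) rfl (𝟙 X)).trans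
      ((lift_snd_assoc _ _ _).trans (Category.id_comp _))
  have hs : ∀ a : Two.{v}, sideAt p q a ≫ B.s =
      insertElem (el a : _ ⟶ (walkingArrow V).obj) X ≫ (internalHom.family k).onObj
    | Two.zero => hp.trans (insertElem_arrow_s _)
    | Two.one => hq.trans (insertElem_arrow_t _)
  have ht : ∀ a : Two.{v}, sideAt p q a ≫ B.t =
      insertElem (el a : _ ⟶ (walkingArrow V).obj) X ≫ (internalHom.family l).onObj
    | Two.zero => hp'.trans (insertElem_arrow_s _)
    | Two.one => hq'.trans (insertElem_arrow_t _)
  have app_s : app ≫ B.s = (internalHom.family k).onObj := by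
    refine sigma_whiskerRight_hom_ext fun a => elem_whiskerRight_cancel.2 ?_
    exact (Category.assoc _ _ _).symm.trans ((happ a =≫ B.s).trans (hs a))
  have app_t : app ≫ B.t = (internalHom.family l).onObj := by
    refine sigma_whiskerRight_hom_ext fun a => elem_whiskerRight_cancel.2 ?_
    exact (Category.assoc _ _ _).symm.trans ((happ a =≫ B.t).trans (ht a))
  have hgel (a : Two.{v}) (Y : V) : (gel a Y : _ ⟶ (walkingArrow V).obj) ▷ X ≫ app =
      snd _ _ ≫ sideAt p q a := by
    rw [← happ a, ← Category.assoc (snd _ _)]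
    refine congrArg (fun r => r ≫ app) ?_
    ext <;> simp [insertElem]
  have hsrc (a b : Two.{v}) : (incl a b : _ ⟶ (walkingArrow V).mor) ▷ X ≫
      (walkingArrow V).s ▷ X ≫ app = snd _ _ ≫ sideAt p q a :=
    (comp_whiskerRight_assoc _ _ _ _).symm.trans
      ((congrArg (fun r : _ ⟶ (walkingArrow V).obj => r ▷ X ≫ app) (incl_src a b)).trans
        (hgel a _))
  have htgt (a b : Two.{v}) : (incl a b : _ ⟶ (walkingArrow V).mor) ▷ X ≫
      (walkingArrow V).t ▷ X ≫ app = snd _ _ ≫ sideAt p q b :=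
    (comp_whiskerRight_assoc _ _ _ _).symm.trans
      ((congrArg (fun r : _ ⟶ (walkingArrow V).obj => r ▷ X ≫ app) (incl_tgt a b)).trans
        (hgel b _))
  have hk : (internalHom.family k).onMor ≫ B.t = ((walkingArrow V).t ▷ X ≫ app) ≫ B.s := by
    rw [Category.assoc, app_s, (internalHom.family k).map_t]
  have hl : ((walkingArrow V).s ▷ X ≫ app) ≫ B.t = (internalHom.family l).onMor ≫ B.s := by
    rw [Category.assoc, app_t, (internalHom.family l).map_s]
  -- Naturality is automatic at the identities and is the given square at the nonidentity
  -- morphism.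
  have natural : B.comp (internalHom.family k).onMor ((walkingArrow V).t ▷ X ≫ app) hk =
      B.comp ((walkingArrow V).s ▷ X ≫ app) (internalHom.family l).onMor hl := by
    have hself (a : Two.{v}) := (B.whisker_comp ((incl a a : _ ⟶ (walkingArrow V).mor) ▷ X)
      (internalHom.family k).onMor ((walkingArrow V).t ▷ X ≫ app) hk).trans
      ((B.comp_congr (incl_self_onMor _ a) (htgt a a) _).trans ((B.id_comp _ _ _).trans
        (((B.comp_congr (hsrc a a) (incl_self_onMor _ a) _).trans (B.comp_id _ _ _)).symm.trans
        (B.whisker_comp ((incl a a : _ ⟶ (walkingArrow V).mor) ▷ X)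
          ((walkingArrow V).s ▷ X ≫ app) (internalHom.family l).onMor hl).symm)))
    apply sigma_whiskerRight_hom_ext
    rintro ⟨_ | _, _ | _⟩
    · exact hself Two.zero
    · have e (m : X ⟶ obj (walkingArrow V) B) : (incl Two.zero Two.one : _ ⟶
          (walkingArrow V).mor) ▷ X ≫ (internalHom.family m).onMor = snd _ _ ≫ toMor m :=
        (congrArg (fun r => r ≫ _) (elem_whiskerRight (arrow V) X)).trans (Category.assoc _ _ _)
      refine (B.whisker_comp _ _ _ _).trans (Eq.trans ?_ (B.whisker_comp _ _ _ _).symm)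
      refine (B.comp_congr (e k) (htgt _ _) _).trans
        (Eq.trans ?_ (B.comp_congr (hsrc _ _) (e l) _).symm)
      exact (B.whisker_comp _ _ _ _).symm.trans ((_ ≫= h).trans (B.whisker_comp _ _ _ _))
    · exact Two.ext_of_initial (fst (⊥_ V) X) _ _
    · exact hself Two.one
  let N : NatFamily (walkingArrow V) B X := ⟨k, l, app, app_s, app_t, natural⟩
  refine ⟨classifyNat N, classifyNat_dom N, classifyNat_cod N, ?_, ?_⟩
  · rw [comp_evalMor, classifyNat_app]
    exact happ Two.zero
  · rw [comp_evalMor, classifyNat_app]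
    exact happ Two.one

end walkingArrow

end Arrows

/-! ### Generalized elements of comma internal categories -/

namespace comma

variable {V : Type u} [Category.{v} V] [CartesianMonoidalCategory V] [MonoidalClosed V]
  [HasPullbacks V] [Extensive V] {A B : InternalCat V} {H : InternalFunctor A B}
  {b : 𝟙_ V ⟶ B.obj} {X : V}

variable (H b) in
/-- The projection of `H ↓ b` to `A`, on objects. -/
noncomputable abbrev projObj : (comma H b).obj ⟶ A.obj :=
  pullback.fst (prodLift H (constAt A b)).onObj (evalEnds B).onObj

variable (H b) in
/-- The projection of `H ↓ b` to `A`, on morphisms. -/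
noncomputable abbrev projMor : (comma H b).mor ⟶ A.mor :=
  pullback.fst (prodLift H (constAt A b)).onMor (evalEnds B).onMor

variable (H b) in
/-- The projection of `H ↓ b` to `⟦𝟚, B⟧`, on objects. -/
noncomputable abbrev arrowObj : (comma H b).obj ⟶ obj (walkingArrow V) B :=
  pullback.snd (prodLift H (constAt A b)).onObj (evalEnds B).onObj

variable (H b) in
/-- The projection of `H ↓ b` to `⟦𝟚, B⟧`, on morphisms. -/
noncomputable abbrev arrowMor : (comma H b).mor ⟶ mor (walkingArrow V) B :=
  pullback.snd (prodLift H (constAt A b)).onMor (evalEnds B).onMor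

/-- The generalized morphism of `B` that underlies a generalized object of `H ↓ b`. -/
noncomputable def hom (x : X ⟶ (comma H b).obj) : X ⟶ B.mor :=
  walkingArrow.toMor (x ≫ arrowObj H b)

theorem comp_hom {Y : V} (y : Y ⟶ X) (x : X ⟶ (comma H b).obj) : y ≫ hom x = hom (y ≫ x) := by
  rw [hom, hom, walkingArrow.comp_toMor, Category.assoc]

theorem obj_ext {x y : X ⟶ (comma H b).obj} (h₁ : x ≫ projObj H b = y ≫ projObj H b)
    (h₂ : hom x = hom y) : x = y :=
  pullback.hom_ext h₁ (walkingArrow.toMor_injective h₂)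

theorem mor_ext' {n n' : X ⟶ (comma H b).mor} (h₁ : n ≫ projMor H b = n' ≫ projMor H b)
    (h₂ : n ≫ arrowMor H b = n' ≫ arrowMor H b) : n = n' :=
  pullback.hom_ext h₁ h₂

theorem obj_condition : projObj H b ≫ lift H.onObj (toUnit _ ≫ b) =
    arrowObj H b ≫ lift (evalObj (walkingArrow.zero V) B)
      (evalObj (walkingArrow.one V) B) :=
  pullback.condition (f := (prodLift H (constAt A b)).onObj) (g := (evalEnds B).onObj)

theorem mor_condition : projMor H b ≫ lift H.onMor (toUnit _ ≫ b ≫ B.i) =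
    arrowMor H b ≫ lift (evalMor (walkingArrow.zero V) B)
      (evalMor (walkingArrow.one V) B) :=
  pullback.condition (f := (prodLift H (constAt A b)).onMor) (g := (evalEnds B).onMor)

theorem hom_s (x : X ⟶ (comma H b).obj) : hom x ≫ B.s = (x ≫ projObj H b) ≫ H.onObj := by
  have e := (x ≫= obj_condition (H := H) (b := b)) =≫ fst _ _
  rw [comp_lift, comp_lift, Category.assoc, Category.assoc, lift_fst, lift_fst] at e
  rw [hom, walkingArrow.toMor_s, Category.assoc, Category.assoc, e]

theorem hom_t (x : X ⟶ (comma H b).obj) : hom x ≫ B.t = toUnit _ ≫ b := by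
  have e := (x ≫= obj_condition (H := H) (b := b)) =≫ snd _ _
  rw [comp_lift, comp_lift, Category.assoc, Category.assoc, lift_snd, lift_snd,
    comp_toUnit_assoc, comp_toUnit_assoc] at e
  rw [hom, walkingArrow.toMor_t, e, Category.assoc]

theorem exists_obj (a : X ⟶ A.obj) (f : X ⟶ B.mor) (hs : f ≫ B.s = a ≫ H.onObj)
    (ht : f ≫ B.t = toUnit _ ≫ b) :
    ∃ x : X ⟶ (comma H b).obj, x ≫ projObj H b = a ∧ hom x = f := by
  obtain ⟨k, rfl⟩ := walkingArrow.exists_toMor f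
  rw [walkingArrow.toMor_s] at hs
  rw [walkingArrow.toMor_t] at ht
  have e : a ≫ lift H.onObj (toUnit _ ≫ b) = k ≫ lift (evalObj (walkingArrow.zero V) B)
      (evalObj (walkingArrow.one V) B) := by
    rw [comp_lift, comp_lift, hs, ht, comp_toUnit_assoc]
  refine ⟨pullback.lift (f := (prodLift H (constAt A b)).onObj) (g := (evalEnds B).onObj) a k e,
    pullback.lift_fst _ _ _, congrArg walkingArrow.toMor (pullback.lift_snd _ _ _)⟩

theorem s_projObj : (comma H b).s ≫ projObj H b = projMor H b ≫ A.s :=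
  pullback.lift_fst _ _ _

theorem t_projObj : (comma H b).t ≫ projObj H b = projMor H b ≫ A.t :=
  pullback.lift_fst _ _ _

theorem s_arrowObj : (comma H b).s ≫ arrowObj H b = arrowMor H b ≫ (univ _ B).dom :=
  pullback.lift_snd _ _ _

theorem t_arrowObj : (comma H b).t ≫ arrowObj H b = arrowMor H b ≫ (univ _ B).cod :=
  pullback.lift_snd _ _ _

theorem arrowMor_zero (n : X ⟶ (comma H b).mor) :
    (n ≫ arrowMor H b) ≫ (evalMor (walkingArrow.zero V) B) =
      (n ≫ projMor H b) ≫ H.onMor := by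
  have e := (n ≫= mor_condition (H := H) (b := b)) =≫ fst _ _
  rw [comp_lift, comp_lift, Category.assoc, Category.assoc, lift_fst, lift_fst] at e
  rw [Category.assoc, Category.assoc, e]

theorem arrowMor_one (n : X ⟶ (comma H b).mor) :
    (n ≫ arrowMor H b) ≫ (evalMor (walkingArrow.one V) B) = (toUnit _ ≫ b) ≫ B.i := by
  have e := (n ≫= mor_condition (H := H) (b := b)) =≫ snd _ _
  rw [comp_lift, comp_lift, Category.assoc, Category.assoc, lift_snd, lift_snd,
    comp_toUnit_assoc, comp_toUnit_assoc] at e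
  rw [Category.assoc, Category.assoc, e]

theorem mor_ext {n n' : X ⟶ (comma H b).mor} (hs : n ≫ (comma H b).s = n' ≫ (comma H b).s)
    (ht : n ≫ (comma H b).t = n' ≫ (comma H b).t)
    (h : n ≫ projMor H b = n' ≫ projMor H b) : n = n' := by
  refine mor_ext' h (walkingArrow.mor_ext ?_ ?_ ?_ ?_)
  · rw [Category.assoc, Category.assoc, ← s_arrowObj, reassoc_of% hs]
  · rw [Category.assoc, Category.assoc, ← t_arrowObj, reassoc_of% ht]
  · rw [arrowMor_zero, arrowMor_zero, h]
  · rw [arrowMor_one, arrowMor_one]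

theorem composable {y : X ⟶ (comma H b).obj} {u : X ⟶ A.mor}
    (ht : u ≫ A.t = y ≫ projObj H b) : (u ≫ H.onMor) ≫ B.t = hom y ≫ B.s := by
  rw [hom_s, Category.assoc, H.map_t, reassoc_of% ht, Category.assoc]

/-- A generalized morphism `u` of `H ↓ b` satisfies `H u ≫ g = f`, where `f` and `g` are the
morphisms of `B` that underlie its source and its target. -/
theorem comp_hom_eq (n : X ⟶ (comma H b).mor) :
    B.comp ((n ≫ projMor H b) ≫ H.onMor) (hom (n ≫ (comma H b).t))
      (composable (by rw [Category.assoc, Category.assoc, t_projObj])) =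
        hom (n ≫ (comma H b).s) := by
  have e₁ : walkingArrow.toMor ((n ≫ arrowMor H b) ≫ (univ _ B).dom) =
      hom (n ≫ (comma H b).s) := by
    rw [hom, Category.assoc, Category.assoc, s_arrowObj]
  have e₂ : walkingArrow.toMor ((n ≫ arrowMor H b) ≫ (univ _ B).cod) =
      hom (n ≫ (comma H b).t) := by
    rw [hom, Category.assoc, Category.assoc, t_arrowObj]
  have e := walkingArrow.comp_eval_eq (n ≫ arrowMor H b)
    (by rw [e₁, arrowMor_one, hom_t, Category.assoc, B.i_s, Category.comp_id])
    (by
      rw [e₂, arrowMor_zero]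
      exact composable (by rw [Category.assoc, Category.assoc, t_projObj]))
  rw [B.comp_congr e₁ (arrowMor_one n), B.comp_id, B.comp_congr (arrowMor_zero n) e₂] at e
  exact e.symm

theorem exists_mor (x y : X ⟶ (comma H b).obj) (u : X ⟶ A.mor)
    (hs : u ≫ A.s = x ≫ projObj H b) (ht : u ≫ A.t = y ≫ projObj H b)
    (h : B.comp (u ≫ H.onMor) (hom y) (composable ht) = hom x) :
    ∃ n : X ⟶ (comma H b).mor, n ≫ (comma H b).s = x ∧ n ≫ (comma H b).t = y ∧
      n ≫ projMor H b = u := by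
  obtain ⟨n, hd, hc, h₀, h₁⟩ := walkingArrow.exists_square (x ≫ arrowObj H b) (y ≫ arrowObj H b)
    (u ≫ H.onMor) ((toUnit _ ≫ b) ≫ B.i)
    (by
      refine Eq.trans ?_ (hom_s x).symm
      rw [Category.assoc, H.map_s, reassoc_of% hs, Category.assoc])
    (composable ht)
    (by
      refine Eq.trans ?_ (hom_t x).symm
      rw [Category.assoc, B.i_s, Category.comp_id])
    (by
      refine Eq.trans ?_ (hom_t y).symm
      rw [Category.assoc, B.i_t, Category.comp_id])
    (by
      rw [B.comp_id]
      exact h.symm)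
  have e : u ≫ lift H.onMor (toUnit _ ≫ b ≫ B.i) =
      n ≫ lift (evalMor (walkingArrow.zero V) B) (evalMor (walkingArrow.one V) B) := by
    rw [comp_lift, comp_lift, h₀, h₁, comp_toUnit_assoc, Category.assoc]
  let n' : X ⟶ (comma H b).mor :=
    pullback.lift (f := (prodLift H (constAt A b)).onMor) (g := (evalEnds B).onMor) u n e
  have e₁ : n' ≫ projMor H b = u := pullback.lift_fst _ _ _
  have e₂ : n' ≫ arrowMor H b = n := pullback.lift_snd _ _ _
  refine ⟨n', ?_, ?_, e₁⟩
  · refine obj_ext ?_ (congrArg walkingArrow.toMor ?_)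
    · rw [Category.assoc, s_projObj, reassoc_of% e₁, hs]
    · rw [Category.assoc, s_arrowObj, reassoc_of% e₂, hd]
  · refine obj_ext ?_ (congrArg walkingArrow.toMor ?_)
    · rw [Category.assoc, t_projObj, reassoc_of% e₁, ht]
    · rw [Category.assoc, t_arrowObj, reassoc_of% e₂, hc]

/-- Terminality of an object `(L, l)` of `H ↓ b`: for each generalized object `(a, f)` there is
exactly one morphism `u` from `a` to `L` with `H u ≫ l = f`. -/
theorem isGenTerminal_iff (T : 𝟙_ V ⟶ (comma H b).obj) :
    IsGenTerminal (comma H b) T ↔ ∀ (X : V) (a : X ⟶ A.obj) (f : X ⟶ B.mor),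
      f ≫ B.s = a ≫ H.onObj → f ≫ B.t = toUnit _ ≫ b →
        ∃! u : X ⟶ A.mor, u ≫ A.s = a ∧ ∃ ht : u ≫ A.t = (toUnit X ≫ T) ≫ projObj H b,
          B.comp (u ≫ H.onMor) (hom (toUnit X ≫ T)) (composable ht) = f := by
  constructor
  · intro hT X a f hs ht
    obtain ⟨x, rfl, rfl⟩ := exists_obj a f hs ht
    obtain ⟨n, ⟨rfl, hn⟩, huniq⟩ := hT X x
    refine ⟨n ≫ projMor H b, ⟨?_, ?_, ?_⟩, ?_⟩
    · rw [Category.assoc, Category.assoc, s_projObj]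
    · rw [← hn, Category.assoc, Category.assoc, t_projObj]
    · have e := comp_hom_eq n
      rw [B.comp_congr rfl (congrArg hom hn)] at e
      exact e
    · rintro u ⟨hus, hut, hu⟩
      obtain ⟨n', h₁, h₂, rfl⟩ := exists_mor (n ≫ (comma H b).s) (toUnit X ≫ T) u hus hut hu
      rw [huniq n' ⟨h₁, h₂⟩]
  · intro hT X x
    obtain ⟨u, ⟨hus, hut, hu⟩, huniq⟩ := hT X (x ≫ projObj H b) (hom x) (hom_s x) (hom_t x)
    obtain ⟨n, h₁, h₂, rfl⟩ := exists_mor x (toUnit X ≫ T) u hus hut hu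
    refine ⟨n, ⟨h₁, h₂⟩, ?_⟩
    rintro n' ⟨h₁', h₂'⟩
    refine mor_ext (h₁'.trans h₁.symm) (h₂'.trans h₂.symm) (huniq _ ⟨?_, ?_, ?_⟩)
    · rw [← h₁', Category.assoc, Category.assoc, s_projObj]
    · rw [← h₂', Category.assoc, Category.assoc, t_projObj]
    · have e := comp_hom_eq n'
      rw [B.comp_congr rfl (congrArg hom h₂'), h₁'] at e
      exact e

end comma

/-! ### Internal terminal objects -/

section Terminal

open comma

variable {V : Type u} [Category.{v} V] [CartesianMonoidalCategory V] [MonoidalClosed V]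
  [HasPullbacks V] [Extensive V] {A : InternalCat V} {T : 𝟙_ V ⟶ A.obj}

/-- The projection of the slice `A / T` to `A` is bijective on generalized objects at `X` exactly
if each generalized object at `X` has exactly one generalized morphism to `T`. -/
theorem bijective_projObj_iff (X : V) :
    (Function.Bijective fun x : X ⟶ (slice A T).obj =>
      x ≫ projObj (InternalFunctor.id A) T) ↔
      ∀ a : X ⟶ A.obj, ∃! f : X ⟶ A.mor, f ≫ A.s = a ∧ f ≫ A.t = toUnit X ≫ T := by
  constructor
  · rintro ⟨hinj, hsurj⟩ a
    obtain ⟨x, rfl⟩ := hsurj a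
    refine ⟨hom x, ⟨(hom_s x).trans (Category.comp_id _), hom_t x⟩, ?_⟩
    rintro f ⟨hs, ht⟩
    obtain ⟨y, hy, rfl⟩ := exists_obj (H := InternalFunctor.id A) _ f
      (hs.trans (Category.comp_id _).symm) ht
    rw [hinj hy]
  · intro h
    constructor
    · intro x y hxy
      refine obj_ext hxy ((h (x ≫ projObj _ _)).unique
        ⟨(hom_s x).trans (Category.comp_id _), hom_t x⟩ ⟨?_, hom_t y⟩)
      exact (hom_s y).trans ((Category.comp_id _).trans hxy.symm)
    · intro a
      obtain ⟨f, ⟨hs, ht⟩, -⟩ := h a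
      obtain ⟨x, hx, -⟩ := exists_obj (H := InternalFunctor.id A) a f
        (hs.trans (Category.comp_id _).symm) ht
      exact ⟨x, hx⟩

theorem isGenTerminal_iff_isIso_projObj :
    IsGenTerminal A T ↔ IsIso (projObj (InternalFunctor.id A) T) :=
  (forall_congr' fun X => (bijective_projObj_iff X).symm).trans
    (isIso_iff_yoneda_map_bijective _).symm

/-- The projection `A / T ⟶ A` is invertible as soon as it is invertible on objects: the triangle
over `T` that a morphism of `A / T` has to satisfy commutes by uniqueness. -/
theorem isInternalTerminal_iff_isGenTerminal :
    IsInternalTerminal A T ↔ IsGenTerminal A T := by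
  constructor
  · intro h
    have : IsIso (slice.proj A T) := h
    exact isGenTerminal_iff_isIso_projObj.2 (InternalFunctor.isIso_onObj (slice.proj A T))
  · intro h
    have h₀ : IsIso (slice.proj A T : InternalFunctor _ _).onObj :=
      isGenTerminal_iff_isIso_projObj.1 h
    have hb (X : V) := (bijective_projObj_iff X).2 (h X)
    have h₁ : IsIso (projMor (InternalFunctor.id A) T) := by
      refine isIso_of_yoneda_map_bijective _ fun X => ⟨?_, ?_⟩
      · intro n n' hn
        refine mor_ext ((hb X).1 ?_) ((hb X).1 ?_) hn
        · change (n ≫ (comma _ T).s) ≫ projObj _ T = (n' ≫ (comma _ T).s) ≫ projObj _ T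
          rw [Category.assoc, Category.assoc, s_projObj, ← Category.assoc, ← Category.assoc]
          exact hn =≫ A.s
        · change (n ≫ (comma _ T).t) ≫ projObj _ T = (n' ≫ (comma _ T).t) ≫ projObj _ T
          rw [Category.assoc, Category.assoc, t_projObj, ← Category.assoc, ← Category.assoc]
          exact hn =≫ A.t
      · intro u
        obtain ⟨x, hx⟩ := (hb X).2 (u ≫ A.s)
        obtain ⟨y, hy⟩ := (hb X).2 (u ≫ A.t)
        obtain ⟨n, -, -, hn⟩ := exists_mor (H := InternalFunctor.id A) x y u hx.symm hy.symm
          ((h X (u ≫ A.s)).unique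
            ⟨(A.comp_s _ _ _).trans ((Category.assoc _ _ _).trans
              (u ≫= Category.id_comp _)), (A.comp_t _ _ _).trans (hom_t y)⟩
            ⟨(hom_s x).trans ((Category.comp_id _).trans hx), hom_t x⟩)
        exact ⟨n, hn⟩
    have : IsIso (slice.proj A T : InternalFunctor _ _).onMor := h₁
    exact InternalFunctor.isIso_of_isIso (slice.proj A T)

end Terminal

/-! ### Terminal objects in the underlying enriched categories -/

section Constant

variable {V : Type u} [Category.{v} V] [CartesianMonoidalCategory V] [HasPullbacks V]
  {A : InternalCat V} {X Z : V}

theorem cst_family_onMor (φ : FunctorFamily (cst X) A Z) : φ.onMor = φ.onObj ≫ A.i := by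
  refine Eq.trans ?_ φ.map_i
  exact ((congrArg (fun q => q ≫ φ.onMor) (id_whiskerRight X Z)).trans (Category.id_comp _)).symm

variable [MonoidalClosed V]

/-- A family of functors out of a constant internal category is a family of objects. -/
noncomputable def cstFamily (a : X ⊗ Z ⟶ A.obj) : FunctorFamily (cst X) A Z :=
  FunctorFamily.mk' (A := cst X) a (a ≫ A.i)
    ((Category.assoc _ _ _).trans ((congrArg (fun q => a ≫ q) A.i_s).trans
      ((Category.comp_id a).trans
        ((congrArg (fun q => q ≫ a) (id_whiskerRight X Z)).trans (Category.id_comp _)).symm)))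
    ((Category.assoc _ _ _).trans ((congrArg (fun q => a ≫ q) A.i_t).trans
      ((Category.comp_id a).trans
        ((congrArg (fun q => q ≫ a) (id_whiskerRight X Z)).trans (Category.id_comp _)).symm)))
    ((congrArg (fun q => q ≫ a ≫ A.i) (id_whiskerRight X Z)).trans (Category.id_comp _))
    (fun {T} f g h z h' => by
      have key (f g : T ⟶ X) (h' : (lift f z ≫ a ≫ A.i) ≫ A.t = (lift g z ≫ a ≫ A.i) ≫ A.s) :
          lift f z ≫ a ≫ A.i = A.comp (lift f z ≫ a ≫ A.i) (lift g z ≫ a ≫ A.i) h' := by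
        rw [A.comp_congr rfl (Category.assoc (lift g z) a A.i).symm, A.comp_id]
      exact (congrArg (fun q : T ⟶ X => lift q z ≫ a ≫ A.i)
        (CompData.toInternalCat_comp (cst.data X) f g h)).trans (key f g h'))

/-- Families of natural transformations between functors out of a constant internal category are
families of morphisms. -/
theorem exists_cst_mor (k l : Z ⟶ obj (cst X) A) (g : X ⊗ Z ⟶ A.mor)
    (hs : g ≫ A.s = (internalHom.family k).onObj) (ht : g ≫ A.t = (internalHom.family l).onObj) :
    ∃ n : Z ⟶ mor (cst X) A, n ≫ (univ _ A).dom = k ∧ n ≫ (univ _ A).cod = l ∧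
      X ◁ n ≫ (univ (cst X) A).app = g := by
  have e : X ◁ 𝟙 Z ≫ g = g := by simp
  have e' : 𝟙 X ▷ Z ≫ g = g := by simp
  let N : NatFamily (cst X) A Z :=
    { dom := k
      cod := l
      app := g
      app_s := hs
      app_t := ht
      -- All structure maps of `cst X` are identities, so both sides are `g`.
      natural := by
        refine (A.comp_congr (cst_family_onMor _) e' _).trans ((A.id_comp _ _ _).trans ?_)
        exact ((A.comp_congr e' (cst_family_onMor _) _).trans (A.comp_id _ _ _)).symm }
  exact ⟨classifyNat N, classifyNat_dom N, classifyNat_cod N, classifyNat_app N⟩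

/-- The generalized elements of a hom-object of the underlying `V`-category of `⟦cst X, A⟧` are
generalized morphisms of `A`. -/
theorem existsUnique_hom_iff (a b : Und (internalHom (cst X) A)) :
    (∃! _h : Z ⟶ (a ⟶[V] b), True) ↔ ∃! g : X ⊗ Z ⟶ A.mor,
      g ≫ A.s = (internalHom.family (A := cst X) (toUnit Z ≫ a.elt)).onObj ∧
      g ≫ A.t = (internalHom.family (A := cst X) (toUnit Z ≫ b.elt)).onObj := by
  let Φ (h : Z ⟶ (a ⟶[V] b)) : X ⊗ Z ⟶ A.mor :=
    X ◁ (h ≫ Und.toMor a b : Z ⟶ mor (cst X) A) ≫ (univ (cst X) A).app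
  have hd (h : Z ⟶ (a ⟶[V] b)) : (h ≫ Und.toMor a b : Z ⟶ mor (cst X) A) ≫
      (univ (cst X) A).dom = toUnit Z ≫ a.elt :=
    (Category.assoc _ _ _).trans ((h ≫= Und.toMor_s a b).trans (comp_toUnit_assoc _ _))
  have hc (h : Z ⟶ (a ⟶[V] b)) : (h ≫ Und.toMor a b : Z ⟶ mor (cst X) A) ≫
      (univ (cst X) A).cod = toUnit Z ≫ b.elt :=
    (Category.assoc _ _ _).trans ((h ≫= Und.toMor_t a b).trans (comp_toUnit_assoc _ _))
  have hΦs (h) : Φ h ≫ A.s = (internalHom.family (A := cst X) (toUnit Z ≫ a.elt)).onObj :=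
    ((univ (cst X) A).pre (h ≫ Und.toMor a b)).app_s.trans
      (congrArg (fun q => (internalHom.family q).onObj) (hd h))
  have hΦt (h) : Φ h ≫ A.t = (internalHom.family (A := cst X) (toUnit Z ≫ b.elt)).onObj :=
    ((univ (cst X) A).pre (h ≫ Und.toMor a b)).app_t.trans
      (congrArg (fun q => (internalHom.family q).onObj) (hc h))
  have hinj : Function.Injective Φ := fun h h' e =>
    Und.hom_ext (internalHom.hom_ext ((hd h).trans (hd h').symm) ((hc h).trans (hc h').symm) e)
  have hsurj (g : X ⊗ Z ⟶ A.mor)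
      (hs : g ≫ A.s = (internalHom.family (A := cst X) (toUnit Z ≫ a.elt)).onObj)
      (ht : g ≫ A.t = (internalHom.family (A := cst X) (toUnit Z ≫ b.elt)).onObj) :
      ∃ h, Φ h = g := by
    obtain ⟨n, h₁, h₂, h₃⟩ := exists_cst_mor _ _ g hs ht
    exact ⟨Und.homLift (A := internalHom (cst X) A) n h₁ h₂, (congrArg (fun q => X ◁ q ≫
      (univ (cst X) A).app) (Und.homLift_toMor (A := internalHom (cst X) A) n h₁ h₂)).trans h₃⟩
  constructor
  · rintro ⟨h, -, hh⟩
    refine ⟨Φ h, ⟨hΦs h, hΦt h⟩, ?_⟩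
    rintro g ⟨hs, ht⟩
    obtain ⟨h', rfl⟩ := hsurj g hs ht
    rw [hh h' trivial]
  · rintro ⟨g, ⟨hs, ht⟩, hg⟩
    obtain ⟨h, rfl⟩ := hsurj g hs ht
    exact ⟨h, trivial, fun h' _ => hinj (hg _ ⟨hΦs h', hΦt h'⟩)⟩

theorem constElem_family (T : 𝟙_ V ⟶ A.obj) :
    (internalHom.family (A := cst X) (toUnit Z ≫ constElem A T X)).onObj =
      toUnit (X ⊗ Z) ≫ T := by
  have e : (internalHom.family (A := cst X) (constElem A T X)).onObj = toUnit (X ⊗ 𝟙_ V) ≫ T := by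
    rw [constElem, nameOf, family_classify, constFamily_onObj]
    exact (Category.assoc _ _ _).symm.trans (toUnit_unique _ _ =≫ T)
  refine (family_comp_onObj (A := cst X) (B := A) (toUnit Z) (constElem A T X)).trans
    ((congrArg (fun q => X ◁ toUnit Z ≫ q) e).trans ?_)
  exact (Category.assoc _ _ _).symm.trans (toUnit_unique _ _ =≫ T)

theorem isVTerminal_constElem_iff (T : 𝟙_ V ⟶ A.obj) (X : V) :
    IsVTerminal V (⟨constElem A T X⟩ : Und (internalHom (cst X) A)) ↔
      ∀ (a : 𝟙_ V ⟶ obj (cst X) A) (Z : V), ∃! g : X ⊗ Z ⟶ A.mor,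
        g ≫ A.s = (internalHom.family (toUnit Z ≫ a)).onObj ∧ g ≫ A.t = toUnit _ ≫ T := by
  constructor
  · intro h a Z
    have := (existsUnique_hom_iff (Z := Z) (A := A) (X := X) ⟨a⟩ ⟨constElem A T X⟩).1
      (isIso_toUnit_iff.1 (h ⟨a⟩) Z)
    rwa [constElem_family] at this
  · intro h a
    refine isIso_toUnit_iff.2 fun Z => (existsUnique_hom_iff a ⟨constElem A T X⟩).2 ?_
    rw [constElem_family]
    exact h a.elt Z

/-- Terminality at the unit object suffices to recover terminality on generalized elements with
domain `X`. -/
theorem existsUnique_of_isVTerminal {T : 𝟙_ V ⟶ A.obj}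
    (h : IsVTerminal V (⟨constElem A T X⟩ : Und (internalHom (cst X) A))) (a : X ⟶ A.obj) :
    ∃! f : X ⟶ A.mor, f ≫ A.s = a ∧ f ≫ A.t = toUnit X ≫ T := by
  have key := (isVTerminal_constElem_iff T X).1 h (classify (cstFamily (fst X (𝟙_ V) ≫ a))) (𝟙_ V)
  have e : (internalHom.family (toUnit (𝟙_ V) ≫ classify (cstFamily (fst X (𝟙_ V) ≫ a)))).onObj =
      fst X (𝟙_ V) ≫ a := by
    rw [toUnit_unique (toUnit (𝟙_ V)) (𝟙 _), Category.id_comp, family_classify]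
    rfl
  rw [e] at key
  obtain ⟨g, ⟨hs, ht⟩, hg⟩ := key
  refine ⟨lift (𝟙 X) (toUnit X) ≫ g, ⟨?_, ?_⟩, ?_⟩
  · rw [Category.assoc, hs, lift_fst_assoc, Category.id_comp]
  · rw [Category.assoc, ht, comp_toUnit_assoc]
  · rintro f ⟨rfl, hf⟩
    rw [← hg (fst _ _ ≫ f) ⟨Category.assoc _ _ _, by rw [Category.assoc, hf, comp_toUnit_assoc]⟩,
      lift_fst_assoc, Category.id_comp]

/-- Internal terminality may be tested on the underlying `V`-categories of the internal
categories `⟦cst X, A⟧`, where `X` runs through a conservative family. -/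
theorem isGenTerminal_iff_isVTerminal [Extensive V] (𝒢 : Set V) (h𝒢 : IsConservative 𝒢)
    (T : 𝟙_ V ⟶ A.obj) : IsGenTerminal A T ↔
      ∀ X ∈ 𝒢, IsVTerminal V (⟨constElem A T X⟩ : Und (internalHom (cst X) A)) := by
  constructor
  · intro h X _
    exact (isVTerminal_constElem_iff T X).2 fun a Z => h (X ⊗ Z) _
  · intro h
    refine isGenTerminal_iff_isIso_projObj.2 ((h𝒢 _).2 fun X hX => ?_)
    exact (bijective_projObj_iff X).2 (existsUnique_of_isVTerminal (h X hX))

end Constant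

/-! ### Terminal objects in comma categories of internalizations -/

section Representable

open comma

variable {V : Type u} [Category.{v} V] [CartesianMonoidalCategory V]

theorem VPresheaf.isIso_iff {C : Type v} [EnrichedCategory V C] {F G : VPresheaf V C}
    (α : F ⟶ G) : IsIso α ↔ ∀ A, IsIso (VPresheaf.Hom.app α A) := by
  constructor
  · intro h A
    exact ⟨VPresheaf.Hom.app (inv α) A,
      congrArg (fun β : F ⟶ F => VPresheaf.Hom.app β A) (IsIso.hom_inv_id α),
      congrArg (fun β : G ⟶ G => VPresheaf.Hom.app β A) (IsIso.inv_hom_id α)⟩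
  · intro h
    let β : VPresheaf.Hom G F := ⟨fun A => inv (VPresheaf.Hom.app α A), fun A B => by
      rw [IsIso.comp_inv_eq, Category.assoc, VPresheaf.Hom.natural α,
        ← MonoidalCategory.whiskerLeft_comp_assoc, IsIso.inv_hom_id,
        MonoidalCategory.whiskerLeft_id, Category.id_comp]⟩
    exact ⟨β, VPresheaf.Hom.ext (funext fun A => IsIso.hom_inv_id (VPresheaf.Hom.app α A)),
      VPresheaf.Hom.ext (funext fun A => IsIso.inv_hom_id (VPresheaf.Hom.app α A))⟩

variable [Extensive V]

namespace internalize

variable {C : Type v} [EnrichedCategory V C] {X : V}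

theorem incl_cancel {A B : C} {f g : X ⟶ (A ⟶[V] B)} (h : f ≫ incl A B = g ≫ incl A B) : f = g :=
  factor_unique (fun p : C × C => toUnit (p.1 ⟶[V] p.2)) (j := (A, B)) f g h (toUnit_unique _ _)

variable [HasPullbacks V]

/-- The object of morphisms with constant source `A` and constant target `B` is the hom-object
`C(A, B)`. -/
theorem exists_incl (g : X ⟶ Mor V C) {A B : C} (hs : g ≫ src V C = gel A X)
    (ht : g ≫ tgt V C = gel B X) : ∃ f : X ⟶ (A ⟶[V] B), f ≫ incl A B = g := by
  obtain ⟨g', rfl⟩ := exists_fromSrc g A hs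
  have e : fromSrc A ≫ tgt V C = Limits.Sigma.map fun B : C => toUnit (A ⟶[V] B) := by
    apply Limits.Sigma.hom_ext
    intro B
    rw [← Category.assoc, ι_fromSrc, incl_tgt, Limits.Sigma.ι_map]
  obtain ⟨f, hf, -⟩ := exists_factor (fun B : C => toUnit (A ⟶[V] B)) g' (toUnit X)
    (by rw [← e, ← Category.assoc, ht])
  exact ⟨f, by rw [← ι_fromSrc, ← Category.assoc, hf]⟩

end internalize

variable [HasPullbacks V]
variable {C D : Type v} [EnrichedCategory V C] [EnrichedCategory V D] (H : EnrichedFunctor V C D)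
  {d : D} {L : C} (x : 𝟙_ V ⟶ (H.obj L ⟶[V] d))

/-- The component at `A` of the transformation `C(-, L) ⟶ D(H(-), d)` that corresponds to `x`:
application of `H` followed by composition with `x`. -/
def postcompose (A : C) : (A ⟶[V] L) ⟶ (H.obj A ⟶[V] d) :=
  lift (𝟙 (A ⟶[V] L)) (toUnit _ ≫ x) ≫ H.map A L ▷ _ ≫ eComp V _ _ _

/-- A generalized morphism `u` from `a` to `L` in the internalization of `C` such that the
composite of `H u` with `x` is `f`. -/
def IsMediator {X : V} (a : X ⟶ Ob V C) (f : X ⟶ Mor V D) (u : X ⟶ Mor V C) : Prop :=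
  u ≫ src V C = a ∧ u ≫ tgt V C = gel L X ∧
    ∃ h, m (u ≫ mapMor H) (toUnit X ≫ x ≫ incl (H.obj L) d) h = f

variable {H x}

theorem IsMediator.comp {X Y : V} {a : X ⟶ Ob V C} {f : X ⟶ Mor V D} {u : X ⟶ Mor V C}
    (hu : IsMediator H x a f u) (y : Y ⟶ X) : IsMediator H x (y ≫ a) (y ≫ f) (y ≫ u) := by
  obtain ⟨hs, ht, h, hm⟩ := hu
  have e : toUnit Y ≫ x ≫ incl (H.obj L) d = y ≫ toUnit X ≫ x ≫ incl (H.obj L) d :=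
    (comp_toUnit_assoc _ _).symm
  refine ⟨by rw [Category.assoc, hs], by rw [Category.assoc, ht, comp_toUnit_assoc], ?_⟩
  refine ⟨by rw [e, Category.assoc, Category.assoc, Category.assoc, ← h, Category.assoc], ?_⟩
  rw [← hm, m_nat]
  congr 1
  exact Category.assoc _ _ _

/-- Where the source is constant at `A`, a mediator is a preimage under `postcompose H x A`. -/
theorem isMediator_incl_iff {X : V} {A : C} (f : X ⟶ (H.obj A ⟶[V] d)) (u : X ⟶ (A ⟶[V] L)) :
    IsMediator H x (gel A X) (f ≫ incl (H.obj A) d) (u ≫ incl A L) ↔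
      u ≫ postcompose H x A = f := by
  have e₁ : (u ≫ incl A L) ≫ mapMor H = (u ≫ H.map A L) ≫ incl _ _ := by
    rw [Category.assoc, incl_mapMor, Category.assoc]
  have e₂ : toUnit X ≫ x ≫ incl (H.obj L) d = (toUnit X ≫ x) ≫ incl _ _ :=
    (Category.assoc _ _ _).symm
  have e₃ : u ≫ postcompose H x A =
      lift (u ≫ H.map A L) (toUnit X ≫ x) ≫ eComp V _ _ _ := by
    rw [postcompose, comp_lift_assoc, lift_whiskerRight_assoc, Category.comp_id, comp_toUnit_assoc]
  have hc : ((u ≫ incl A L) ≫ mapMor H) ≫ tgt V D =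
      (toUnit X ≫ x ≫ incl (H.obj L) d) ≫ src V D := by
    rw [e₁, e₂, Category.assoc (u ≫ _), Category.assoc (toUnit X ≫ x), incl_tgt, incl_src,
      comp_toUnit_assoc, comp_toUnit_assoc]
  have hm := (m_spec hc e₁ e₂).trans (Category.assoc _ _ _).symm
  rw [← e₃] at hm
  constructor
  · rintro ⟨-, -, h, hf⟩
    exact incl_cancel (hm.symm.trans hf)
  · rintro rfl
    refine ⟨?_, ?_, hc, hm⟩
    · rw [Category.assoc, incl_src, comp_toUnit_assoc]
    · rw [Category.assoc, incl_tgt, comp_toUnit_assoc]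

theorem isRepresentableBy_iff_existsUnique :
    (VPresheaf.homInto H d).IsRepresentableBy L x ↔ ∀ (X : V) (A : C) (f : X ⟶ (H.obj A ⟶[V] d)),
      ∃! u : X ⟶ Mor V C, IsMediator H x (gel A X) (f ≫ incl (H.obj A) d) u := by
  refine (VPresheaf.isIso_iff _).trans ?_
  change (∀ A, IsIso (postcompose H x A)) ↔ _
  constructor
  · intro h X A f
    have := h A
    refine ⟨(f ≫ inv (postcompose H x A)) ≫ incl A L,
      (isMediator_incl_iff _ _).2 ?_, ?_⟩
    · rw [Category.assoc, IsIso.inv_hom_id, Category.comp_id]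
    · intro u hu
      obtain ⟨u', rfl⟩ := exists_incl u hu.1 hu.2.1
      rw [← (isMediator_incl_iff f u').1 hu, Category.assoc, Category.assoc, IsIso.hom_inv_id_assoc]
  · intro h A
    refine isIso_of_yoneda_map_bijective _ fun X => ⟨?_, ?_⟩
    · intro u u' e
      exact incl_cancel ((h X A _).unique ((isMediator_incl_iff _ u).2 rfl)
        ((isMediator_incl_iff _ u').2 e.symm))
    · intro f
      obtain ⟨u, hu, -⟩ := h X A f
      obtain ⟨u', rfl⟩ := exists_incl u hu.1 hu.2.1
      exact ⟨u', (isMediator_incl_iff f u').1 hu⟩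

/-- By extensivity, a generalized object `a` of the internalization of `C` is locally constant, so
that unique mediators for constant `a` can be glued. -/
theorem existsUnique_isMediator_iff :
    (∀ (X : V) (A : C) (f : X ⟶ (H.obj A ⟶[V] d)),
      ∃! u : X ⟶ Mor V C, IsMediator H x (gel A X) (f ≫ incl (H.obj A) d) u) ↔
    ∀ (X : V) (a : X ⟶ Ob V C) (f : X ⟶ Mor V D), f ≫ src V D = a ≫ mapOb H →
      f ≫ tgt V D = gel d X → ∃! u : X ⟶ Mor V C, IsMediator H x a f u := by
  constructor
  · intro h X a f hs ht
    have hloc (A : C) {T : V} (y : T ⟶ X) (hy : y ≫ a = gel A T) :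
        ∃! u : T ⟶ Mor V C, IsMediator H x (gel A T) (y ≫ f) u := by
      obtain ⟨f', hf'⟩ := exists_incl (y ≫ f) (A := H.obj A) (B := d)
        (by rw [Category.assoc, hs, reassoc_of% hy, el_mapOb])
        (by rw [Category.assoc, ht, comp_toUnit_assoc])
      rw [← hf']
      exact h T A f'
    obtain ⟨W, p, e, he⟩ := exists_decomposition a
    have hW (A : C) : (Limits.Sigma.ι W A ≫ e.hom) ≫ a = gel A (W A) := by
      rw [Category.assoc, he, Limits.Sigma.ι_map, toUnit_unique (p A) (toUnit _)]
    choose u hu _ using fun A => hloc A _ (hW A)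
    have hι (A : C) : (Limits.Sigma.ι W A ≫ e.hom) ≫ e.inv ≫ Limits.Sigma.desc u = u A := by
      rw [Category.assoc, Iso.hom_inv_id_assoc, Limits.Sigma.ι_desc]
    have hext {Z : V} {g g' : X ⟶ Z} (hg : ∀ A, (Limits.Sigma.ι W A ≫ e.hom) ≫ g =
        (Limits.Sigma.ι W A ≫ e.hom) ≫ g') : g = g' := by
      rw [← cancel_epi e.hom]
      apply Limits.Sigma.hom_ext
      intro A
      rw [← Category.assoc, hg, Category.assoc]
    have hc (A : C) : (Limits.Sigma.ι W A ≫ e.hom) ≫ toUnit X ≫ x ≫ incl (H.obj L) d =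
        toUnit (W A) ≫ x ≫ incl (H.obj L) d := comp_toUnit_assoc _ _
    have hm (A : C) : (Limits.Sigma.ι W A ≫ e.hom) ≫ (e.inv ≫ Limits.Sigma.desc u) ≫ mapMor H =
        u A ≫ mapMor H := by rw [← Category.assoc, hι]
    refine ⟨e.inv ≫ Limits.Sigma.desc u, ⟨?_, ?_, ?_, ?_⟩, ?_⟩
    · refine hext fun A => ?_
      rw [← Category.assoc, hι, (hu A).1, hW]
    · refine hext fun A => ?_
      rw [← Category.assoc, hι, (hu A).2.1, comp_toUnit_assoc]
    · refine hext fun A => ?_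
      rw [← Category.assoc, hm, ← Category.assoc (_ ≫ e.hom), hc]
      exact (hu A).2.2.1
    · refine hext fun A => ?_
      rw [m_nat, ← (hu A).2.2.2]
      congr 1
      · exact hm A
      · exact hc A
    · intro u' hu'
      refine hext fun A => ?_
      have := hu'.comp (Limits.Sigma.ι W A ≫ e.hom)
      rw [hW] at this
      rw [hι]
      exact (hloc A _ (hW A)).unique this (hu A)
  · intro h X A f
    refine h X (gel A X) (f ≫ incl (H.obj A) d) ?_ ?_
    · rw [Category.assoc, incl_src, comp_toUnit_assoc, Category.assoc, el_mapOb]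
    · rw [Category.assoc, incl_tgt, comp_toUnit_assoc]

variable [MonoidalClosed V]

theorem toMor_nameOf {B : InternalCat V} (F : InternalFunctor (walkingArrow V) B) :
    walkingArrow.toMor (nameOf F) = walkingArrow.arrow V ≫ F.onMor := by
  change insertElem _ (𝟙_ V) ≫ (internalHom.family (classify (constFamily F _))).onMor = _
  rw [family_classify, constFamily_onMor, insertElem, lift_fst_assoc,
    toUnit_unique (toUnit (𝟙_ V)) (𝟙 _), Category.id_comp]

/-- An object `(L, x)` of the comma internal category `Int H ↓ d` is terminal exactly if the
`V`-functor `D(H(-), d)` is represented by `(L, x)`. -/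
theorem isGenTerminal_internalize_iff (T : 𝟙_ V ⟶ (comma (internalizeMap H) (el d)).obj)
    (hT : T ≫ projObj (internalizeMap H) (el d) = el L)
    (hx : comma.hom T = x ≫ incl (H.obj L) d) :
    IsGenTerminal (comma (internalizeMap H) (el d)) T ↔
      (VPresheaf.homInto H d).IsRepresentableBy L x := by
  refine (comma.isGenTerminal_iff T).trans (Iff.trans ?_
    (isRepresentableBy_iff_existsUnique.trans existsUnique_isMediator_iff).symm)
  refine forall_congr' fun X => forall_congr' fun a => forall_congr' fun f =>
    imp_congr_right fun _ => imp_congr_right fun _ => existsUnique_congr fun u => ?_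
  have e₁ : (toUnit X ≫ T) ≫ projObj (internalizeMap H) (el d) = gel L X :=
    (Category.assoc _ _ _).trans (_ ≫= hT)
  have e₂ : comma.hom (toUnit X ≫ T) = toUnit X ≫ x ≫ incl (H.obj L) d :=
    (comma.comp_hom _ _).symm.trans (_ ≫= hx)
  have e₃ (h) (h') : (internalize V D).comp (u ≫ mapMor H) (comma.hom (toUnit X ≫ T)) h =
      m (u ≫ mapMor H) (toUnit X ≫ x ≫ incl (H.obj L) d) h' :=
    ((internalize V D).comp_congr rfl e₂ _).trans (internalize.comp_eq _ _ _)
  refine and_congr_right fun _ => ⟨?_, ?_⟩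
  · rintro ⟨ht, hf⟩
    exact ⟨ht.trans e₁, e₂ ▸ composable ht, (e₃ _ _).symm.trans hf⟩
  · rintro ⟨ht, h, hf⟩
    exact ⟨ht.trans e₁.symm, (e₃ _ _).trans hf⟩

end Representable

/-! ### Conical limits as terminal cones -/

section Cones

variable {V : Type u} [Category.{v} V] [CartesianMonoidalCategory V] [MonoidalClosed V]
  [HasPullbacks V] [Extensive V] {I C : Type v} [EnrichedCategory V I] [EnrichedCategory V C]
  [HasFunctorHoms V I C] (G : EnrichedFunctor V I C) (L : C)
  (lam : VNatTrans (constFunctor V I L) G)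

theorem isGenTerminal_coneElem_iff :
    IsGenTerminal (coneCat G) (coneElem G L lam) ↔ IsConicalLimit G L lam := by
  refine isGenTerminal_internalize_iff (H := diagonal V I C) (x := lam.elt) (coneElem G L lam)
    (pullback.lift_fst _ _ _) ?_
  refine (congrArg walkingArrow.toMor (pullback.lift_snd _ _ _)).trans ((toMor_nameOf _).trans ?_)
  exact incl_mapMor (Two.functor lam.elt) Two.zero Two.one

end Cones

end EnrInt

theorem mainTheorem12 {V : Type u} [Category.{v} V] [CartesianMonoidalCategory V]
    [MonoidalClosed V] [HasPullbacks V] [Extensive V]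
    {I C : Type v} [EnrichedCategory V I] [EnrichedCategory V C] [HasFunctorHoms V I C]
    (G : EnrichedFunctor V I C) (L : C) (lam : VNatTrans (constFunctor V I L) G)
    (𝒢 : Set V) (h𝒢 : IsConservative 𝒢) :
    List.TFAE
      [IsConicalLimit G L lam,
       IsInternalTerminal (coneCat G) (coneElem G L lam),
       ∀ X ∈ 𝒢, IsVTerminal V
        (⟨constElem (coneCat G) (coneElem G L lam) X⟩ : Und (internalHom (cst X) (coneCat G)))] := by
  have h₁ := isGenTerminal_coneElem_iff G L lam
  have h₂ := isInternalTerminal_iff_isGenTerminal (T := coneElem G L lam)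
  have h₃ := isGenTerminal_iff_isVTerminal 𝒢 h𝒢 (coneElem G L lam)
  tfae_have 1 ↔ 2 := h₁.symm.trans h₂.symm
  tfae_have 2 ↔ 3 := h₂.trans h₃
  tfae_finish
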